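/- Let $\Lambda\subset\mathbb C$ be a lattice with $\mathbb Z$-basis $\omega_1,\omega_2$, let $T=\mathbb C/\Lambda$, let $N\ge 1$, and let $D_N=\langle r,s : r^N=s^2=(sr)^2=1\rangle=C_2\ltimes C_N$ (so $D_1=C_2$). Let $\rho:D_N\to\mathrm{Aut}(\mathfrak{sl}_2(\mathbb C))$ be an injective homomorphism into the Lie algebra automorphisms, and let $\sigma:D_N\to\mathrm{Aut}(T)$ be an injective homomorphism into the biholomorphisms of $T$ with $\sigma(s)z=-z$ and $\sigma(r)z=z+\alpha$ for some $\alpha\in\mathbb C$ (taken modulo $\Lambda$; by injectivity its class has order exactly $N$ in $T$). Put $\mathbb T=T\setminus\sigma(D_N)\cdot 0$ and let $\mathcal O_{\mathbb T}$ be the algebra of meromorphic functions on $T$ that are holomorphic on $\mathbb T$. Let $D_N$ act on $\mathcal O_{\mathbb T}$ by $\tilde\sigma(\gamma)f=f\circ\sigma(\gamma)^{-1}$ and on the Lie algebra $\mathfrak{sl}_2\otimes_{\mathbb C}\mathcal O_{\mathbb T}$ by $\gamma\cdot(A\otimes f)=\rho(\gamma)A\otimes\tilde\sigma(\gamma)f$,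 and let $\mathfrak A=(\mathfrak{sl}_2\otimes_{\mathbb C}\mathcal O_{\mathbb T})^{D_N}$ be the automorphic Lie algebra of invariants. For $\tau$ in the upper half plane $\mathbb H$ let $\mathfrak S_\tau=\mathbb C\langle E,F,H\rangle\otimes_{\mathbb C}\mathbb C[x]$ with the $\mathbb C[x]$-linear bracket determined by $[H,E]=2E$, $[H,F]=-2F$, $[E,F]=H\otimes(4x^3-g_2x-g_3)$, where $g_2,g_3$ are the elliptic invariants of $\mathbb Z\oplus\mathbb Z\tau$. Then $\Lambda'=\Lambda+\mathbb Z\alpha$ is a lattice, and, writing $\wp=\wp_{\Lambda'}$, $g_i=g_i(\Lambda')$: (1) There is $\tau\in\mathbb H$ such that $\Lambda'$ is homothetic to $\mathbb Z\oplus\mathbb Z\tau$ (so that $\mathbb C/\Lambda'\cong\mathbb C/(\mathbb Z\oplus\mathbb Z\tau)$) and $\mathfrak A\cong\mathfrak S_\tau$ as complex Lie algebras. (2) $\mathcal O_{\mathbb T}^{D_N}=\mathbb C[\wp]$, and $\mathfrak A$ has the normal form $$\mathfrak A=\mathbb C\langle\tilde E,\tilde F,\tilde H\rangle\otimes_{\mathbb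 C}\mathbb C[\wp],\qquad \tilde E=E\otimes\wp',\quad \tilde F=F\otimes\wp',\quad \tilde H=H,$$ that is, $\tilde E,\tilde F,\tilde H$ is a basis of $\mathfrak A$ over $\mathbb C[\wp]$, with $$[\tilde H,\tilde E]=2\tilde E,\qquad[\tilde H,\tilde F]=-2\tilde F,\qquad[\tilde E,\tilde F]=\tilde H\otimes(4\wp^3-g_2\wp-g_3).$$ Here $E,F,H\in\mathfrak{sl}_2\otimes\mathcal O_{\mathbb T}$ are the functions $z\mapsto B\,\mathrm{Ad}(\Phi(z))x$ with $x=e,f,h$ respectively, where $e=\begin{pmatrix}0&1\\0&0\end{pmatrix}$, $f=\begin{pmatrix}0&0\\1&0\end{pmatrix}$, $h=\begin{pmatrix}1&0\\0&-1\end{pmatrix}$, for some $B\in\mathrm{Aut}(\mathfrak{sl}_2)$ and some $\Phi$ of the following form. If $N=1$, then $\Phi=1$. If $N\ge2$, let $(M,\hat\Lambda)=(N,\Lambda)$ for $N$ odd; for $N$ even let $M=2N$, and let $\hat\Lambda=\mathbb Z\omega_1\oplus\mathbb Z2\omega_2$ if $N\alpha/2\equiv\omega_2/2$ modulo $\Lambda$,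 and $\hat\Lambda=\mathbb Z2\omega_1\oplus\mathbb Z\omega_2$ otherwise. Put $$P_i(z)=\sum_{k=0}^{M-1}e^{-2\pi\mathrm i\,ki/M}\,\frac{\wp_{\hat\Lambda}'(z-k\alpha)}{\wp_{\hat\Lambda}(z-k\alpha)-\wp_{\hat\Lambda}(\alpha)}\qquad(i\in\mathbb Z).$$ Then, for some integer $j$ prime to $N$ and constants $\lambda,\mu\in\mathbb C$ with $\mu\ne0$ and $P_{2j}P_{-j}^2-P_{-2j}P_j^2=\lambda P_{-j}P_j+\mu$, $$\Phi=\begin{pmatrix}P_{-j}&\frac1\mu P_jP_{-2j}+\frac{\lambda}{2\mu}P_{-j}\\[2pt] P_j&\frac1\mu P_{-j}P_{2j}-\frac{\lambda}{2\mu}P_j\end{pmatrix}.$$ -/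

import Mathlib

open scoped TensorProduct Topology Polynomial
open Polynomial

noncomputable section

/-! ### `𝔰𝔩₂` and its automorphism group -/

/-- The Lie algebra `𝔰𝔩₂(ℂ)` of traceless complex `2 × 2` matrices. -/
abbrev Sl2 : Type := LieAlgebra.SpecialLinear.sl (Fin 2) ℂ

namespace Sl2

/-- Build an element of `𝔰𝔩₂(ℂ)` from a matrix of trace zero. -/
def ofMatrix (A : Matrix (Fin 2) (Fin 2) ℂ) (h : A.trace = 0) : Sl2 :=
  ⟨A, LinearMap.mem_ker.2 h⟩

/-- The standard basis element `e`. -/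
def e : Sl2 := ofMatrix !![0, 1; 0, 0] (by simp [Matrix.trace_fin_two])

/-- The standard basis element `f`. -/
def f : Sl2 := ofMatrix !![0, 0; 1, 0] (by simp [Matrix.trace_fin_two])

/-- The standard basis element `h`. -/
def h : Sl2 := ofMatrix !![1, 0; 0, -1] (by simp [Matrix.trace_fin_two])

/-- The group `Aut(𝔰𝔩₂)` of Lie algebra automorphisms. -/
def Aut : Subgroup (Sl2 ≃ₗ[ℂ] Sl2) where
  carrier := {g | ∀ x y : Sl2, g ⁅x, y⁆ = ⁅g x, g y⁆}
  one_mem' := fun _ _ => rfl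
  mul_mem' := by
    intro a b ha hb x y
    change ∀ x y : Sl2, a ⁅x, y⁆ = ⁅a x, a y⁆ at ha
    change ∀ x y : Sl2, b ⁅x, y⁆ = ⁅b x, b y⁆ at hb
    rw [LinearEquiv.mul_apply, LinearEquiv.mul_apply, LinearEquiv.mul_apply, hb, ha]
  inv_mem' := by
    intro a ha x y
    change ∀ x y : Sl2, a ⁅x, y⁆ = ⁅a x, a y⁆ at ha
    apply a.injective
    have hr : ∀ z, a (a⁻¹ z) = z := fun z => a.apply_symm_apply z
    rw [ha, hr, hr, hr]

/-- An automorphism of `𝔰𝔩₂`, as a homomorphism of Lie algebras. -/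
def Aut.toLieHom (g : Aut) : Sl2 →ₗ⁅ℂ⁆ Sl2 :=
  { (g.1 : Sl2 →ₗ[ℂ] Sl2) with map_lie' := fun {x y} => g.2 x y }

/-- The adjoint action `x ↦ A x A⁻¹` of an invertible matrix on `𝔰𝔩₂`. -/
def Ad (A : Matrix (Fin 2) (Fin 2) ℂ) (x : Sl2) : Sl2 :=
  ofMatrix (A * x.1 * A⁻¹) (by
    have hx : x.1.trace = 0 := LinearMap.mem_ker.1 x.2
    rw [Matrix.trace_mul_cycle]
    by_cases hA : IsUnit A.det
    · rw [Matrix.nonsing_inv_mul A hA, one_mul, hx]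
    · rw [Matrix.nonsing_inv_apply_not_isUnit A hA]; simp)

end Sl2

/-! ### Complex tori, their automorphisms and functions -/

/-- The complex torus `T = ℂ / Λ`. -/
abbrev Torus (L : PeriodPair) : Type := ℂ ⧸ L.lattice

/-- The canonical projection `ℂ → ℂ / Λ`. -/
def Torus.mk (L : PeriodPair) (z : ℂ) : Torus L := Submodule.Quotient.mk z

/-- A self-map of the torus is holomorphic if near every point it is induced by a holomorphic
function of the coordinate `z ∈ ℂ`. -/
def Torus.IsHolomorphic (L : PeriodPair) (u : Torus L → Torus L) : Prop :=
  ∀ z : ℂ, ∃ φ : ℂ → ℂ, AnalyticAt ℂ φ z ∧ ∀ᶠ w in 𝓝 z, u (Torus.mk L w) = Torus.mk L (φ w)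

theorem Torus.IsHolomorphic.comp {L : PeriodPair} {u v : Torus L → Torus L}
    (hu : Torus.IsHolomorphic L u) (hv : Torus.IsHolomorphic L v) :
    Torus.IsHolomorphic L (u ∘ v) := by
  intro z
  obtain ⟨φ, hφ, hφ'⟩ := hv z
  obtain ⟨ψ, hψ, hψ'⟩ := hu (φ z)
  refine ⟨ψ ∘ φ, hψ.comp hφ, ?_⟩
  filter_upwards [hφ', hφ.continuousAt.eventually hψ'] with w h1 h2
  simp only [Function.comp_apply]
  rw [h1, h2]

theorem Torus.IsHolomorphic.id (L : PeriodPair) :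
    Torus.IsHolomorphic L (fun z => z) :=
  fun _ => ⟨fun w => w, analyticAt_id, Filter.Eventually.of_forall fun _ => rfl⟩

/-- The group `Aut(T)` of biholomorphic maps of the torus. -/
def Torus.Aut (L : PeriodPair) : Subgroup (Equiv.Perm (Torus L)) where
  carrier := {u | Torus.IsHolomorphic L u ∧ Torus.IsHolomorphic L u.symm}
  one_mem' := ⟨Torus.IsHolomorphic.id L, Torus.IsHolomorphic.id L⟩
  mul_mem' := by
    intro a b ha hb
    exact ⟨ha.1.comp hb.1, hb.2.comp ha.2⟩
  inv_mem' := by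
    intro a ha
    exact ⟨ha.2, ha.1⟩

/-- The algebra of meromorphic functions on `T` that are holomorphic on `T ∖ S`, realised as
functions on `T ∖ S`: near every point `x` of `ℂ`, the pull-back of such a function to `ℂ` agrees
off the punctures with a function that is meromorphic at `x`, and analytic at `x` if `x` does not
lie over a puncture. -/
def regularFunctions (L : PeriodPair) (S : Set (Torus L)) :
    Subalgebra ℂ ({z : Torus L // z ∉ S} → ℂ) where
  carrier := {f | ∀ x : ℂ, ∃ F : ℂ → ℂ, MeromorphicAt F x ∧
    (Torus.mk L x ∉ S → AnalyticAt ℂ F x) ∧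
    ∀ᶠ w in 𝓝 x, ∀ hw : Torus.mk L w ∉ S, f ⟨Torus.mk L w, hw⟩ = F w}
  mul_mem' := by
    intro f g hf hg x
    obtain ⟨F, hF, hF', hF''⟩ := hf x
    obtain ⟨G, hG, hG', hG''⟩ := hg x
    refine ⟨F * G, hF.mul hG, fun hx => (hF' hx).mul (hG' hx), ?_⟩
    filter_upwards [hF'', hG''] with w h1 h2 hw
    simp [h1 hw, h2 hw]
  add_mem' := by
    intro f g hf hg x
    obtain ⟨F, hF, hF', hF''⟩ := hf x
    obtain ⟨G, hG, hG', hG''⟩ := hg x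
    refine ⟨F + G, hF.add hG, fun hx => (hF' hx).add (hG' hx), ?_⟩
    filter_upwards [hF'', hG''] with w h1 h2 hw
    simp [h1 hw, h2 hw]
  algebraMap_mem' := by
    intro c x
    exact ⟨fun _ => c, MeromorphicAt.const c x, fun _ => analyticAt_const,
      Filter.Eventually.of_forall fun _ _ => rfl⟩

/-! ### Automorphic Lie algebras -/

section AutomorphicLieAlgebra

variable {L : PeriodPair} {Γ : Type} [Group Γ]

/-- The set of punctures: the orbit `Γ · 0` in `T`. -/
def punctures (σ : Γ →* Torus.Aut L) : Set (Torus L) :=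
  Set.range fun γ : Γ => (σ γ).1 0

theorem apply_inv_notMem_punctures (σ : Γ →* Torus.Aut L) (γ : Γ) {z : Torus L}
    (hz : z ∉ punctures σ) : (σ γ⁻¹).1 z ∉ punctures σ := by
  rintro ⟨δ, hδ⟩
  refine hz ⟨γ * δ, ?_⟩
  have h1 : (σ γ).1 ((σ γ⁻¹).1 z) = z := by
    have h2 : (σ γ * σ γ⁻¹) = 1 := by rw [← map_mul, mul_inv_cancel, map_one]
    have h3 := congrArg (fun u : Torus.Aut L => u.1 z) h2
    exact h3
  have h4 : (σ γ).1 ((σ δ).1 0) = (σ γ).1 ((σ γ⁻¹).1 z) := congrArg _ hδ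
  rw [h1] at h4
  change (σ (γ * δ)).1 0 = z
  rw [map_mul]
  exact h4

/-- The punctured torus `𝕋 = T ∖ Γ · 0`. -/
abbrev PuncturedTorus (σ : Γ →* Torus.Aut L) : Type := {z : Torus L // z ∉ punctures σ}

/-- The algebra `𝒪_𝕋`. -/
abbrev RegFun (σ : Γ →* Torus.Aut L) : Type := regularFunctions L (punctures σ)

/-- The action `(γ f)(z) = f(σ(γ)⁻¹ z)` of `Γ` on `𝒪_𝕋`. -/
def RegFun.act (σ : Γ →* Torus.Aut L) (γ : Γ) : RegFun σ →ₐ[ℂ] RegFun σ where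
  toFun f := ⟨fun z => f.1 ⟨(σ γ⁻¹).1 z.1, apply_inv_notMem_punctures σ γ z.2⟩, by
    intro x
    obtain ⟨φ, hφ, hφ'⟩ := (σ γ⁻¹).2.1 x
    obtain ⟨F, hF, hF', hF''⟩ := f.2 (φ x)
    refine ⟨F ∘ φ, hF.comp_analyticAt hφ, fun hx => AnalyticAt.comp (hF' ?_) hφ, ?_⟩
    · rw [← hφ'.self_of_nhds]
      exact apply_inv_notMem_punctures σ γ hx
    · filter_upwards [hφ', hφ.continuousAt.eventually hF''] with w h1 h2 hw
      have h3 := apply_inv_notMem_punctures σ γ hw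
      rw [h1] at h3
      have h4 := h2 h3
      simp only [Function.comp_apply]
      rw [← h4]
      exact congrArg f.1 (Subtype.ext h1)⟩
  map_one' := rfl
  map_mul' _ _ := rfl
  map_zero' := rfl
  map_add' _ _ := rfl
  commutes' _ := rfl

/-- The algebra of invariants `𝒪_𝕋^Γ`. -/
def RegFun.invariants (σ : Γ →* Torus.Aut L) : Subalgebra ℂ (RegFun σ) where
  carrier := {f | ∀ γ : Γ, RegFun.act σ γ f = f}
  mul_mem' := by
    intro f g hf hg γ
    rw [map_mul, hf γ, hg γ]
  add_mem' := by
    intro f g hf hg γ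
    rw [map_add, hf γ, hg γ]
  algebraMap_mem' := fun c γ => AlgHom.commutes _ c

/-- The current algebra `𝔰𝔩₂ ⊗ 𝒪_𝕋`, with bracket `[f ⊗ A, g ⊗ B] = fg ⊗ [A, B]`
(the scalar ring is written on the left). -/
abbrev CurrentAlgebra (σ : Γ →* Torus.Aut L) : Type := RegFun σ ⊗[ℂ] Sl2

/-- The diagonal action `γ · (A ⊗ f) = ρ(γ) A ⊗ γ f` of `Γ` on the current algebra. -/
def CurrentAlgebra.act (ρ : Γ →* Sl2.Aut) (σ : Γ →* Torus.Aut L) (γ : Γ) :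
    CurrentAlgebra σ →ₗ⁅ℂ⁆ CurrentAlgebra σ :=
  LieAlgebra.ExtendScalars.map (RegFun.act σ γ) (Sl2.Aut.toLieHom (ρ γ))

/-- The automorphic Lie algebra `(𝔰𝔩₂ ⊗ 𝒪_𝕋)^Γ`. -/
def automorphicLieAlgebra (ρ : Γ →* Sl2.Aut) (σ : Γ →* Torus.Aut L) :
    LieSubalgebra ℂ (CurrentAlgebra σ) where
  carrier := {a | ∀ γ : Γ, CurrentAlgebra.act ρ σ γ a = a}
  add_mem' := by
    intro a b ha hb γ
    rw [map_add, ha γ, hb γ]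
  zero_mem' := fun γ => map_zero _
  smul_mem' := by
    intro c a ha γ
    rw [map_smul, ha γ]
  lie_mem' := by
    intro a b ha hb γ
    rw [LieHom.map_lie, ha γ, hb γ]

/-- The value in `𝔰𝔩₂` of an element of the current algebra at a point of `𝕋`:
`A ⊗ f ↦ f(z) A`. -/
def CurrentAlgebra.eval (σ : Γ →* Torus.Aut L) (z : PuncturedTorus σ) :
    CurrentAlgebra σ →ₗ[ℂ] Sl2 :=
  (TensorProduct.lid ℂ Sl2).toLinearMap ∘ₗ
    LinearMap.rTensor Sl2
      ((LinearMap.proj z : (PuncturedTorus σ → ℂ) →ₗ[ℂ] ℂ) ∘ₗ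
        (regularFunctions L (punctures σ)).val.toLinearMap)

/-- `E, F, H` is a normal form of the automorphic Lie algebra `𝔄`, with structure function `p`:
`𝔄 = ℂ⟨E, F, H⟩ ⊗ 𝒪_𝕋^Γ`, that is, `E, F, H` is a basis of `𝔄` over `𝒪_𝕋^Γ`, and
`[H, E] = 2E`, `[H, F] = -2F`, `[E, F] = H ⊗ p` with `p ∈ 𝒪_𝕋^Γ`. -/
structure IsNormalForm (ρ : Γ →* Sl2.Aut) (σ : Γ →* Torus.Aut L)
    (E F H : CurrentAlgebra σ) (p : RegFun σ) : Prop where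
  mem_E : E ∈ automorphicLieAlgebra ρ σ
  mem_F : F ∈ automorphicLieAlgebra ρ σ
  mem_H : H ∈ automorphicLieAlgebra ρ σ
  mem_p : p ∈ RegFun.invariants σ
  existsUnique_coeff : ∀ X ∈ automorphicLieAlgebra ρ σ,
    ∃! c : Fin 3 → RegFun.invariants σ,
      X = (c 0 : RegFun σ) • E + (c 1 : RegFun σ) • F + (c 2 : RegFun σ) • H
  lie_H_E : ⁅H, E⁆ = (2 : ℂ) • E
  lie_H_F : ⁅H, F⁆ = (-2 : ℂ) • F
  lie_E_F : ⁅E, F⁆ = p • H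

end AutomorphicLieAlgebra

/-! ### The Lie algebras `𝔖_τ` -/

/-- The Lie algebra `ℂ⟨E, F, H⟩ ⊗ ℂ[x]` with the `ℂ[x]`-linear bracket determined by
`[H, E] = 2E`, `[H, F] = -2F`, `[E, F] = H ⊗ p`. The element `E ⊗ a + F ⊗ b + H ⊗ c` is the
function with values `a, b, c` at `0, 1, 2`. -/
def TwistedCurrent (_p : ℂ[X]) : Type := Fin 3 → ℂ[X]

namespace TwistedCurrent

variable (p : ℂ[X])

instance : AddCommGroup (TwistedCurrent p) := inferInstanceAs (AddCommGroup (Fin 3 → ℂ[X]))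

instance : Module ℂ (TwistedCurrent p) := inferInstanceAs (Module ℂ (Fin 3 → ℂ[X]))

instance : Bracket (TwistedCurrent p) (TwistedCurrent p) where
  bracket u v :=
    (![2 * (u 2 * v 0 - u 0 * v 2), -2 * (u 2 * v 1 - u 1 * v 2),
      p * (u 0 * v 1 - u 1 * v 0)] : Fin 3 → ℂ[X])

theorem lie_apply_zero (u v : TwistedCurrent p) :
    ⁅u, v⁆ 0 = 2 * (u 2 * v 0 - u 0 * v 2) := rfl

theorem lie_apply_one (u v : TwistedCurrent p) :
    ⁅u, v⁆ 1 = -2 * (u 2 * v 1 - u 1 * v 2) := rfl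

theorem lie_apply_two (u v : TwistedCurrent p) :
    ⁅u, v⁆ 2 = p * (u 0 * v 1 - u 1 * v 0) := rfl

theorem ext_three {u v : TwistedCurrent p} (h0 : u 0 = v 0) (h1 : u 1 = v 1) (h2 : u 2 = v 2) :
    u = v := by
  funext i
  fin_cases i
  exacts [h0, h1, h2]

theorem add_apply (u v : TwistedCurrent p) (i : Fin 3) : (u + v) i = u i + v i := rfl

theorem smul_apply (c : ℂ) (u : TwistedCurrent p) (i : Fin 3) : (c • u) i = c • u i := rfl

theorem zero_apply (i : Fin 3) : (0 : TwistedCurrent p) i = 0 := rfl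

instance : LieRing (TwistedCurrent p) where
  add_lie u v w := by
    apply ext_three <;> simp only [lie_apply_zero, lie_apply_one, lie_apply_two, add_apply] <;> ring
  lie_add u v w := by
    apply ext_three <;> simp only [lie_apply_zero, lie_apply_one, lie_apply_two, add_apply] <;> ring
  lie_self u := by
    apply ext_three <;> simp only [lie_apply_zero, lie_apply_one, lie_apply_two, zero_apply] <;> ring
  leibniz_lie u v w := by
    apply ext_three <;>
      simp only [lie_apply_zero, lie_apply_one, lie_apply_two, add_apply] <;> ring

instance : LieAlgebra ℂ (TwistedCurrent p) where
  lie_smul c u v := by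
    apply ext_three <;>
      simp only [lie_apply_zero, lie_apply_one, lie_apply_two, smul_apply, Polynomial.smul_eq_C_mul] <;>
      ring

end TwistedCurrent

/-- The pair of periods `(1, τ)`, which spans the lattice `ℤ ⊕ ℤτ`. -/
def tauPair (τ : UpperHalfPlane) : PeriodPair where
  ω₁ := 1
  ω₂ := (τ : ℂ)
  indep := by
    rw [LinearIndependent.pair_iff]
    intro a b hab
    have him := congrArg Complex.im hab
    have hre := congrArg Complex.re hab
    have hτ : (τ : ℂ).im ≠ 0 := ne_of_gt τ.im_pos
    simp only [Complex.real_smul, mul_one, Complex.add_im, Complex.ofReal_im, Complex.mul_im,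
      Complex.ofReal_re, zero_mul, add_zero, zero_add, Complex.zero_im, mul_eq_zero] at him
    have hb : b = 0 := him.resolve_right hτ
    subst hb
    simpa using hre

/-- The polynomial `4x³ - g₂(Λ) x - g₃(Λ)`. -/
def PeriodPair.cubic (L : PeriodPair) : ℂ[X] :=
  4 * X ^ 3 - C L.g₂ * X - C L.g₃

/-- The Lie algebra `𝔖_τ`. -/
abbrev STau (τ : UpperHalfPlane) : Type := TwistedCurrent (tauPair τ).cubic

/-! ### The intertwiners `Φ_j` -/

/-- The pair of periods `(2ω₁, ω₂)`. -/
def PeriodPair.double₁ (L : PeriodPair) : PeriodPair where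
  ω₁ := 2 * L.ω₁
  ω₂ := L.ω₂
  indep := by
    have h := LinearIndependent.pair_iff.1 L.indep
    rw [LinearIndependent.pair_iff]
    intro a b hab
    have := h (a * 2) b (by
      rw [← hab]; simp only [Complex.real_smul]; push_cast; ring)
    exact ⟨by linarith [this.1], this.2⟩

/-- The pair of periods `(ω₁, 2ω₂)`. -/
def PeriodPair.double₂ (L : PeriodPair) : PeriodPair where
  ω₁ := L.ω₁
  ω₂ := 2 * L.ω₂
  indep := by
    have h := LinearIndependent.pair_iff.1 L.indep
    rw [LinearIndependent.pair_iff]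
    intro a b hab
    have := h a (b * 2) (by
      rw [← hab]; simp only [Complex.real_smul]; push_cast; ring)
    exact ⟨this.1, by linarith [this.2]⟩

open Classical in
/-- The lattice `Λ̂ ⊆ Λ` on which the intertwiner lives: `Λ̂ = Λ` for odd `N`; for even `N`, it is
`ℤω₁ ⊕ ℤ2ω₂` if `Nα/2 ≡ ω₂/2` modulo `Λ`, and `ℤ2ω₁ ⊕ ℤω₂` if `Nα/2` is congruent to `ω₁/2` or
`(ω₁ + ω₂)/2`. -/
def PeriodPair.hat (L : PeriodPair) (N : ℕ) (α : ℂ) : PeriodPair :=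
  if Odd N then L
  else if (N : ℂ) * α / 2 - L.ω₂ / 2 ∈ L.lattice then L.double₂
  else L.double₁

/-- The order of the translation by `α` on `ℂ / Λ̂`: it is `N` for odd `N`, and `2N` for
even `N`. -/
def hatOrder (N : ℕ) : ℕ := if Odd N then N else 2 * N

/-- The primitive root of unity `ω_M = exp(2πi/M)`. -/
def rootOfUnity (M : ℕ) : ℂ := Complex.exp (2 * Real.pi * Complex.I / M)

/-- The function
`P_j(z) = ∑_{k=0}^{M-1} ω_M^{-kj} ℘'(z - kα) / (℘(z - kα) - ℘(α))`. -/
def PeriodPair.P (L : PeriodPair) (M : ℕ) (α : ℂ) (j : ℤ) (z : ℂ) : ℂ :=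
  ∑ k ∈ Finset.range M, rootOfUnity M ^ (-((k : ℤ) * j)) *
    (L.derivWeierstrassP (z - k * α) / (L.weierstrassP (z - k * α) - L.weierstrassP α))

/-- The matrix `Φ_j(z)` with parameters `l` and `m`, the constants called `λ` and `μ` in
`P_{2j} P_{-j}² - P_{-2j} P_j² = λ P_{-j} P_j + μ`. -/
def PeriodPair.phiMatrix (L : PeriodPair) (M : ℕ) (α : ℂ) (j : ℤ) (l m : ℂ) (z : ℂ) :
    Matrix (Fin 2) (Fin 2) ℂ :=
  let P := fun i : ℤ => L.P M α i z
  !![P (-j), 1 / m * (P j * P (-2 * j)) + l / (2 * m) * P (-j);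
     P j, 1 / m * (P (-j) * P (2 * j)) - l / (2 * m) * P j]

/-- `Φ` is one of the intertwiners attached to the translation by `α`, of order `N` on `ℂ / Λ`:
the identity if `N = 1`, and otherwise a matrix `Φ_j` for the lattice `Λ̂` with `j` prime to `N`,
where `λ, μ` are the constants with `P_{2j} P_{-j}² - P_{-2j} P_j² = λ P_{-j} P_j + μ`
(an identity of functions off the poles, that is, off `Λ + ℤα`). -/
def IsIntertwiner (L : PeriodPair) (N : ℕ) (α : ℂ)
    (Φ : ℂ → Matrix (Fin 2) (Fin 2) ℂ) : Prop :=
  (N = 1 ∧ Φ = fun _ => 1) ∨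
  (2 ≤ N ∧ ∃ j : ℤ, IsCoprime j (N : ℤ) ∧ ∃ l m : ℂ, m ≠ 0 ∧
    (∀ z : ℂ, z ∉ L.lattice ⊔ Submodule.span ℤ {α} →
      (L.hat N α).P (hatOrder N) α (2 * j) z * (L.hat N α).P (hatOrder N) α (-j) z ^ 2
        - (L.hat N α).P (hatOrder N) α (-2 * j) z * (L.hat N α).P (hatOrder N) α j z ^ 2
      = l * ((L.hat N α).P (hatOrder N) α (-j) z * (L.hat N α).P (hatOrder N) α j z) + m) ∧
    Φ = (L.hat N α).phiMatrix (hatOrder N) α j l m)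

end

/-! Write Λ' = Λ + ℤα. Everything rests on a matrix function Φ that untwists the action
(`PeriodPair.IsFrame`): off Λ' it is holomorphic with constant nonzero determinant, it is Λ-periodic
up to sign, Φ(z + α) = DΦ(z) and Φ(-z) = SΦ(z)diag(-1, 1), where Ad D and Ad S are ρ(r) and ρ(s) up
to one common conjugation. An invariant X is then Ad(Φ)Y with Y elliptic for Λ', without poles off
Λ', and Y(-z) = Ad(diag(-1, 1))Y(z). So the h-coordinate of Y is even, a polynomial in ℘, and the e-
and f-coordinates are odd, ℘' times a polynomial in ℘ (`exists_polynomial_of_even`,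
`exists_polynomial_of_odd`). This is the normal form, and its structure function is ℘'² = 4℘³ - g₂℘
- g₃.

The entries of Φ come from the functions P_i, discrete Fourier transforms over the translates by kα
of the logarithmic derivative of ℘ - ℘(α). Translation by α multiplies P_i by ω^(-i), and for M ∤ i
its poles are simple and lie exactly at Λ' (`order_P`). The relation defining λ and μ
(`exists_relation`) says precisely that det Φ = 1; μ ≠ 0 because functions P_i with different
multipliers have no common zero.

On the algebraic side every automorphism of 𝔰𝔩₂ is inner (`adHom_surjective`), and a faithful
dihedral action with N ≥ 2 is conjugate to the one sending r to Ad diag(ω^j, ω^(-j)) and s to Ad of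
the swap (`exists_conj_of_two_le`). For even N a lift of ρ(r) to SL₂ has order 2N, which is why Φ
lives on the double cover given by Λ̂.

The analytic engine is Liouville's theorem in the form
`HasUnitaryMultipliers.meromorphicOrderAt_eq_zero`, applied to products in which every pole is
cancelled by a known zero; it replaces counting zeros and poles by contour integrals. Part (1)
follows from the normal form by rescaling to a homothetic lattice ℤ ⊕ ℤτ. -/

noncomputable section

/-! ### Liouville's theorem for functions with unitary multipliers -/

/-- `f` is multiplied by a constant of absolute value one under translation by each period. -/
def PeriodPair.HasUnitaryMultipliers (L : PeriodPair) (f : ℂ → ℂ) : Prop :=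
  ∀ l ∈ L.lattice, ∃ c : ℂ, ‖c‖ = 1 ∧ ∀ z, f (z + l) = c * f z

namespace PeriodPair

variable (L : PeriodPair)

theorem exists_bound_forall_exists_sub_mem_lattice :
    ∃ R : ℝ, ∀ z : ℂ, ∃ l ∈ L.lattice, ‖z - l‖ ≤ R := by
  obtain ⟨R, hR⟩ := (ZSpan.fundamentalDomain_isBounded L.basis).exists_norm_le
  refine ⟨R, fun z => ⟨ZSpan.floor L.basis z, ?_, hR _ (ZSpan.fract_mem_fundamentalDomain L.basis z)⟩⟩
  rw [L.lattice_eq_span_range_basis]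
  exact (ZSpan.floor L.basis z).2

/-- Unitary multipliers leave the absolute value periodic, so a bound on a compact set meeting every
class modulo the lattice is a global bound. -/
theorem exists_const_of_differentiable_of_multipliers {g : ℂ → ℂ} (hg : Differentiable ℂ g)
    (hm : ∀ l ∈ L.lattice, ∃ c : ℂ, ‖c‖ = 1 ∧ ∀ z, g (z + l) = c * g z) :
    ∃ c, ∀ z, g z = c := by
  refine hg.exists_const_forall_eq_of_bounded ?_
  obtain ⟨R, hR⟩ := L.exists_bound_forall_exists_sub_mem_lattice
  obtain ⟨K, hK⟩ := (isCompact_closedBall (0 : ℂ) R).exists_bound_of_continuousOn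
    hg.continuous.continuousOn
  refine isBounded_iff_forall_norm_le.2 ⟨K, ?_⟩
  rintro _ ⟨z, rfl⟩
  obtain ⟨l, hl, hz⟩ := hR z
  obtain ⟨c, hc, hcz⟩ := hm l hl
  have := hcz (z - l)
  rw [sub_add_cancel] at this
  rw [this, norm_mul, hc, one_mul]
  exact hK _ (by simpa using hz)

variable {L}

theorem tendsto_add_nhdsNE (z l : ℂ) :
    Filter.Tendsto (fun w => w + l) (𝓝[≠] z) (𝓝[≠] (z + l)) := by
  refine tendsto_nhdsWithin_of_tendsto_nhds_of_eventually_within _ ?_ ?_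
  · exact ((continuous_add_const l).tendsto z).mono_left nhdsWithin_le_nhds
  · filter_upwards [self_mem_nhdsWithin] with w hw
    simpa using hw

/-- Liouville's theorem for meromorphic functions without poles and with unitary multipliers. -/
theorem HasUnitaryMultipliers.exists_eventually_eq_const {f : ℂ → ℂ}
    (hm : L.HasUnitaryMultipliers f) (hf : Meromorphic f)
    (h0 : ∀ z, 0 ≤ meromorphicOrderAt f z) : ∃ c, ∀ z, f =ᶠ[𝓝[≠] z] fun _ => c := by
  have hlim : ∀ z, ∃ c, Filter.Tendsto f (𝓝[≠] z) (𝓝 c) := fun z =>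
    tendsto_nhds_of_meromorphicOrderAt_nonneg (hf z) (h0 z)
  choose g hg using hlim
  -- The values of `f` at its singular points are arbitrary, so one passes to the function `g` of
  -- limits. Near each `z` it agrees with the analytic `F` that equals `f` off `z`, hence `g` is
  -- entire.
  have hloc : ∀ z, ∃ F : ℂ → ℂ, AnalyticAt ℂ F z ∧ f =ᶠ[𝓝[≠] z] F ∧ g =ᶠ[𝓝 z] F := by
    intro z
    obtain ⟨F, hF, hfF⟩ := ((hf z).meromorphicOrderAt_nonneg_iff).1 (h0 z)
    refine ⟨F, hF, hfF, ?_⟩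
    have h1 : ∀ᶠ w in 𝓝 z, ∀ᶠ v in 𝓝 w, v ≠ z → f v = F v :=
      eventually_eventually_nhds.2 (eventually_nhdsWithin_iff.1 hfF)
    filter_upwards [h1, hF.eventually_continuousAt] with w hw hFw
    have h2 : f =ᶠ[𝓝[≠] w] F := by
      rcases eq_or_ne w z with rfl | hwz
      · exact hfF
      · filter_upwards [hw.filter_mono nhdsWithin_le_nhds,
          (isOpen_ne.mem_nhds hwz : {v | v ≠ z} ∈ 𝓝 w) |> mem_nhdsWithin_of_mem_nhds] with v hv hvz
        exact hv hvz
    exact tendsto_nhds_unique ((hg w).congr' h2)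
      (hFw.tendsto.mono_left nhdsWithin_le_nhds)
  have hgd : Differentiable ℂ g := fun z => by
    obtain ⟨F, hF, -, h⟩ := hloc z
    exact (hF.congr h.symm).differentiableAt
  obtain ⟨c, hc⟩ := L.exists_const_of_differentiable_of_multipliers hgd (by
    intro l hl
    obtain ⟨c, hc, hcz⟩ := hm l hl
    refine ⟨c, hc, fun z => ?_⟩
    have h1 := (hg (z + l)).comp (tendsto_add_nhdsNE z l)
    refine tendsto_nhds_unique h1 (((hg z).const_mul c).congr fun w => ?_)
    simp [hcz])
  refine ⟨c, fun z => ?_⟩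
  obtain ⟨F, hF, h1, h2⟩ := hloc z
  filter_upwards [h1, h2.filter_mono nhdsWithin_le_nhds] with w hw hw'
  rw [hw, ← hw', hc]

theorem HasUnitaryMultipliers.exists_ne_zero_eventually_eq_const {f : ℂ → ℂ}
    (hm : L.HasUnitaryMultipliers f) (hf : Meromorphic f)
    (h0 : ∀ z, 0 ≤ meromorphicOrderAt f z) {x : ℂ} (hx : meromorphicOrderAt f x ≠ ⊤) :
    ∃ c, c ≠ 0 ∧ ∀ z, f =ᶠ[𝓝[≠] z] fun _ => c := by
  obtain ⟨c, hc⟩ := hm.exists_eventually_eq_const hf h0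
  refine ⟨c, ?_, hc⟩
  rintro rfl
  exact hx (meromorphicOrderAt_eq_top_iff.2 (hc x))

/-- The working form of Liouville's theorem: once all poles of a product are seen to be cancelled,
it can have no zeros either. -/
theorem HasUnitaryMultipliers.meromorphicOrderAt_eq_zero {f : ℂ → ℂ}
    (hm : L.HasUnitaryMultipliers f) (hf : Meromorphic f)
    (h0 : ∀ z, 0 ≤ meromorphicOrderAt f z) {x : ℂ} (hx : meromorphicOrderAt f x ≠ ⊤) (z : ℂ) :
    meromorphicOrderAt f z = 0 := by
  obtain ⟨c, hc, h⟩ := hm.exists_ne_zero_eventually_eq_const hf h0 hx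
  classical
  rw [meromorphicOrderAt_congr (h z), meromorphicOrderAt_const, if_neg hc]

theorem HasUnitaryMultipliers.mul {f g : ℂ → ℂ} (hf : L.HasUnitaryMultipliers f)
    (hg : L.HasUnitaryMultipliers g) : L.HasUnitaryMultipliers (f * g) := by
  intro l hl
  obtain ⟨c, hc, h⟩ := hf l hl
  obtain ⟨d, hd, h'⟩ := hg l hl
  refine ⟨c * d, by simp [hc, hd], fun z => ?_⟩
  simp only [Pi.mul_apply, h, h']
  ring

theorem HasUnitaryMultipliers.inv {f : ℂ → ℂ} (hf : L.HasUnitaryMultipliers f) :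
    L.HasUnitaryMultipliers f⁻¹ := by
  intro l hl
  obtain ⟨c, hc, h⟩ := hf l hl
  refine ⟨c⁻¹, by simp [hc], fun z => ?_⟩
  simp only [Pi.inv_apply, h, mul_inv]

theorem HasUnitaryMultipliers.comp_const_sub {f : ℂ → ℂ} (hf : L.HasUnitaryMultipliers f) (a : ℂ) :
    L.HasUnitaryMultipliers (fun z => f (a - z)) := by
  intro l hl
  obtain ⟨c, hc, h⟩ := hf (-l) (neg_mem hl)
  refine ⟨c, hc, fun z => ?_⟩
  change f (a - (z + l)) = c * f (a - z)
  rw [← h, sub_add_eq_sub_sub, sub_eq_add_neg (a - z)]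

theorem hasUnitaryMultipliers_of_periodic {f : ℂ → ℂ}
    (hf : ∀ l ∈ L.lattice, ∀ z, f (z + l) = f z) : L.HasUnitaryMultipliers f :=
  fun l hl => ⟨1, by simp, fun z => by simp [hf l hl z]⟩

end PeriodPair

/-! ### Orders under substitutions, and parity of the order at 0 -/

section Order

theorem meromorphicOrderAt_comp_add (f : ℂ → ℂ) (c x : ℂ) :
    meromorphicOrderAt (fun z => f (z + c)) x = meromorphicOrderAt f (x + c) :=
  meromorphicOrderAt_comp_add_const_eq_meromorphicOrderAt

theorem meromorphicOrderAt_comp_sub (f : ℂ → ℂ) (c x : ℂ) :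
    meromorphicOrderAt (fun z => f (z - c)) x = meromorphicOrderAt f (x - c) :=
  meromorphicOrderAt_comp_sub_const_eq_meromorphicOrderAt

theorem meromorphicOrderAt_comp_const_sub (f : ℂ → ℂ) (c x : ℂ) :
    meromorphicOrderAt (fun z => f (c - z)) x = meromorphicOrderAt f (c - x) := by
  refine meromorphicOrderAt_comp_of_deriv_ne_zero (g := fun z => c - z) (by fun_prop) ?_
  simp

theorem meromorphicOrderAt_const_mul {c : ℂ} (hc : c ≠ 0) (f : ℂ → ℂ) (x : ℂ) :
    meromorphicOrderAt (fun z => c * f z) x = meromorphicOrderAt f x :=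
  meromorphicOrderAt_mul_of_ne_zero (g := fun _ => c) analyticAt_const hc

theorem PeriodPair.HasUnitaryMultipliers.meromorphicOrderAt_add {L : PeriodPair} {f : ℂ → ℂ}
    (hf : L.HasUnitaryMultipliers f) {l : ℂ} (hl : l ∈ L.lattice) (x : ℂ) :
    meromorphicOrderAt f (x + l) = meromorphicOrderAt f x := by
  obtain ⟨c, hc, h⟩ := hf l hl
  rw [← meromorphicOrderAt_comp_add, funext h, meromorphicOrderAt_const_mul]
  rintro rfl
  simp at hc

/-- Subtracting a suitable multiple of `h` raises the order of `f`. -/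
theorem exists_lt_meromorphicOrderAt_sub {f h : ℂ → ℂ} {x : ℂ} (hf : MeromorphicAt f x)
    (hh : MeromorphicAt h x) {n : ℤ} (hn : meromorphicOrderAt h x = n)
    (hfn : n ≤ meromorphicOrderAt f x) :
    ∃ c : ℂ, n < meromorphicOrderAt (fun z => f z - c * h z) x := by
  obtain ⟨c, hc⟩ := tendsto_nhds_of_meromorphicOrderAt_nonneg (hf.div hh) (by
    rw [div_eq_mul_inv, meromorphicOrderAt_mul hf hh.inv, meromorphicOrderAt_inv, hn]
    cases h' : meromorphicOrderAt f x with
    | top => exact le_top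
    | coe m =>
      rw [h'] at hfn
      norm_cast at hfn ⊢
      omega)
  refine ⟨c, ?_⟩
  have hm : MeromorphicAt (fun z => (f / h) z - c) x :=
    (hf.div hh).sub (MeromorphicAt.const c x)
  have h1 : 0 < meromorphicOrderAt (fun z => (f / h) z - c) x := by
    rw [← tendsto_zero_iff_meromorphicOrderAt_pos hm]
    simpa using hc.sub_const c
  have hne : ∀ᶠ z in 𝓝[≠] x, h z ≠ 0 :=
    (meromorphicOrderAt_ne_top_iff_eventually_ne_zero hh).1 (by rw [hn]; simp)
  have h2 : meromorphicOrderAt (fun z => f z - c * h z) x =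
      meromorphicOrderAt ((fun z => (f / h) z - c) * h) x := by
    refine meromorphicOrderAt_congr ?_
    filter_upwards [hne] with z hz
    simp only [Pi.mul_apply, Pi.div_apply]
    field_simp
  rw [h2, meromorphicOrderAt_mul hm hh, hn]
  cases h' : meromorphicOrderAt (fun z => (f / h) z - c) x with
  | top => exact WithTop.coe_lt_top n
  | coe m =>
    rw [h'] at h1
    change (n : WithTop ℤ) < ((m + n : ℤ) : WithTop ℤ)
    norm_cast at h1 ⊢
    omega

/-- With f = zⁿg and g(0) ≠ 0, comparing f(-z) and f(z) as z → 0 gives (-1)ⁿ = (-1)ˢ. -/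
theorem meromorphicOrderAt_zero_even_of_eventually {f : ℂ → ℂ} {s : ℤ} {n : ℤ}
    (hf : MeromorphicAt f 0) (hn : meromorphicOrderAt f 0 = n)
    (h : ∀ᶠ z in 𝓝[≠] (0 : ℂ), f (-z) = (-1) ^ s * f z) : Even (n - s) := by
  obtain ⟨g, hg, hg0, hfg⟩ := (meromorphicOrderAt_eq_int_iff hf).1 hn
  have hneg : Filter.Tendsto (fun z : ℂ => -z) (𝓝[≠] 0) (𝓝[≠] 0) := by
    refine tendsto_nhdsWithin_of_tendsto_nhds_of_eventually_within _ ?_ ?_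
    · exact ((continuous_neg (G := ℂ)).tendsto' 0 0 (by simp)).mono_left nhdsWithin_le_nhds
    · filter_upwards [self_mem_nhdsWithin] with w hw
      simpa using hw
  have h1 : ∀ᶠ z in 𝓝[≠] (0 : ℂ), (-1) ^ n * g (-z) = (-1) ^ s * g z := by
    filter_upwards [hfg, hneg.eventually hfg, h, self_mem_nhdsWithin] with z h1 h2 h3 h4
    have hz : z ≠ 0 := h4
    rw [h2, h1] at h3
    simp only [sub_zero, smul_eq_mul, neg_eq_neg_one_mul z, mul_zpow] at h3
    have := zpow_ne_zero n hz
    rw [neg_eq_neg_one_mul z]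
    apply mul_left_cancel₀ this
    linear_combination h3
  have hgt : Filter.Tendsto g (𝓝[≠] 0) (𝓝 (g 0)) :=
    hg.continuousAt.tendsto.mono_left nhdsWithin_le_nhds
  have h2 : Filter.Tendsto (fun z => g (-z)) (𝓝[≠] 0) (𝓝 (g 0)) := hgt.comp hneg
  have h3 := tendsto_nhds_unique ((h2.const_mul ((-1) ^ n)).congr' h1) (hgt.const_mul ((-1) ^ s))
  have h4 : ((-1 : ℂ)) ^ n = (-1) ^ s := mul_right_cancel₀ hg0 h3
  have h5 : ((-1 : ℂ)) ^ (n - s) = 1 := by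
    rw [zpow_sub₀ (by norm_num), h4, div_self (zpow_ne_zero _ (by norm_num))]
  rcases Int.even_or_odd (n - s) with h6 | h6
  · exact h6
  · rw [h6.neg_one_zpow] at h5
    norm_num at h5

/-- Parity gains one order: an even function cannot have odd order at 0. This replaces the vanishing
of residues in the arguments below. -/
theorem le_meromorphicOrderAt_zero_of_even {f : ℂ → ℂ} (hf : MeromorphicAt f 0)
    (h : ∀ z, f (-z) = f z) {n : ℤ} (hn : (2 * n - 1 : ℤ) ≤ meromorphicOrderAt f 0) :
    (2 * n : ℤ) ≤ meromorphicOrderAt f 0 := by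
  cases h' : meromorphicOrderAt f 0 with
  | top => exact le_top
  | coe m =>
    have := meromorphicOrderAt_zero_even_of_eventually (s := 0) hf h'
      (Filter.Eventually.of_forall fun z => by simp [h])
    rw [h'] at hn
    norm_cast at hn ⊢
    obtain ⟨k, hk⟩ := this
    omega

end Order

theorem Meromorphic.comp_add_const {f : ℂ → ℂ} (hf : Meromorphic f) (c : ℂ) :
    Meromorphic fun z => f (z + c) := fun x =>
  MeromorphicAt.comp_analyticAt (f := f) (g := fun z => z + c) (hf (x + c)) (by fun_prop)

theorem AnalyticAt.comp_sub_const {f : ℂ → ℂ} {x c : ℂ} (hf : AnalyticAt ℂ f (x - c)) :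
    AnalyticAt ℂ (fun z => f (z - c)) x :=
  AnalyticAt.comp (g := f) (f := fun z => z - c) hf (by fun_prop)

theorem Meromorphic.comp_sub_const {f : ℂ → ℂ} (hf : Meromorphic f) (c : ℂ) :
    Meromorphic fun z => f (z - c) := fun x =>
  MeromorphicAt.comp_analyticAt (f := f) (g := fun z => z - c) (hf (x - c)) (by fun_prop)

theorem Meromorphic.comp_const_sub {f : ℂ → ℂ} (hf : Meromorphic f) (c : ℂ) :
    Meromorphic fun z => f (c - z) := fun x =>
  MeromorphicAt.comp_analyticAt (f := f) (g := fun z => c - z) (hf (c - x)) (by fun_prop)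

theorem AnalyticAt.one_le_meromorphicOrderAt {f : ℂ → ℂ} {x : ℂ} (hf : AnalyticAt ℂ f x)
    (h : f x = 0) : 1 ≤ meromorphicOrderAt f x := by
  have h1 : 0 < meromorphicOrderAt f x := by
    rw [← tendsto_zero_iff_meromorphicOrderAt_pos hf.meromorphicAt, ← h]
    exact hf.continuousAt.tendsto.mono_left nhdsWithin_le_nhds
  cases h' : meromorphicOrderAt f x with
  | top => exact le_top
  | coe m =>
    rw [h'] at h1
    norm_cast at h1 ⊢

theorem AnalyticAt.meromorphicOrderAt_eq_zero {f : ℂ → ℂ} {x : ℂ} (hf : AnalyticAt ℂ f x)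
    (h : f x ≠ 0) : meromorphicOrderAt f x = 0 :=
  (tendsto_ne_zero_iff_meromorphicOrderAt_eq_zero hf.meromorphicAt).1
    ⟨f x, h, hf.continuousAt.tendsto.mono_left nhdsWithin_le_nhds⟩

theorem AnalyticAt.eq_of_eventually_nhdsNE {f : ℂ → ℂ} {x c : ℂ} (hf : AnalyticAt ℂ f x)
    (h : f =ᶠ[𝓝[≠] x] fun _ => c) : f x = c :=
  tendsto_nhds_unique (hf.continuousAt.tendsto.mono_left nhdsWithin_le_nhds)
    (tendsto_const_nhds.congr' h.symm)

/-! ### Even and odd elliptic functions in terms of ℘ and ℘' -/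

namespace PeriodPair

variable (L : PeriodPair)

theorem weierstrassP_add {l : ℂ} (hl : l ∈ L.lattice) (z : ℂ) :
    L.weierstrassP (z + l) = L.weierstrassP z := L.weierstrassP_add_coe z ⟨l, hl⟩

theorem derivWeierstrassP_add {l : ℂ} (hl : l ∈ L.lattice) (z : ℂ) :
    L.derivWeierstrassP (z + l) = L.derivWeierstrassP z := L.derivWeierstrassP_add_coe z ⟨l, hl⟩

theorem isPreconnected_compl_lattice : IsPreconnected ((L.lattice : Set ℂ)ᶜ) := by
  have hc : (L.lattice : Set ℂ).Countable := by
    have : Countable L.lattice := L.latticeEquivProd.toEquiv.countable_iff.2 inferInstance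
    exact Set.to_countable _
  exact (hc.isConnected_compl_of_one_lt_rank (by simp [Complex.rank_real_complex])).isPreconnected

theorem notMem_lattice_eventually (x : ℂ) : ∀ᶠ z in 𝓝[≠] x, z ∉ L.lattice := by
  filter_upwards [mem_nhdsWithin_of_mem_nhds (L.compl_lattice_sdiff_singleton_mem_nhds x),
    self_mem_nhdsWithin] with z hz hzx h
  exact hz ⟨h, hzx⟩

theorem compl_lattice_mem_nhds {x : ℂ} (hx : x ∉ L.lattice) : ((L.lattice : Set ℂ)ᶜ) ∈ 𝓝 x :=
  L.isClosed_lattice.isOpen_compl.mem_nhds hx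

theorem analyticAt_weierstrassP {z : ℂ} (hz : z ∉ L.lattice) : AnalyticAt ℂ L.weierstrassP z :=
  L.analyticOnNhd_weierstrassP z hz

theorem analyticAt_derivWeierstrassP {z : ℂ} (hz : z ∉ L.lattice) :
    AnalyticAt ℂ L.derivWeierstrassP z :=
  L.analyticOnNhd_derivWeierstrassP z hz

theorem meromorphic_weierstrassP_sub_const (c : ℂ) : Meromorphic fun z => L.weierstrassP z - c :=
  fun z => (L.meromorphic_weierstrassP z).sub (MeromorphicAt.const c z)

theorem order_weierstrassP_sub_const (c : ℂ) {l : ℂ} (hl : l ∈ L.lattice) :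
    meromorphicOrderAt (fun z => L.weierstrassP z - c) l = -2 := by
  rw [← L.order_weierstrassP l hl]
  have : (fun z => L.weierstrassP z - c) = L.weierstrassP + fun _ => -c := by
    ext z; simp [sub_eq_add_neg]
  rw [this]
  refine meromorphicOrderAt_add_eq_left_of_lt (MeromorphicAt.const _ _) ?_
  rw [L.order_weierstrassP l hl]
  refine lt_of_lt_of_le ?_ (analyticAt_const (𝕜 := ℂ) (v := -c)).meromorphicOrderAt_nonneg
  decide

theorem order_weierstrassP_sub_const_ne_top (c z : ℂ) :
    meromorphicOrderAt (fun z => L.weierstrassP z - c) z ≠ ⊤ :=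
  MeromorphicOn.meromorphicOrderAt_ne_top_of_isPreconnected (U := Set.univ) (x := 0)
    (fun z _ => L.meromorphic_weierstrassP_sub_const c z) isPreconnected_univ (Set.mem_univ _)
    (Set.mem_univ _)
    (by rw [L.order_weierstrassP_sub_const c (zero_mem _)]; decide)

theorem analyticAt_weierstrassP_sub_const (c : ℂ) {z : ℂ} (hz : z ∉ L.lattice) :
    AnalyticAt ℂ (fun z => L.weierstrassP z - c) z :=
  (L.analyticAt_weierstrassP hz).sub analyticAt_const

theorem order_weierstrassP_sub_const_nonneg (c : ℂ) {z : ℂ} (hz : z ∉ L.lattice) :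
    0 ≤ meromorphicOrderAt (fun z => L.weierstrassP z - c) z :=
  (L.analyticAt_weierstrassP_sub_const c hz).meromorphicOrderAt_nonneg

theorem order_derivWeierstrassP {l : ℂ} (hl : l ∈ L.lattice) :
    meromorphicOrderAt L.derivWeierstrassP l = -3 := by
  rw [← L.deriv_weierstrassP]
  exact meromorphicOrderAt_deriv_eq_sub_one (n := -2) (by norm_num) (L.order_weierstrassP l hl)

/-- An even elliptic function without poles off the lattice is a polynomial in `℘`. -/
theorem exists_polynomial_of_even {f : ℂ → ℂ} (hf : Meromorphic f)
    (ha : ∀ z ∉ L.lattice, AnalyticAt ℂ f z) (hp : ∀ l ∈ L.lattice, ∀ z, f (z + l) = f z)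
    (he : ∀ z, f (-z) = f z) :
    ∃ q : ℂ[X], ∀ z ∉ L.lattice, f z = q.eval (L.weierstrassP z) := by
  -- Induction on a bound for half the pole order at 0.
  suffices H : ∀ n : ℕ, ∀ f : ℂ → ℂ, Meromorphic f → (∀ z ∉ L.lattice, AnalyticAt ℂ f z) →
      (∀ l ∈ L.lattice, ∀ z, f (z + l) = f z) → (∀ z, f (-z) = f z) →
      (2 * -(n : ℤ) : ℤ) ≤ meromorphicOrderAt f 0 →
      ∃ q : ℂ[X], ∀ z ∉ L.lattice, f z = q.eval (L.weierstrassP z) by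
    cases h : meromorphicOrderAt f 0 with
    | top => exact H 0 f hf ha hp he (by simp [h])
    | coe m =>
      -- The crude bound -2|m| ≤ m is enough.
      refine H m.natAbs f hf ha hp he ?_
      rw [h]
      refine WithTop.coe_le_coe.2 ?_
      omega
  clear! f
  intro n
  induction n with
  | zero =>
    intro f hf ha hp he h0
    have hm := hasUnitaryMultipliers_of_periodic hp
    obtain ⟨c, hc⟩ := hm.exists_eventually_eq_const hf (fun z => by
      by_cases hz : z ∈ L.lattice
      · have := hm.meromorphicOrderAt_add hz 0
        rw [zero_add] at this
        rw [this]
        simpa using h0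
      · exact (ha z hz).meromorphicOrderAt_nonneg)
    exact ⟨C c, fun z hz => by rw [(ha z hz).eq_of_eventually_nhdsNE (hc z), eval_C]⟩
  | succ n ih =>
    intro f hf ha hp he h0
    have hP : meromorphicOrderAt (fun z => L.weierstrassP z ^ (n + 1)) 0 =
        ((-2 * (n + 1) : ℤ) : WithTop ℤ) := by
      have h1 := meromorphicOrderAt_pow (n := n + 1) (L.meromorphic_weierstrassP 0)
      rw [L.order_weierstrassP 0 (zero_mem _)] at h1
      refine h1.trans ?_
      change ((n + 1 : ℕ) : WithTop ℤ) * ((-2 : ℤ) : WithTop ℤ) = _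
      norm_cast
      rw [mul_comm]
    -- Cancelling the leading term leaves order at least -2(n + 1) + 1 = -2n - 1, and parity
    -- improves this to -2n.
    obtain ⟨c, hc⟩ := exists_lt_meromorphicOrderAt_sub (h := fun z => L.weierstrassP z ^ (n + 1)) (hf 0)
      ((L.meromorphic_weierstrassP 0).pow (n + 1)) hP (le_trans (by norm_cast) h0)
    have hg : Meromorphic fun z => f z - c * L.weierstrassP z ^ (n + 1) := fun z =>
      (hf z).sub ((MeromorphicAt.const c z).mul ((L.meromorphic_weierstrassP z).pow (n + 1)))
    have hge : ∀ z, f (-z) - c * L.weierstrassP (-z) ^ (n + 1) =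
        f z - c * L.weierstrassP z ^ (n + 1) := fun z => by rw [he, L.weierstrassP_neg]
    obtain ⟨q, hq⟩ := ih (fun z => f z - c * L.weierstrassP z ^ (n + 1)) hg
      (fun z hz => (ha z hz).sub (analyticAt_const.mul ((L.analyticAt_weierstrassP hz).pow (n + 1))))
      (fun l hl z => by rw [hp l hl, L.weierstrassP_add hl]) hge (by
        refine le_meromorphicOrderAt_zero_of_even (hg 0) hge ?_
        cases h : meromorphicOrderAt (fun z => f z - c * L.weierstrassP z ^ (n + 1)) 0 with
        | top => exact le_top
        | coe m =>
          rw [h] at hc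
          norm_cast at hc ⊢
          omega)
    refine ⟨q + C c * X ^ (n + 1), fun z hz => ?_⟩
    have := hq z hz
    simp only [eval_add, eval_mul, eval_C, eval_pow, eval_X]
    linear_combination this

/-- The complement of the lattice is connected, so the identity theorem makes its analytic functions
a domain. Its use is the cancellation of ℘'. -/
theorem eq_zero_of_forall_mul_eq_zero {f g : ℂ → ℂ} (hf : ∀ z ∉ L.lattice, AnalyticAt ℂ f z)
    (hg : ∀ z ∉ L.lattice, AnalyticAt ℂ g z) (h : ∀ z ∉ L.lattice, f z * g z = 0)
    (hf0 : ∃ z ∉ L.lattice, f z ≠ 0) : ∀ z ∉ L.lattice, g z = 0 := by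
  rcases AnalyticOnNhd.eq_zero_or_eq_zero_of_mul_eq_zero (U := (L.lattice : Set ℂ)ᶜ) hf hg h
    L.isPreconnected_compl_lattice with h1 | h1
  · obtain ⟨z, hz, hfz⟩ := hf0
    exact absurd (h1 z hz) hfz
  · exact h1

theorem tendsto_weierstrassP_zero :
    Filter.Tendsto L.weierstrassP (𝓝[≠] 0) (Bornology.cobounded ℂ) :=
  tendsto_cobounded_of_meromorphicOrderAt_neg
    (by rw [L.order_weierstrassP 0 (zero_mem _)]; decide)

/-- `℘` is transcendental. -/
theorem eq_zero_of_forall_eval_weierstrassP_eq_zero {q : ℂ[X]}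
    (h : ∀ z ∉ L.lattice, q.eval (L.weierstrassP z) = 0) : q = 0 := by
  by_contra hq
  -- Near 0 the function ℘ tends to infinity and so leaves the finite set of roots of `q`.
  have h1 : ∀ᶠ w in Bornology.cobounded ℂ, q.eval w ≠ 0 := by
    have : {w | q.eval w = 0}.Finite := by
      refine (q.roots.toFinset.finite_toSet).subset fun w hw => ?_
      simpa [hq] using hw
    exact Bornology.isBounded_def.1 this.isBounded
  obtain ⟨z, hz, hz'⟩ := ((L.tendsto_weierstrassP_zero.eventually h1).and
    (L.notMem_lattice_eventually 0)).exists
  exact hz (h z hz')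

theorem exists_derivWeierstrassP_ne_zero : ∃ z ∉ L.lattice, L.derivWeierstrassP z ≠ 0 := by
  have h := (meromorphicOrderAt_ne_top_iff_eventually_ne_zero (L.meromorphic_derivWeierstrassP 0)).1
    (by rw [L.order_derivWeierstrassP (zero_mem _)]; decide)
  obtain ⟨z, h1, h2⟩ := (h.and (L.notMem_lattice_eventually 0)).exists
  exact ⟨z, h2, h1⟩

theorem derivWeierstrassP_half_period {w : ℂ} (hw : 2 * w ∈ L.lattice) :
    L.derivWeierstrassP w = 0 := by
  have h := L.derivWeierstrassP_add (neg_mem hw) w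
  rw [show w + -(2 * w) = -w by ring, L.derivWeierstrassP_neg] at h
  linear_combination (-1 / 2 : ℂ) * h

/-- About a half period w the function ℘(w + z) - ℘(w) is even in z, so its zero at z = 0 is at
least double. -/
theorem two_le_order_weierstrassP_sub_half_period {w : ℂ} (hw : w ∉ L.lattice)
    (hw2 : 2 * w ∈ L.lattice) :
    2 ≤ meromorphicOrderAt (fun z => L.weierstrassP z - L.weierstrassP w) w := by
  have h1 := (L.analyticAt_weierstrassP_sub_const (L.weierstrassP w) hw).one_le_meromorphicOrderAt
    (sub_self _)
  have h2 := meromorphicOrderAt_comp_add (fun z => L.weierstrassP z - L.weierstrassP w) w 0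
  rw [zero_add] at h2
  rw [← h2] at h1 ⊢
  refine le_meromorphicOrderAt_zero_of_even (n := 1) ?_ (fun z => ?_) h1
  · exact (L.meromorphic_weierstrassP_sub_const _).comp_add_const w 0
  · rw [← L.weierstrassP_neg, ← L.weierstrassP_add hw2]
    ring_nf

/-- `℘` takes distinct values at distinct half periods. -/
theorem weierstrassP_half_period_injective {w w' : ℂ} (hw : w ∉ L.lattice)
    (hw2 : 2 * w ∈ L.lattice) (hw' : w' ∉ L.lattice)
    (h : L.weierstrassP w' = L.weierstrassP w) : w' + w ∈ L.lattice := by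
  by_contra hsum
  set f : ℂ → ℂ := fun z => L.weierstrassP z - L.weierstrassP w with hf
  have hfm : Meromorphic f := L.meromorphic_weierstrassP_sub_const _
  have hper : ∀ l ∈ L.lattice, ∀ z, f (z + l) = f z := fun l hl z => by
    simp only [hf, L.weierstrassP_add hl]
  have hfu := hasUnitaryMultipliers_of_periodic hper
  have hordw : ∀ z, z + w ∈ L.lattice → 2 ≤ meromorphicOrderAt f z := fun z hz => by
    have h1 := hfu.meromorphicOrderAt_add (l := z + w - 2 * w) (sub_mem hz hw2) w
    rw [show w + (z + w - 2 * w) = z by ring] at h1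
    rw [h1]
    exact L.two_le_order_weierstrassP_sub_half_period hw hw2
  have hgm : Meromorphic fun z => f (z + w) := hfm.comp_add_const w
  have hord : ∀ z, meromorphicOrderAt (f * fun z => f (z + w)) z =
      meromorphicOrderAt f z + meromorphicOrderAt f (z + w) := fun z => by
    rw [meromorphicOrderAt_mul (hfm z) (hgm z), meromorphicOrderAt_comp_add]
  -- In f(z)f(z + w) the double pole of each factor meets the zero, at least double, of the other.
  -- The product has no poles, hence no zeros, and a further zero `w'` of `f` is excluded.
  have key := HasUnitaryMultipliers.meromorphicOrderAt_eq_zero (L := L)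
    (f := f * fun z => f (z + w)) (x := 0)
    (hfu.mul (hasUnitaryMultipliers_of_periodic fun l hl z => by
      rw [add_right_comm, hper l hl])) (fun z => (hfm z).mul (hgm z)) (fun z => by
      rw [hord]
      by_cases h1 : z ∈ L.lattice
      · rw [L.order_weierstrassP_sub_const _ h1]
        have h2 := hfu.meromorphicOrderAt_add h1 w
        rw [add_comm] at h2
        rw [h2]
        have h3 := L.two_le_order_weierstrassP_sub_half_period hw hw2
        calc (0 : WithTop ℤ) = -2 + 2 := by decide
          _ ≤ _ := add_le_add_right h3 _
      by_cases h2 : z + w ∈ L.lattice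
      · rw [L.order_weierstrassP_sub_const _ h2]
        calc (0 : WithTop ℤ) = 2 + -2 := by decide
          _ ≤ _ := add_le_add_left (hordw z h2) _
      exact add_nonneg (L.order_weierstrassP_sub_const_nonneg _ h1)
        (L.order_weierstrassP_sub_const_nonneg _ h2))
    (by rw [hord]; simp [hf, L.order_weierstrassP_sub_const_ne_top]) w'
  rw [hord] at key
  have h1 : 1 ≤ meromorphicOrderAt f w' :=
    (L.analyticAt_weierstrassP_sub_const _ hw').one_le_meromorphicOrderAt (by simp [h])
  have h2 : 0 ≤ meromorphicOrderAt f (w' + w) := L.order_weierstrassP_sub_const_nonneg _ hsum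
  have h3 := add_le_add h1 h2
  rw [key] at h3
  exact absurd h3 (by decide)

theorem eval_cubic (x : ℂ) : L.cubic.eval x = 4 * x ^ 3 - L.g₂ * x - L.g₃ := by
  simp [cubic]

theorem eval_cubic_weierstrassP {z : ℂ} (hz : z ∉ L.lattice) :
    L.cubic.eval (L.weierstrassP z) = L.derivWeierstrassP z ^ 2 := by
  rw [eval_cubic, L.derivWeierstrassP_sq z hz]

theorem degree_cubic : L.cubic.degree = 3 := by
  unfold cubic
  compute_degree!

theorem half_period_add_notMem_lattice : (L.ω₁ + L.ω₂) / 2 ∉ L.lattice := by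
  have := L.mul_ω₁_add_mul_ω₂_mem_lattice (α := 1 / 2) (β := 1 / 2)
  intro h
  rw [show (L.ω₁ + L.ω₂) / 2 = ((1 / 2 : ℚ) : ℂ) * L.ω₁ + ((1 / 2 : ℚ) : ℂ) * L.ω₂ by
    push_cast; ring] at h
  have h2 := (this.1 h).1
  norm_num at h2

/-- A polynomial such that `q(℘)` vanishes at the half periods is divisible by the cubic. -/
theorem cubic_dvd_of_eval_half_period_eq_zero {q : ℂ[X]}
    (h : ∀ w ∉ L.lattice, 2 * w ∈ L.lattice → q.eval (L.weierstrassP w) = 0) : L.cubic ∣ q := by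
  -- The cubic vanishes at ℘(w) because ℘'(w) = 0, so the remainder modulo the cubic inherits the
  -- zeros of `q`. It has degree below 3 and three distinct roots, so it is zero.
  have hr : ∀ w ∉ L.lattice, 2 * w ∈ L.lattice → (q % L.cubic).eval (L.weierstrassP w) = 0 := by
    intro w hw hw2
    have h1 := congrArg (Polynomial.eval (L.weierstrassP w)) (EuclideanDomain.div_add_mod q L.cubic)
    rw [eval_add, eval_mul, eval_cubic_weierstrassP L hw, L.derivWeierstrassP_half_period hw2,
      h w hw hw2] at h1
    simpa using h1
  have hω₁ : 2 * (L.ω₁ / 2) ∈ L.lattice := by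
    rw [mul_div_cancel₀ _ two_ne_zero]; exact L.ω₁_mem_lattice
  have hω₂ : 2 * (L.ω₂ / 2) ∈ L.lattice := by
    rw [mul_div_cancel₀ _ two_ne_zero]; exact L.ω₂_mem_lattice
  have hω₃ : 2 * ((L.ω₁ + L.ω₂) / 2) ∈ L.lattice := by
    rw [mul_div_cancel₀ _ two_ne_zero]; exact add_mem L.ω₁_mem_lattice L.ω₂_mem_lattice
  have h12 : L.weierstrassP (L.ω₁ / 2) ≠ L.weierstrassP (L.ω₂ / 2) := fun h => by
    have := L.weierstrassP_half_period_injective L.ω₂_div_two_notMem_lattice hω₂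
      L.ω₁_div_two_notMem_lattice h
    rw [← add_div] at this
    exact L.half_period_add_notMem_lattice this
  have h13 : L.weierstrassP ((L.ω₁ + L.ω₂) / 2) ≠ L.weierstrassP (L.ω₁ / 2) := fun h => by
    have := L.weierstrassP_half_period_injective L.ω₁_div_two_notMem_lattice hω₁
      L.half_period_add_notMem_lattice h
    refine L.ω₂_div_two_notMem_lattice ?_
    convert sub_mem this L.ω₁_mem_lattice using 1
    ring
  have h23 : L.weierstrassP ((L.ω₁ + L.ω₂) / 2) ≠ L.weierstrassP (L.ω₂ / 2) := fun h => by
    have := L.weierstrassP_half_period_injective L.ω₂_div_two_notMem_lattice hω₂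
      L.half_period_add_notMem_lattice h
    refine L.ω₁_div_two_notMem_lattice ?_
    convert sub_mem this L.ω₂_mem_lattice using 1
    ring
  have hc0 : L.cubic ≠ 0 := fun h0 => by
    have := L.degree_cubic
    rw [h0, degree_zero] at this
    exact absurd this (by decide)
  refine EuclideanDomain.mod_eq_zero.1 ?_
  classical
  refine Polynomial.eq_zero_of_degree_lt_of_eval_finset_eq_zero
    {L.weierstrassP (L.ω₁ / 2), L.weierstrassP (L.ω₂ / 2), L.weierstrassP ((L.ω₁ + L.ω₂) / 2)}
    ?_ ?_
  · rw [Finset.card_insert_of_notMem (by simp [h12, h13.symm]), Finset.card_pair h23.symm]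
    exact (degree_mod_lt q hc0).trans_eq L.degree_cubic
  · simp only [Finset.mem_insert, Finset.mem_singleton]
    rintro x (rfl | rfl | rfl)
    · exact hr _ L.ω₁_div_two_notMem_lattice hω₁
    · exact hr _ L.ω₂_div_two_notMem_lattice hω₂
    · exact hr _ L.half_period_add_notMem_lattice hω₃

/-- An odd elliptic function without poles off the lattice is `℘'` times a polynomial in `℘`. -/
theorem exists_polynomial_of_odd {f : ℂ → ℂ} (hf : Meromorphic f)
    (ha : ∀ z ∉ L.lattice, AnalyticAt ℂ f z) (hp : ∀ l ∈ L.lattice, ∀ z, f (z + l) = f z)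
    (ho : ∀ z, f (-z) = -f z) :
    ∃ q : ℂ[X], ∀ z ∉ L.lattice, f z = q.eval (L.weierstrassP z) * L.derivWeierstrassP z := by
  -- f℘' is even, hence q(℘), and it vanishes at the half periods. So the cubic divides `q`, giving
  -- f℘' = d(℘)℘'², from which one factor ℘' is cancelled.
  obtain ⟨q, hq⟩ := L.exists_polynomial_of_even (f := fun z => f z * L.derivWeierstrassP z)
    (fun z => (hf z).mul (L.meromorphic_derivWeierstrassP z))
    (fun z hz => (ha z hz).mul (L.analyticAt_derivWeierstrassP hz))
    (fun l hl z => by rw [hp l hl, L.derivWeierstrassP_add hl])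
    (fun z => by rw [ho, L.derivWeierstrassP_neg, neg_mul_neg])
  obtain ⟨d, rfl⟩ := L.cubic_dvd_of_eval_half_period_eq_zero (q := q) (fun w hw hw2 => by
    rw [← hq w hw, L.derivWeierstrassP_half_period hw2, mul_zero])
  refine ⟨d, fun z hz => ?_⟩
  have hd : ∀ z ∉ L.lattice, AnalyticAt ℂ (fun z => d.eval (L.weierstrassP z)) z := fun z hz =>
    (AnalyticOnNhd.eval_polynomial d (L.weierstrassP z) (Set.mem_univ _)).comp
      (L.analyticAt_weierstrassP hz)
  refine sub_eq_zero.1 (L.eq_zero_of_forall_mul_eq_zero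
    (f := L.derivWeierstrassP)
    (g := fun z => f z - d.eval (L.weierstrassP z) * L.derivWeierstrassP z)
    (fun z hz => L.analyticAt_derivWeierstrassP hz)
    (fun z hz => (ha z hz).sub ((hd z hz).mul (L.analyticAt_derivWeierstrassP hz)))
    (fun z hz => ?_) L.exists_derivWeierstrassP_ne_zero z hz)
  have h1 := hq z hz
  rw [eval_mul, L.eval_cubic_weierstrassP hz] at h1
  linear_combination h1

theorem eq_zero_of_forall_eval_mul_derivWeierstrassP_eq_zero {q : ℂ[X]}
    (h : ∀ z ∉ L.lattice, q.eval (L.weierstrassP z) * L.derivWeierstrassP z = 0) : q = 0 := by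
  have hd : ∀ z ∉ L.lattice, AnalyticAt ℂ (fun z => q.eval (L.weierstrassP z)) z := fun z hz =>
    (AnalyticOnNhd.eval_polynomial q (L.weierstrassP z) (Set.mem_univ _)).comp
      (L.analyticAt_weierstrassP hz)
  exact L.eq_zero_of_forall_eval_weierstrassP_eq_zero (L.eq_zero_of_forall_mul_eq_zero
    (f := L.derivWeierstrassP) (g := fun z => q.eval (L.weierstrassP z))
    (fun z hz => L.analyticAt_derivWeierstrassP hz) hd
    (fun z hz => by rw [mul_comm]; exact h z hz) L.exists_derivWeierstrassP_ne_zero)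

end PeriodPair

/-! ### Sums over ℤ/M, and the divisor of ℘ - ℘(α) -/

section PeriodicSum

variable {A : Type*} [AddCommMonoid A] {M : ℕ} {G : ℤ → A}

theorem Finset.sum_range_add_one_of_periodic (hG : ∀ k, G (k + M) = G k) :
    ∑ k ∈ Finset.range M, G ((k : ℤ) + 1) = ∑ k ∈ Finset.range M, G k := by
  cases M with
  | zero => simp
  | succ m =>
    rw [Finset.sum_range_succ, Finset.sum_range_succ' (fun k : ℕ => G k)]
    have := hG 0
    push_cast at this ⊢
    rw [← this, zero_add]

theorem Finset.sum_range_add_of_periodic (hG : ∀ k, G (k + M) = G k) (c : ℤ) :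
    ∑ k ∈ Finset.range M, G ((k : ℤ) + c) = ∑ k ∈ Finset.range M, G k := by
  have hstep : ∀ c : ℤ, ∑ k ∈ Finset.range M, G ((k : ℤ) + (c + 1)) =
      ∑ k ∈ Finset.range M, G ((k : ℤ) + c) := fun c => by
    rw [← Finset.sum_range_add_one_of_periodic (G := fun k => G (k + c))
      (fun k => by rw [add_right_comm, hG])]
    refine Finset.sum_congr rfl fun k _ => ?_
    rw [add_right_comm, add_assoc]
  induction c using Int.induction_on with
  | zero => simp
  | succ i ih => rw [hstep, ih]
  | pred i ih => rw [← hstep, sub_add_cancel, ih]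

theorem Finset.sum_range_neg_of_periodic (hG : ∀ k, G (k + M) = G k) :
    ∑ k ∈ Finset.range M, G (-(k : ℤ)) = ∑ k ∈ Finset.range M, G k := by
  have h1 := Finset.sum_range_reflect (fun k : ℕ => G k) M
  rw [← h1, ← Finset.sum_range_add_one_of_periodic (G := fun k => G (-k)) (fun k => by
    rw [← hG]; congr 1; ring)]
  refine Finset.sum_congr rfl fun k hk => ?_
  rw [← hG]
  have := Finset.mem_range.1 hk
  congr 1
  omega

end PeriodicSum

/-- The residue of the logarithmic derivative is the order; this is how orders of ℘ - ℘(α) become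
residues of the functions P_j. -/
theorem tendsto_mul_deriv_div {f : ℂ → ℂ} {x : ℂ} {n : ℤ} (hf : MeromorphicAt f x)
    (hn : meromorphicOrderAt f x = n) :
    Filter.Tendsto (fun z => (z - x) * (deriv f z / f z)) (𝓝[≠] x) (𝓝 n) := by
  obtain ⟨g, hg, hg0, hfg⟩ := (meromorphicOrderAt_eq_int_iff hf).1 hn
  have hfg' : f =ᶠ[𝓝[≠] x] fun z => (z - x) ^ n * g z := hfg
  have h1 : Filter.Tendsto (fun z => n + (z - x) * (deriv g z / g z)) (𝓝[≠] x) (𝓝 n) := by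
    have : ContinuousAt (fun z => (n : ℂ) + (z - x) * (deriv g z / g z)) x :=
      continuousAt_const.add ((continuousAt_id.sub continuousAt_const).mul
        (hg.deriv.continuousAt.div hg.continuousAt hg0))
    simpa using this.tendsto.mono_left nhdsWithin_le_nhds
  refine h1.congr' ?_
  have hg1 : ∀ᶠ z in 𝓝[≠] x, g z ≠ 0 ∧ AnalyticAt ℂ g z :=
    ((hg.continuousAt.eventually_ne hg0).and hg.eventually_analyticAt).filter_mono
      nhdsWithin_le_nhds
  filter_upwards [hfg', hfg'.nhdsNE_deriv, hg1, self_mem_nhdsWithin] with z h2 h3 h4 h5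
  have hz : z - x ≠ 0 := sub_ne_zero.2 h5
  have hd : deriv (fun z => (z - x) ^ n * g z) z =
      n * (z - x) ^ (n - 1) * g z + (z - x) ^ n * deriv g z := by
    have h6 : HasDerivAt (fun z => (z - x) ^ n) (n * (z - x) ^ (n - 1) * 1) z :=
      HasDerivAt.comp z (h₂ := fun w => w ^ n) (hasDerivAt_zpow n (z - x) (Or.inl hz))
        ((hasDerivAt_id z).sub_const x)
    rw [(h6.fun_mul h4.2.differentiableAt.hasDerivAt).deriv, mul_one]
  rw [h3, h2, hd, zpow_sub_one₀ hz]
  have := zpow_ne_zero n hz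
  have := h4.1
  field_simp

namespace PeriodPair

variable {K L' : PeriodPair} {M : ℕ} {α : ℂ}

theorem mem_sup_span_singleton_iff {x : ℂ} :
    x ∈ K.lattice ⊔ Submodule.span ℤ {α} ↔ ∃ k : ℤ, x - k * α ∈ K.lattice := by
  rw [Submodule.mem_sup]
  constructor
  · rintro ⟨y, hy, z, hz, rfl⟩
    obtain ⟨k, rfl⟩ := Submodule.mem_span_singleton.1 hz
    exact ⟨k, by simpa using hy⟩
  · rintro ⟨k, hk⟩
    exact ⟨_, hk, _, Submodule.mem_span_singleton.2 ⟨k, rfl⟩, by simp⟩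

variable (K) in
/-- Data of a torsion point `α` of order `M ≥ 3` on `ℂ / K`, with `L' = K + ℤα`. -/
structure IsTorsionExtension (L' : PeriodPair) (M : ℕ) (α : ℂ) : Prop where
  three_le : 3 ≤ M
  mem_iff : ∀ k : ℤ, k * α ∈ K.lattice ↔ (M : ℤ) ∣ k
  lattice_eq : L'.lattice = K.lattice ⊔ Submodule.span ℤ {α}

namespace IsTorsionExtension

variable (h : K.IsTorsionExtension L' M α)
include h

theorem mem_lattice_iff {x : ℂ} : x ∈ L'.lattice ↔ ∃ k : ℤ, x - k * α ∈ K.lattice := by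
  rw [h.lattice_eq, mem_sup_span_singleton_iff]

theorem le_lattice {x : ℂ} (hx : x ∈ K.lattice) : x ∈ L'.lattice :=
  h.mem_lattice_iff.2 ⟨0, by simpa using hx⟩

theorem mul_mem_lattice (k : ℤ) : k * α ∈ L'.lattice :=
  h.mem_lattice_iff.2 ⟨k, by simp⟩

theorem order_mul_mem : (M : ℂ) * α ∈ K.lattice := by
  simpa using (h.mem_iff M).2 dvd_rfl

theorem notMem {k : ℤ} (hk : ¬ (M : ℤ) ∣ k) : k * α ∉ K.lattice := fun h' =>
  hk ((h.mem_iff k).1 h')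

/-- The order of `℘ - ℘(α)` at `-kα`. -/
theorem exists_orders : ∃ n : ℤ → ℤ,
    (∀ k : ℤ, meromorphicOrderAt (fun z => K.weierstrassP z - K.weierstrassP α) (-(k * α)) = n k) ∧
    (∀ k, n (k + M) = n k) ∧ n 0 = -2 ∧ 1 ≤ n 1 ∧ 1 ≤ n (-1) ∧
    ∀ k, ¬ (M : ℤ) ∣ k → 0 ≤ n k := by
  have hM := h.three_le
  have h0 := fun k : ℤ => K.order_weierstrassP_sub_const_ne_top (K.weierstrassP α) (-(k * α))
  choose n hn using fun k : ℤ => WithTop.ne_top_iff_exists.1 (h0 k)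
  have hper := hasUnitaryMultipliers_of_periodic (L := K)
    (f := fun z => K.weierstrassP z - K.weierstrassP α)
    (fun l hl z => by simp only [K.weierstrassP_add hl])
  have hα : α ∉ K.lattice := by
    have := h.notMem (k := 1) (fun h1 => by
      have := Int.le_of_dvd one_pos h1
      omega)
    simpa using this
  refine ⟨n, fun k => (hn k).symm, fun k => ?_, ?_, ?_, ?_, fun k hk => ?_⟩
  · have h1 := hper.meromorphicOrderAt_add (neg_mem h.order_mul_mem) (-(k * α))
    rw [← hn, show -(k * α) + -(M * α) = -(((k + M : ℤ) : ℂ) * α) by push_cast; ring, ← hn] at h1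
    exact_mod_cast h1
  · have h1 := K.order_weierstrassP_sub_const (K.weierstrassP α) (l := -((0 : ℤ) * α)) (by simp)
    rw [← hn] at h1
    exact WithTop.coe_injective h1
  · have h1 := (K.analyticAt_weierstrassP_sub_const (K.weierstrassP α) (z := -((1 : ℤ) * α))
      (by simpa using hα)).one_le_meromorphicOrderAt (by simp)
    rw [← hn] at h1
    exact_mod_cast h1
  · have h1 := (K.analyticAt_weierstrassP_sub_const (K.weierstrassP α) (z := -((-1 : ℤ) * α))
      (by simpa using hα)).one_le_meromorphicOrderAt (by simp)
    rw [← hn] at h1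
    exact_mod_cast h1
  · have h1 := K.order_weierstrassP_sub_const_nonneg (K.weierstrassP α) (z := -(k * α))
      (by rw [neg_mem_iff]; exact h.notMem hk)
    rw [← hn] at h1
    exact_mod_cast h1

omit h in
theorem sum_mul_indicator (hM : 3 ≤ M) (w : ℕ → ℂ) :
    ∑ k ∈ Finset.range M, w k * (((if k = 0 then -2 else 0) + (if k = 1 then 1 else 0) +
      (if k = M - 1 then 1 else 0) : ℤ) : ℂ) = -2 * w 0 + w 1 + w (M - 1) := by
  push_cast
  simp only [mul_add, Finset.sum_add_distrib, mul_ite, mul_one, mul_zero, Finset.sum_ite_eq',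
    Finset.mem_range]
  rw [if_pos (by omega), if_pos (by omega), if_pos (by omega)]
  ring

/-- At the points -kα the difference ℘ - ℘(α) has only the double pole at 0 and simple zeros at ±α;
the index `M - 1` stands for the point α. The lower bounds of `exists_orders` add up to 0, and
Liouville's theorem for the product of all translates by kα turns them into equalities and excludes
zeros off Λ'. -/
theorem orders_eq : (∀ z ∉ L'.lattice, K.weierstrassP z ≠ K.weierstrassP α) ∧
    ∀ k : ℕ, k < M →
      meromorphicOrderAt (fun z => K.weierstrassP z - K.weierstrassP α) (-((k : ℂ) * α)) =
      (((if k = 0 then -2 else 0) + (if k = 1 then 1 else 0) +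
        (if k = M - 1 then 1 else 0) : ℤ) : WithTop ℤ) := by
  have hM := h.three_le
  obtain ⟨n, hn, hper, hn0, hn1, hn2, hn3⟩ := h.exists_orders
  set f : ℂ → ℂ := fun z => K.weierstrassP z - K.weierstrassP α with hf
  have hfm : Meromorphic f := K.meromorphic_weierstrassP_sub_const _
  have hfper : ∀ l ∈ K.lattice, ∀ z, f (z + l) = f z := fun l hl z => by
    simp only [hf, K.weierstrassP_add hl]
  have hnpred : n ((M : ℤ) - 1) = n (-1) := by
    rw [← hper (-1), neg_add_eq_sub]
  -- The expected orders. Since M ≥ 3 the indices 0, 1 and M - 1 are distinct, so the bounds hold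
  -- term by term and the sum is -2 + 1 + 1 = 0.
  let δ : ℕ → ℤ := fun k => (if k = 0 then -2 else 0) + (if k = 1 then 1 else 0) +
    (if k = M - 1 then 1 else 0)
  have hδsum : ∑ k ∈ Finset.range M, δ k = 0 := by
    simp only [δ, Finset.sum_add_distrib, Finset.sum_ite_eq', Finset.mem_range]
    rw [if_pos (by omega), if_pos (by omega), if_pos (by omega)]
    norm_num
  have hδ : ∀ k ∈ Finset.range M, 0 ≤ n k - δ k := fun k hk => by
    have hk := Finset.mem_range.1 hk
    simp only [δ]
    by_cases h0 : k = 0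
    · subst h0
      rw [if_pos rfl, if_neg (by omega), if_neg (by omega)]
      push_cast
      omega
    by_cases h1 : k = 1
    · subst h1
      rw [if_neg (by omega), if_pos rfl, if_neg (by omega)]
      push_cast
      omega
    by_cases h2 : k = M - 1
    · rw [if_neg h0, if_neg h1, if_pos h2, h2, show ((M - 1 : ℕ) : ℤ) = (M : ℤ) - 1 by omega,
        hnpred]
      omega
    · rw [if_neg h0, if_neg h1, if_neg h2]
      have := hn3 k (fun h' => by
        have := Int.le_of_dvd (by omega) h'
        omega)
      omega
  have hsum : 0 ≤ ∑ k ∈ Finset.range M, n k := by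
    have := Finset.sum_nonneg hδ
    rw [Finset.sum_sub_distrib, hδsum] at this
    linarith
  -- At every point of Λ' the order of this product is the same sum of all `n k`, which is known to
  -- be nonnegative; off Λ' no factor has a pole.
  let Q : ℂ → ℂ := fun z => ∏ k ∈ Finset.range M, f (z - k * α)
  have hQm : Meromorphic Q := fun z =>
    MeromorphicAt.fun_prod fun k _ => hfm.comp_sub_const (k * α) z
  have hQu : K.HasUnitaryMultipliers Q := hasUnitaryMultipliers_of_periodic fun l hl z => by
    simp only [Q]
    refine Finset.prod_congr rfl fun k _ => ?_
    rw [add_sub_right_comm, hfper l hl]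
  have hQo : ∀ z, meromorphicOrderAt Q z =
      ∑ k ∈ Finset.range M, meromorphicOrderAt f (z - k * α) := fun z => by
    refine (meromorphicOrderAt_fun_prod (f := fun (k : ℕ) z => f (z - k * α)) fun k _ => hfm.comp_sub_const (k * α) z).trans ?_
    exact Finset.sum_congr rfl fun k _ => meromorphicOrderAt_comp_sub f _ z
  have hQmul : ∀ m : ℤ, meromorphicOrderAt Q (m * α) = ∑ k ∈ Finset.range M, n k := fun m => by
    rw [hQo, ← Finset.sum_range_add_of_periodic hper (-m)]
    push_cast
    refine Finset.sum_congr rfl fun k _ => ?_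
    rw [← hn]
    congr 1
    push_cast
    ring
  have hnonneg : ∀ z ∉ L'.lattice, ∀ k : ℕ, 0 ≤ meromorphicOrderAt f (z - k * α) :=
    fun z hz k => K.order_weierstrassP_sub_const_nonneg _ fun h' =>
      hz (h.mem_lattice_iff.2 ⟨k, by simpa using h'⟩)
  have key := hQu.meromorphicOrderAt_eq_zero hQm (x := (0 : ℤ) * α) (fun z => by
    by_cases hz : z ∈ L'.lattice
    · obtain ⟨m, hm⟩ := h.mem_lattice_iff.1 hz
      have h1 := hQu.meromorphicOrderAt_add hm (m * α)
      rw [add_sub_cancel] at h1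
      rw [h1, hQmul]
      exact_mod_cast hsum
    · rw [hQo]
      exact Finset.sum_nonneg fun k _ => hnonneg z hz k) (by rw [hQmul]; exact WithTop.coe_ne_top)
  constructor
  · intro z hz hzα
    have h1 := key z
    rw [hQo] at h1
    have h2 := (Finset.sum_eq_zero_iff_of_nonneg fun k _ => hnonneg z hz k).1 h1 0
      (Finset.mem_range.2 (by omega))
    have h3 := (K.analyticAt_weierstrassP_sub_const (K.weierstrassP α)
      (fun h' => hz (h.le_lattice h'))).one_le_meromorphicOrderAt (sub_eq_zero.2 hzα)
    rw [Nat.cast_zero, zero_mul, sub_zero] at h2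
    rw [hf] at h2
    rw [h2] at h3
    exact absurd h3 (by decide)
  · intro k hk
    have h1 := key ((0 : ℤ) * α)
    rw [hQmul] at h1
    have h2 : ∑ k ∈ Finset.range M, (n k - δ k) = 0 := by
      rw [Finset.sum_sub_distrib, hδsum]
      have : ∑ k ∈ Finset.range M, n k = 0 := by exact_mod_cast h1
      rw [this, sub_zero]
    have h3 := (Finset.sum_eq_zero_iff_of_nonneg hδ).1 h2 k (Finset.mem_range.2 hk)
    have h4 := hn k
    rw [Int.cast_natCast] at h4
    rw [h4, sub_eq_zero.1 h3]

end IsTorsionExtension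
end PeriodPair

/-! ### The functions P_j: multipliers, parity and poles -/

theorem rootOfUnity_ne_zero (M : ℕ) : rootOfUnity M ≠ 0 := Complex.exp_ne_zero _

theorem isPrimitiveRoot_rootOfUnity {M : ℕ} (hM : M ≠ 0) : IsPrimitiveRoot (rootOfUnity M) M :=
  Complex.isPrimitiveRoot_exp M hM

theorem norm_rootOfUnity {M : ℕ} (hM : M ≠ 0) : ‖rootOfUnity M‖ = 1 :=
  (isPrimitiveRoot_rootOfUnity hM).norm'_eq_one hM

namespace PeriodPair

variable {K L' : PeriodPair} {M : ℕ} {α : ℂ}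

theorem P_add_mem {l : ℂ} (hl : l ∈ K.lattice) (j : ℤ) (z : ℂ) :
    K.P M α j (z + l) = K.P M α j z := by
  unfold P
  refine Finset.sum_congr rfl fun k _ => ?_
  rw [add_sub_right_comm, K.derivWeierstrassP_add hl, K.weierstrassP_add hl]

theorem meromorphic_P (j : ℤ) : Meromorphic (K.P M α j) := fun z =>
  MeromorphicAt.fun_sum (G := fun (k : ℕ) z => rootOfUnity M ^ (-((k : ℤ) * j)) *
    (K.derivWeierstrassP (z - k * α) / (K.weierstrassP (z - k * α) - K.weierstrassP α)))
    fun k _ => (MeromorphicAt.const _ z).mul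
      ((K.meromorphic_derivWeierstrassP.comp_sub_const (k * α) z).div
        ((K.meromorphic_weierstrassP_sub_const (K.weierstrassP α)).comp_sub_const (k * α) z))

variable (K M α) in
/-- The summands of `P`, indexed by all integers. -/
def PSummand (j : ℤ) (z : ℂ) (k : ℤ) : ℂ :=
  rootOfUnity M ^ (-(k * j)) *
    (K.derivWeierstrassP (z - k * α) / (K.weierstrassP (z - k * α) - K.weierstrassP α))

theorem P_eq_sum_PSummand (j : ℤ) (z : ℂ) :
    K.P M α j z = ∑ k ∈ Finset.range M, K.PSummand M α j z k := by
  simp [P, PSummand]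

namespace IsTorsionExtension

variable (h : K.IsTorsionExtension L' M α)
include h

theorem ne_zero : M ≠ 0 := by
  have := h.three_le
  omega

theorem isPrimitiveRoot : IsPrimitiveRoot (rootOfUnity M) M := isPrimitiveRoot_rootOfUnity h.ne_zero

theorem periodic_summand (j : ℤ) (z : ℂ) (k : ℤ) :
    K.PSummand M α j z (k + M) = K.PSummand M α j z k := by
  unfold PSummand
  have h1 : rootOfUnity M ^ (-((k + M) * j)) = rootOfUnity M ^ (-(k * j)) := by
    rw [show -((k + M) * j) = -(k * j) + M * (-j) by ring, zpow_add₀ (rootOfUnity_ne_zero M),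
      zpow_mul, zpow_natCast, h.isPrimitiveRoot.pow_eq_one, one_zpow, mul_one]
  have h2 : z - ((k + M : ℤ) : ℂ) * α = z - k * α + -(M * α) := by push_cast; ring
  rw [h1, h2, K.derivWeierstrassP_add (neg_mem h.order_mul_mem),
    K.weierstrassP_add (neg_mem h.order_mul_mem)]

/-- The sum runs over ℤ/M, since both the root of unity and Mα ∈ K make the summand M-periodic;
translation by α only shifts the summation index. -/
theorem P_add_self (j : ℤ) (z : ℂ) :
    K.P M α j (z + α) = rootOfUnity M ^ (-j) * K.P M α j z := by
  have h1 := Finset.sum_range_add_of_periodic (h.periodic_summand j z) (-1)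
  rw [P_eq_sum_PSummand, P_eq_sum_PSummand, ← h1, Finset.mul_sum]
  refine Finset.sum_congr rfl fun k _ => ?_
  unfold PSummand
  rw [← mul_assoc, ← zpow_add₀ (rootOfUnity_ne_zero M)]
  rw [show -j + -((k + -1 : ℤ) * j) = -(k * j) by ring,
    show z - ((k + -1 : ℤ) : ℂ) * α = z + α - (k : ℤ) * α by push_cast; ring]

theorem P_add_zsmul (j m : ℤ) (z : ℂ) :
    K.P M α j (z + m * α) = rootOfUnity M ^ (-(j * m)) * K.P M α j z := by
  induction m using Int.induction_on generalizing z with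
  | zero => simp
  | succ i ih =>
    rw [show z + ((i + 1 : ℤ) : ℂ) * α = z + (i : ℤ) * α + α by push_cast; ring, h.P_add_self, ih,
      ← mul_assoc, ← zpow_add₀ (rootOfUnity_ne_zero M)]
    congr 2
    ring
  | pred i ih =>
    have h1 := h.P_add_self j (z + ((-i - 1 : ℤ) : ℂ) * α)
    rw [show z + ((-i - 1 : ℤ) : ℂ) * α + α = z + ((-i : ℤ) : ℂ) * α by push_cast; ring, ih] at h1
    rw [show -(j * (-(i : ℤ) - 1)) = j + -(j * -(i : ℤ)) by ring,
      zpow_add₀ (rootOfUnity_ne_zero M), mul_assoc, h1, ← mul_assoc, ← zpow_add₀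
      (rootOfUnity_ne_zero M), add_neg_cancel, zpow_zero, one_mul]

/-- Replace k by -k in the sum; the sign comes from ℘' being odd and ℘ even. -/
theorem P_neg (j : ℤ) (z : ℂ) : K.P M α j (-z) = -K.P M α (-j) z := by
  have h1 := Finset.sum_range_neg_of_periodic (h.periodic_summand (-j) z)
  rw [P_eq_sum_PSummand, P_eq_sum_PSummand, ← h1, ← Finset.sum_neg_distrib]
  refine Finset.sum_congr rfl fun k _ => ?_
  unfold PSummand
  rw [show z - ((-(k : ℤ) : ℤ) : ℂ) * α = -(-z - (k : ℤ) * α) by push_cast; ring,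
    K.derivWeierstrassP_neg, K.weierstrassP_neg, neg_mul_neg]
  ring

theorem hasUnitaryMultipliers_P (j : ℤ) : L'.HasUnitaryMultipliers (K.P M α j) := by
  intro l hl
  obtain ⟨m, hm⟩ := h.mem_lattice_iff.1 hl
  refine ⟨rootOfUnity M ^ (-(j * m)), ?_, fun z => ?_⟩
  · rw [norm_zpow, norm_rootOfUnity h.ne_zero, one_zpow]
  · rw [← h.P_add_zsmul, ← P_add_mem hm j (z + m * α)]
    congr 1
    ring

theorem analyticAt_P (j : ℤ) {z : ℂ} (hz : z ∉ L'.lattice) : AnalyticAt ℂ (K.P M α j) z := by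
  refine Finset.analyticAt_fun_sum (f := fun (k : ℕ) z => rootOfUnity M ^ (-((k : ℤ) * j)) *
    (K.derivWeierstrassP (z - k * α) / (K.weierstrassP (z - k * α) - K.weierstrassP α))) _
    fun k _ => analyticAt_const.mul ?_
  have h1 : z - k * α ∉ L'.lattice := fun h1 => hz (by
    have := add_mem h1 (h.mul_mem_lattice k)
    simpa using this)
  have h2 : z - k * α ∉ K.lattice := fun h2 => h1 (h.le_lattice h2)
  exact (K.analyticAt_derivWeierstrassP h2).comp_sub_const.fun_div
    (K.analyticAt_weierstrassP_sub_const (K.weierstrassP α) h2).comp_sub_const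
    (sub_ne_zero.2 (h.orders_eq.1 _ h1))

/-- The k-th summand is ω^(-kj) times the logarithmic derivative of ℘ - ℘(α) at z - kα. Its residue
at z = 0 is therefore the weighted order at -kα, and only k = 0, 1, M - 1 contribute. -/
theorem tendsto_mul_P (j : ℤ) : Filter.Tendsto (fun z => z * K.P M α j z) (𝓝[≠] 0)
    (𝓝 (-2 + rootOfUnity M ^ (-j) + rootOfUnity M ^ j)) := by
  have hM := h.three_le
  have h1 : ∀ k ∈ Finset.range M, Filter.Tendsto (fun z => rootOfUnity M ^ (-((k : ℤ) * j)) *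
      (z * (K.derivWeierstrassP (z - k * α) / (K.weierstrassP (z - k * α) - K.weierstrassP α))))
      (𝓝[≠] 0) (𝓝 (rootOfUnity M ^ (-((k : ℤ) * j)) *
        (((if k = 0 then -2 else 0) + (if k = 1 then 1 else 0) +
        (if k = M - 1 then 1 else 0) : ℤ) : ℂ))) := fun k hk => by
    refine Filter.Tendsto.const_mul _ ?_
    have h2 := tendsto_mul_deriv_div (K.meromorphic_weierstrassP_sub_const (K.weierstrassP α) _)
      (h.orders_eq.2 k (Finset.mem_range.1 hk))
    have h3 := tendsto_add_nhdsNE 0 (-((k : ℂ) * α))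
    rw [zero_add] at h3
    refine (h2.comp h3).congr fun z => ?_
    simp only [Function.comp_apply, deriv_sub_const_fun, deriv_weierstrassP]
    rw [sub_neg_eq_add, neg_add_cancel_right, ← sub_eq_add_neg]
  have h2 := tendsto_finsetSum _ h1
  rw [sum_mul_indicator hM (fun k : ℕ => rootOfUnity M ^ (-((k : ℤ) * j)))] at h2
  convert h2 using 2
  · unfold P
    rw [Finset.mul_sum]
    refine Finset.sum_congr rfl fun k _ => ?_
    ring
  · have h3 : rootOfUnity M ^ (-(((M - 1 : ℕ) : ℤ) * j)) = rootOfUnity M ^ j := by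
      rw [show -(((M - 1 : ℕ) : ℤ) * j) = j + M * (-j) by
        rw [Nat.cast_sub (by omega)]; push_cast; ring, zpow_add₀ (rootOfUnity_ne_zero M),
        zpow_mul, zpow_natCast, h.isPrimitiveRoot.pow_eq_one, one_zpow, mul_one]
    rw [h3]
    simp

/-- The residue -2 + ω^(-j) + ω^j equals (ω^j - 1)²/ω^j, nonzero exactly because M does not divide
j. -/
theorem order_P {j : ℤ} (hj : ¬ (M : ℤ) ∣ j) {l : ℂ} (hl : l ∈ L'.lattice) :
    meromorphicOrderAt (K.P M α j) l = -1 := by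
  have h0 := (h.hasUnitaryMultipliers_P j).meromorphicOrderAt_add hl 0
  rw [zero_add] at h0
  rw [h0]
  have hne : -2 + rootOfUnity M ^ (-j) + rootOfUnity M ^ j ≠ 0 := by
    have h1 : rootOfUnity M ^ j ≠ 1 := fun h1 => hj (h.isPrimitiveRoot.zpow_eq_one_iff_dvd j |>.1 h1)
    have h2 := zpow_ne_zero j (rootOfUnity_ne_zero M)
    have h3 : -2 + rootOfUnity M ^ (-j) + rootOfUnity M ^ j =
        (rootOfUnity M ^ j - 1) ^ 2 / rootOfUnity M ^ j := by
      rw [zpow_neg]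
      field_simp
      ring
    rw [h3]
    exact div_ne_zero (pow_ne_zero 2 (sub_ne_zero.2 h1)) h2
  have h1 : meromorphicOrderAt (id * K.P M α j) 0 = 0 :=
    (tendsto_ne_zero_iff_meromorphicOrderAt_eq_zero ((MeromorphicAt.id 0).mul (K.meromorphic_P (M := M) (α := α) j 0))).1 ⟨_, hne, h.tendsto_mul_P j⟩
  rw [meromorphicOrderAt_mul (MeromorphicAt.id 0) (K.meromorphic_P j 0), meromorphicOrderAt_id] at h1
  cases h' : meromorphicOrderAt (K.P M α j) 0 with
  | top => simp [h'] at h1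
  | coe m =>
    rw [h'] at h1
    have h2 : (1 : ℤ) + m = 0 := by exact_mod_cast h1
    rw [show m = -1 by omega]
    rfl

end IsTorsionExtension
end PeriodPair

/-! ### Zeros of functions with one simple pole, and the relation defining λ and μ -/

namespace PeriodPair

/-- `f` has unitary multipliers, simple poles at the lattice points, and no other poles. -/
structure HasSimplePoles (L : PeriodPair) (f : ℂ → ℂ) : Prop where
  meromorphic : Meromorphic f
  multipliers : L.HasUnitaryMultipliers f
  analyticAt : ∀ z ∉ L.lattice, AnalyticAt ℂ f z
  order : ∀ l ∈ L.lattice, meromorphicOrderAt f l = -1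

namespace HasSimplePoles

variable {L : PeriodPair} {f g : ℂ → ℂ}

theorem order_ne_top (hf : L.HasSimplePoles f) (z : ℂ) : meromorphicOrderAt f z ≠ ⊤ :=
  MeromorphicOn.meromorphicOrderAt_ne_top_of_isPreconnected (U := Set.univ) (x := 0)
    (fun z _ => hf.meromorphic z) isPreconnected_univ (Set.mem_univ _) (Set.mem_univ _)
    (by rw [hf.order 0 (zero_mem _)]; decide)

/-- Without zeros, 1/f would have no poles but would vanish on the lattice, against Liouville's
theorem. -/
theorem exists_zero (hf : L.HasSimplePoles f) : ∃ z ∉ L.lattice, f z = 0 := by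
  by_contra! H
  have h1 : ∀ l ∈ L.lattice, meromorphicOrderAt f⁻¹ l = 1 := fun l hl => by
    rw [meromorphicOrderAt_inv, hf.order l hl]; rfl
  have h2 := hf.multipliers.inv.meromorphicOrderAt_eq_zero (fun z => (hf.meromorphic z).inv)
    (x := 0) (fun z => by
      by_cases hz : z ∈ L.lattice
      · rw [h1 z hz]; decide
      · rw [meromorphicOrderAt_inv, (hf.analyticAt z hz).meromorphicOrderAt_eq_zero (H z hz)]
        decide) (by rw [h1 0 (zero_mem _)]; decide) 0
  rw [h1 0 (zero_mem _)] at h2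
  exact absurd h2 (by decide)

/-- In f(z)f(z₀ - z) the zero of one factor at z₀ cancels the simple pole of the other. Consequently
the zeros of f are simple and form a single class modulo the lattice. -/
theorem order_add_order_const_sub (hf : L.HasSimplePoles f) {z₀ : ℂ} (hz₀ : z₀ ∉ L.lattice)
    (h0 : f z₀ = 0) (z : ℂ) : meromorphicOrderAt f z + meromorphicOrderAt f (z₀ - z) = 0 := by
  have hord : ∀ z, meromorphicOrderAt (f * fun z => f (z₀ - z)) z =
      meromorphicOrderAt f z + meromorphicOrderAt f (z₀ - z) := fun z => by
    rw [meromorphicOrderAt_mul (hf.meromorphic z) (hf.meromorphic.comp_const_sub z₀ z),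
      meromorphicOrderAt_comp_const_sub]
  have hone : 1 ≤ meromorphicOrderAt f z₀ := (hf.analyticAt z₀ hz₀).one_le_meromorphicOrderAt h0
  rw [← hord]
  refine (hf.multipliers.mul (hf.multipliers.comp_const_sub z₀)).meromorphicOrderAt_eq_zero
    (fun z => (hf.meromorphic z).mul (hf.meromorphic.comp_const_sub z₀ z)) (x := 0) (fun z => ?_)
    ?_ z
  · rw [hord]
    by_cases h1 : z ∈ L.lattice
    · rw [hf.order z h1, sub_eq_add_neg, hf.multipliers.meromorphicOrderAt_add (neg_mem h1)]
      calc (0 : WithTop ℤ) = -1 + 1 := by decide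
        _ ≤ _ := add_le_add_right hone _
    by_cases h2 : z₀ - z ∈ L.lattice
    · have h3 := hf.multipliers.meromorphicOrderAt_add (neg_mem h2) z₀
      rw [← sub_eq_add_neg, sub_sub_cancel] at h3
      rw [hf.order _ h2, h3]
      calc (0 : WithTop ℤ) = 1 + -1 := by decide
        _ ≤ _ := add_le_add_left hone _
    exact add_nonneg (hf.analyticAt _ h1).meromorphicOrderAt_nonneg
      (hf.analyticAt _ h2).meromorphicOrderAt_nonneg
  · rw [hord]
    simp [hf.order_ne_top]

theorem order_eq_of_zero (hf : L.HasSimplePoles f) (hg : L.HasSimplePoles g) {z₀ : ℂ}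
    (hz₀ : z₀ ∉ L.lattice) (hf0 : f z₀ = 0) (hg0 : g z₀ = 0) (z : ℂ) :
    meromorphicOrderAt f z = meromorphicOrderAt g z := by
  by_cases h1 : z ∈ L.lattice
  · rw [hf.order z h1, hg.order z h1]
  have hf1 := hf.order_add_order_const_sub hz₀ hf0 z
  have hg1 := hg.order_add_order_const_sub hz₀ hg0 z
  by_cases h2 : z₀ - z ∈ L.lattice
  · rw [hf.order _ h2] at hf1
    rw [hg.order _ h2, ← hf1] at hg1
    exact ((WithTop.add_right_inj (by decide)).1 hg1).symm
  · rw [(add_eq_zero_iff_of_nonneg (hf.analyticAt _ h1).meromorphicOrderAt_nonneg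
        (hf.analyticAt _ h2).meromorphicOrderAt_nonneg).1 hf1 |>.1,
      (add_eq_zero_iff_of_nonneg (hg.analyticAt _ h1).meromorphicOrderAt_nonneg
        (hg.analyticAt _ h2).meromorphicOrderAt_nonneg).1 hg1 |>.1]

/-- Two such functions with a common zero have the same multipliers. -/
theorem multiplier_eq_of_common_zero (hf : L.HasSimplePoles f) (hg : L.HasSimplePoles g) {z₀ : ℂ}
    (hz₀ : z₀ ∉ L.lattice) (hf0 : f z₀ = 0) (hg0 : g z₀ = 0) {α a b : ℂ}
    (ha : ∀ z, f (z + α) = a * f z) (hb : ∀ z, g (z + α) = b * g z) : a = b := by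
  -- A common zero forces the two divisors to coincide, so f/g is a nonzero constant and the
  -- multipliers agree.
  have hord : ∀ z, meromorphicOrderAt (f * g⁻¹) z = 0 := fun z => by
    rw [meromorphicOrderAt_mul (hf.meromorphic z) (hg.meromorphic z).inv, meromorphicOrderAt_inv,
      hf.order_eq_of_zero hg hz₀ hf0 hg0]
    lift meromorphicOrderAt g z to ℤ using hg.order_ne_top z with n
    norm_cast
    omega
  obtain ⟨c, hc, h⟩ := (hf.multipliers.mul hg.multipliers.inv).exists_ne_zero_eventually_eq_const
    (fun z => (hf.meromorphic z).mul (hg.meromorphic z).inv) (fun z => (hord z).ge) (x := 0)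
    (by rw [hord]; decide)
  have hsh := tendsto_add_nhdsNE 0 α
  rw [zero_add] at hsh
  obtain ⟨w, h1, h2⟩ := ((h 0).and (hsh.eventually (h α))).exists
  simp only [Pi.mul_apply, Pi.inv_apply] at h1 h2
  have hfw : f w ≠ 0 := fun h3 => hc (by rw [← h1, h3, zero_mul])
  have hgw : g w ≠ 0 := fun h3 => hc (by rw [← h1, h3, inv_zero, mul_zero])
  have hgw' : g (w + α) ≠ 0 := fun h3 => hc (by rw [← h2, h3, inv_zero, mul_zero])
  rw [← h1, ← div_eq_mul_inv, ← div_eq_mul_inv, div_eq_div_iff hgw' hgw, ha, hb] at h2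
  have h3 : (a - b) * (f w * g w) = 0 := by linear_combination h2
  exact sub_eq_zero.1 ((mul_eq_zero.1 h3).resolve_right (mul_ne_zero hfw hgw))

end HasSimplePoles

namespace IsTorsionExtension

variable {K L' : PeriodPair} {M : ℕ} {α : ℂ} (h : K.IsTorsionExtension L' M α)
include h

theorem hasSimplePoles_P {j : ℤ} (hj : ¬ (M : ℤ) ∣ j) : L'.HasSimplePoles (K.P M α j) where
  meromorphic := meromorphic_P j
  multipliers := h.hasUnitaryMultipliers_P j
  analyticAt := fun _ hz => h.analyticAt_P j hz
  order := fun _ hl => h.order_P hj hl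

theorem dvd_of_P_common_zero {i j : ℤ} (hi : ¬ (M : ℤ) ∣ i) (hj : ¬ (M : ℤ) ∣ j) {z : ℂ}
    (hz : z ∉ L'.lattice) (h1 : K.P M α i z = 0) (h2 : K.P M α j z = 0) : (M : ℤ) ∣ i - j := by
  have h3 := (h.hasSimplePoles_P hi).multiplier_eq_of_common_zero (h.hasSimplePoles_P hj) hz h1 h2
    (h.P_add_self i) (h.P_add_self j)
  rw [← h.isPrimitiveRoot.zpow_eq_one_iff_dvd, zpow_sub₀ (rootOfUnity_ne_zero M),
    div_eq_one_iff_eq (zpow_ne_zero _ (rootOfUnity_ne_zero M))]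
  rw [zpow_neg, zpow_neg, inv_inj] at h3
  exact h3

/-- Both the left-hand side F and H = P_{-j}P_j are even and elliptic for Λ'. F has a pole of order
at most 3 at 0, hence by parity at most 2, while H has a pole of order exactly 2. Some F - λH
therefore has order above -2, by parity no pole, and is a constant μ. -/
theorem exists_relation {j : ℤ} (hj : ¬ (M : ℤ) ∣ 2 * j) : ∃ l m : ℂ, m ≠ 0 ∧
    ∀ z ∉ L'.lattice, K.P M α (2 * j) z * K.P M α (-j) z ^ 2 - K.P M α (-2 * j) z * K.P M α j z ^ 2
      = l * (K.P M α (-j) z * K.P M α j z) + m := by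
  have hj1 : ¬ (M : ℤ) ∣ j := fun h' => hj (h'.mul_left 2)
  have hj2 : ¬ (M : ℤ) ∣ -j := by rwa [dvd_neg]
  have hj3 : ¬ (M : ℤ) ∣ -2 * j := by rwa [neg_mul, dvd_neg]
  set F : ℂ → ℂ := fun z => K.P M α (2 * j) z * K.P M α (-j) z ^ 2 -
    K.P M α (-2 * j) z * K.P M α j z ^ 2 with hF
  set H : ℂ → ℂ := fun z => K.P M α (-j) z * K.P M α j z with hH
  have hFper : ∀ l ∈ L'.lattice, ∀ z, F (z + l) = F z := fun l hl z => by
    obtain ⟨m, hm⟩ := h.mem_lattice_iff.1 hl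
    have h1 : ∀ i, K.P M α i (z + l) = (rootOfUnity M ^ m) ^ (-i) * K.P M α i z := fun i => by
      rw [← zpow_mul, show m * -i = -(i * m) by ring, ← h.P_add_zsmul,
        ← P_add_mem hm i (z + m * α)]
      congr 1
      ring
    have h2 : rootOfUnity M ^ m ≠ 0 := zpow_ne_zero _ (rootOfUnity_ne_zero M)
    simp only [hF, h1]
    rw [show -(2 * j) = -j + -j by ring, show -(-2 * j) = j + j by ring, zpow_add₀ h2, zpow_add₀ h2,
      neg_neg, zpow_neg]
    have := zpow_ne_zero j h2
    field_simp
  have hHper : ∀ l ∈ L'.lattice, ∀ z, H (z + l) = H z := fun l hl z => by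
    obtain ⟨m, hm⟩ := h.mem_lattice_iff.1 hl
    have h1 : ∀ i, K.P M α i (z + l) = (rootOfUnity M ^ m) ^ (-i) * K.P M α i z := fun i => by
      rw [← zpow_mul, show m * -i = -(i * m) by ring, ← h.P_add_zsmul,
        ← P_add_mem hm i (z + m * α)]
      congr 1
      ring
    have h2 : rootOfUnity M ^ m ≠ 0 := zpow_ne_zero _ (rootOfUnity_ne_zero M)
    simp only [hH, h1]
    rw [neg_neg, zpow_neg]
    have := zpow_ne_zero j h2
    field_simp
  have hFe : ∀ z, F (-z) = F z := fun z => by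
    simp only [hF, h.P_neg]
    rw [show -(2 * j) = -2 * j by ring, show -(-2 * j) = 2 * j by ring, neg_neg]
    ring
  have hHe : ∀ z, H (-z) = H z := fun z => by
    simp only [hH, h.P_neg, neg_neg]
    ring
  have hP := fun i => meromorphic_P (K := K) (M := M) (α := α) i
  have hHm : Meromorphic H := fun z => (hP (-j) z).mul (hP j z)
  have hFm : Meromorphic F := fun z => ((hP (2 * j) z).mul ((hP (-j) z).pow 2)).sub
    ((hP (-2 * j) z).mul ((hP j z).pow 2))
  have hHo : meromorphicOrderAt H 0 = ((-2 : ℤ) : WithTop ℤ) := by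
    refine (meromorphicOrderAt_mul (hP (-j) 0) (hP j 0)).trans ?_
    rw [h.order_P hj1 (zero_mem _), h.order_P hj2 (zero_mem _)]
    rfl
  have hFo : ((2 * -1 - 1 : ℤ) : WithTop ℤ) ≤ meromorphicOrderAt F 0 := by
    have h1 : ∀ a b : ℤ, ¬ (M : ℤ) ∣ a → ¬ (M : ℤ) ∣ b →
        meromorphicOrderAt (fun z => K.P M α a z * K.P M α b z ^ 2) 0 = ((-3 : ℤ) : WithTop ℤ) := by
      intro a b ha hb
      refine (meromorphicOrderAt_mul (hP a 0) ((hP b 0).pow 2)).trans ?_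
      rw [meromorphicOrderAt_pow (hP b 0), h.order_P ha (zero_mem _), h.order_P hb (zero_mem _)]
      rfl
    have h2 := meromorphicOrderAt_add ((hP (2 * j) 0).mul ((hP (-j) 0).pow 2))
      ((hP (-2 * j) 0).mul ((hP j 0).pow 2)).neg
    rw [← meromorphicOrderAt_neg] at h2
    refine le_trans ?_ (h2.trans_eq (congrArg (meromorphicOrderAt · 0) (by
      ext z; simp [hF, sub_eq_add_neg])))
    exact le_min (h1 _ _ hj hj2).ge (h1 _ _ hj3 hj1).ge
  obtain ⟨l, hl⟩ := exists_lt_meromorphicOrderAt_sub (hFm 0) (hHm 0) hHo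
    (le_meromorphicOrderAt_zero_of_even (n := -1) (hFm 0) hFe hFo)
  have hGm : Meromorphic fun z => F z - l * H z := fun z =>
    (hFm z).sub ((MeromorphicAt.const l z).mul (hHm z))
  have hGa : ∀ z ∉ L'.lattice, AnalyticAt ℂ (fun z => F z - l * H z) z := fun z hz => by
    have hP := fun i => h.analyticAt_P i hz
    exact (((hP (2 * j)).mul ((hP (-j)).pow 2)).sub ((hP (-2 * j)).mul ((hP j).pow 2))).sub
      (analyticAt_const.mul ((hP (-j)).mul (hP j)))
  have hGu := hasUnitaryMultipliers_of_periodic (L := L') (f := fun z => F z - l * H z)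
    (fun l hl z => by simp only [hFper l hl, hHper l hl])
  have hG0 : 0 ≤ meromorphicOrderAt (fun z => F z - l * H z) 0 :=
    le_meromorphicOrderAt_zero_of_even (n := 0) (hGm 0) (fun z => by simp only [hFe, hHe]) (by
      cases h' : meromorphicOrderAt (fun z => F z - l * H z) 0 with
      | top => exact le_top
      | coe m =>
        rw [h'] at hl
        norm_cast at hl ⊢)
  obtain ⟨m, hm⟩ := hGu.exists_eventually_eq_const hGm fun z => by
    by_cases hz : z ∈ L'.lattice
    · have h1 := hGu.meromorphicOrderAt_add hz 0
      rw [zero_add] at h1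
      rw [h1]
      exact hG0
    · exact (hGa z hz).meromorphicOrderAt_nonneg
  have hrel : ∀ z ∉ L'.lattice, F z = l * H z + m := fun z hz => by
    have := (hGa z hz).eq_of_eventually_nhdsNE (hm z)
    linear_combination this
  refine ⟨l, m, ?_, hrel⟩
  rintro rfl
  -- At a zero of P_j, μ = 0 would make P_{2j} or P_{-j} vanish as well. A common zero means equal
  -- multipliers, so M would divide j or 2j.
  obtain ⟨z, hz, hz0⟩ := (h.hasSimplePoles_P hj1).exists_zero
  have h1 := hrel z hz
  simp only [hF, hH, hz0] at h1
  have h2 : K.P M α (2 * j) z * K.P M α (-j) z ^ 2 = 0 := by linear_combination h1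
  rcases mul_eq_zero.1 h2 with h3 | h3
  · have := h.dvd_of_P_common_zero hj hj1 hz h3 hz0
    rw [show 2 * j - j = j by ring] at this
    exact hj1 this
  · have := h.dvd_of_P_common_zero hj1 hj2 hz hz0 (pow_eq_zero_iff two_ne_zero |>.1 h3)
    rw [show j - -j = 2 * j by ring] at this
    exact hj this

end IsTorsionExtension
end PeriodPair

/-! ### The lattice Λ̂ and the matrix Φ -/

namespace PeriodPair

variable {L L' : PeriodPair} {N : ℕ} {α : ℂ}

theorem mem_double₁ {L : PeriodPair} {x : ℂ} :
    x ∈ L.double₁.lattice ↔ ∃ a b : ℤ, 2 * a * L.ω₁ + b * L.ω₂ = x := by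
  rw [mem_lattice]
  refine exists_congr fun a => exists_congr fun b => ?_
  change a * (2 * L.ω₁) + b * L.ω₂ = x ↔ _
  rw [← mul_assoc, mul_comm (a : ℂ) 2]

theorem mem_double₂ {L : PeriodPair} {x : ℂ} :
    x ∈ L.double₂.lattice ↔ ∃ a b : ℤ, a * L.ω₁ + 2 * b * L.ω₂ = x := by
  rw [mem_lattice]
  refine exists_congr fun a => exists_congr fun b => ?_
  change a * L.ω₁ + b * (2 * L.ω₂) = x ↔ _
  rw [← mul_assoc, mul_comm (b : ℂ) 2]

theorem coeff_eq_of_mem {L : PeriodPair} {a b c d : ℤ}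
    (h : a * L.ω₁ + b * L.ω₂ = c * L.ω₁ + d * L.ω₂) : a = c ∧ b = d := by
  have h1 := LinearIndependent.pair_iff.1 L.indep (a - c) (b - d) (by
    simp only [Complex.real_smul]
    push_cast
    linear_combination h)
  exact ⟨by exact_mod_cast sub_eq_zero.1 h1.1, by exact_mod_cast sub_eq_zero.1 h1.2⟩

/-- `K` is a sublattice of index two of `L` which does not contain `β ∈ L`. -/
structure IsIndexTwo (K L : PeriodPair) (β : ℂ) : Prop where
  le : ∀ x ∈ K.lattice, x ∈ L.lattice
  two_mul_mem : ∀ x ∈ L.lattice, 2 * x ∈ K.lattice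
  notMem : β ∉ K.lattice
  mem_or : ∀ x ∈ L.lattice, x ∈ K.lattice ∨ x - β ∈ K.lattice

theorem isIndexTwo_double₁ {a b : ℤ} (ha : Odd a) :
    IsIndexTwo L.double₁ L (a * L.ω₁ + b * L.ω₂) where
  le x hx := by
    obtain ⟨a, b, rfl⟩ := mem_double₁.1 hx
    exact mem_lattice.2 ⟨2 * a, b, by push_cast; ring⟩
  two_mul_mem x hx := by
    obtain ⟨a, b, rfl⟩ := mem_lattice.1 hx
    exact mem_double₁.2 ⟨a, 2 * b, by push_cast; ring⟩
  notMem h := by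
    obtain ⟨c, d, h⟩ := mem_double₁.1 h
    have h1 : ((2 * c : ℤ) : ℂ) * L.ω₁ + d * L.ω₂ = a * L.ω₁ + b * L.ω₂ := by
      rw [← h]; push_cast; ring
    have := (coeff_eq_of_mem h1).1
    obtain ⟨k, hk⟩ := ha
    omega
  mem_or x hx := by
    obtain ⟨c, d, rfl⟩ := mem_lattice.1 hx
    obtain ⟨k, rfl⟩ := ha
    rcases Int.even_or_odd c with ⟨e, rfl⟩ | ⟨e, rfl⟩
    · exact Or.inl (mem_double₁.2 ⟨e, d, by push_cast; ring⟩)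
    · exact Or.inr (mem_double₁.2 ⟨e - k, d - b, by push_cast; ring⟩)

theorem isIndexTwo_double₂ {a b : ℤ} (hb : Odd b) :
    IsIndexTwo L.double₂ L (a * L.ω₁ + b * L.ω₂) where
  le x hx := by
    obtain ⟨a, b, rfl⟩ := mem_double₂.1 hx
    exact mem_lattice.2 ⟨a, 2 * b, by push_cast; ring⟩
  two_mul_mem x hx := by
    obtain ⟨a, b, rfl⟩ := mem_lattice.1 hx
    exact mem_double₂.2 ⟨2 * a, b, by push_cast; ring⟩
  notMem h := by
    obtain ⟨c, d, h⟩ := mem_double₂.1 h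
    have h1 : (c : ℂ) * L.ω₁ + ((2 * d : ℤ) : ℂ) * L.ω₂ = a * L.ω₁ + b * L.ω₂ := by
      rw [← h]; push_cast; ring
    have := (coeff_eq_of_mem h1).2
    obtain ⟨k, hk⟩ := hb
    omega
  mem_or x hx := by
    obtain ⟨c, d, rfl⟩ := mem_lattice.1 hx
    obtain ⟨k, rfl⟩ := hb
    rcases Int.even_or_odd d with ⟨e, rfl⟩ | ⟨e, rfl⟩
    · exact Or.inl (mem_double₂.2 ⟨c, e, by push_cast; ring⟩)
    · exact Or.inr (mem_double₂.2 ⟨c - a, e - k, by push_cast; ring⟩)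

/-- For even N the index-two sublattice must avoid Nα, so that α has order 2N modulo Λ̂. Write Nα =
aω₁ + bω₂: a and b are not both even because Nα/2 ∉ Λ, and doubling a period whose coefficient is
odd removes Nα from the lattice. -/
theorem isIndexTwo_hat (hN : 1 ≤ N) (hα : ∀ k : ℤ, k * α ∈ L.lattice ↔ (N : ℤ) ∣ k)
    (he : ¬ Odd N) : IsIndexTwo (L.hat N α) L (N * α) := by
  have hβ : (N : ℂ) * α ∈ L.lattice := by simpa using (hα N).2 dvd_rfl
  have hβ2 : (N : ℂ) * α / 2 ∉ L.lattice := fun h => by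
    obtain ⟨n, hn⟩ := Nat.not_odd_iff_even.1 he
    have h1 := (hα n).1 (by
      convert h using 1
      rw [hn]
      push_cast
      ring)
    have := Int.le_of_dvd (by omega) h1
    omega
  obtain ⟨a, b, hab⟩ := mem_lattice.1 hβ
  unfold hat
  rw [if_neg he]
  split_ifs with h1
  · rw [← hab] at h1 ⊢
    obtain ⟨c, d, hcd⟩ := mem_lattice.1 h1
    have h2 : ((2 * c : ℤ) : ℂ) * L.ω₁ + ((2 * d + 1 : ℤ) : ℂ) * L.ω₂ = a * L.ω₁ + b * L.ω₂ := by
      push_cast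
      linear_combination 2 * hcd
    exact isIndexTwo_double₂ ⟨d, (coeff_eq_of_mem h2).2.symm⟩
  · rw [← hab] at h1 hβ2 ⊢
    -- If a were even, then b even would put Nα/2 in Λ, and b odd would be the case already treated.
    refine isIndexTwo_double₁ ?_
    rw [← Int.not_even_iff_odd]
    rintro ⟨c, rfl⟩
    rcases Int.even_or_odd b with ⟨d, rfl⟩ | ⟨d, rfl⟩
    · exact hβ2 (mem_lattice.2 ⟨c, d, by push_cast; ring⟩)
    · exact h1 (mem_lattice.2 ⟨c, d, by push_cast; ring⟩)

/-- Passing to Λ̂ does not change the lattice generated together with α, because Nα represents the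
missing class. It also secures M ≥ 3 when N = 2. -/
theorem isTorsionExtension_hat (hN : 2 ≤ N) (hα : ∀ k : ℤ, k * α ∈ L.lattice ↔ (N : ℤ) ∣ k)
    (hL' : L'.lattice = L.lattice ⊔ Submodule.span ℤ {α}) :
    (L.hat N α).IsTorsionExtension L' (hatOrder N) α := by
  by_cases ho : Odd N
  · have h1 : L.hat N α = L := if_pos ho
    have h2 : hatOrder N = N := if_pos ho
    rw [h1, h2]
    refine ⟨?_, hα, hL'⟩
    obtain ⟨k, rfl⟩ := ho
    omega
  · have h1 := isIndexTwo_hat (L := L) (by omega) hα ho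
    have h2 : hatOrder N = 2 * N := if_neg ho
    have hβ : (N : ℂ) * α ∈ L.lattice := by simpa using (hα N).2 dvd_rfl
    have heven : ∀ k : ℤ, ((2 * k : ℤ) : ℂ) * (N * α) ∈ (L.hat N α).lattice := fun k => by
      have := h1.two_mul_mem (k * (N * α)) (by simpa using zsmul_mem hβ k)
      convert this using 1
      push_cast
      ring
    refine ⟨by omega, fun k => ?_, ?_⟩
    · rw [h2]
      constructor
      · intro hk
        obtain ⟨m, rfl⟩ := (hα k).1 (h1.le _ hk)
        rcases Int.even_or_odd m with ⟨c, rfl⟩ | ⟨c, rfl⟩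
        · exact ⟨c, by push_cast; ring⟩
        · refine absurd ?_ h1.notMem
          convert sub_mem hk (heven c) using 1
          push_cast
          ring
      · rintro ⟨c, rfl⟩
        convert heven c using 1
        push_cast
        ring
    · rw [hL']
      apply le_antisymm
      · refine sup_le (fun x hx => ?_) le_sup_right
        rcases h1.mem_or x hx with h3 | h3
        · exact mem_sup_span_singleton_iff.2 ⟨0, by simpa using h3⟩
        · exact mem_sup_span_singleton_iff.2 ⟨N, by simpa using h3⟩
      · exact sup_le_sup_right (show (L.hat N α).lattice ≤ L.lattice from h1.le) _

/-- Translation by an element of `L` multiplies the functions `P_i` by `εⁱ` with `ε = ±1`. -/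
theorem exists_sign_P_hat (hN : 2 ≤ N) (hα : ∀ k : ℤ, k * α ∈ L.lattice ↔ (N : ℤ) ∣ k)
    (hL' : L'.lattice = L.lattice ⊔ Submodule.span ℤ {α}) {l : ℂ} (hl : l ∈ L.lattice) :
    ∃ ε : ℂ, ε ^ 2 = 1 ∧ ∀ (i : ℤ) (z : ℂ), (L.hat N α).P (hatOrder N) α i (z + l) =
      ε ^ i * (L.hat N α).P (hatOrder N) α i z := by
  have h := isTorsionExtension_hat hN hα hL'
  by_cases hK : l ∈ (L.hat N α).lattice
  · exact ⟨1, one_pow 2, fun i z => by rw [P_add_mem hK, one_zpow, one_mul]⟩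
  have ho : ¬ Odd N := fun ho => hK (by rwa [show L.hat N α = L from if_pos ho])
  have h1 := isIndexTwo_hat (L := L) (by omega) hα ho
  have h2 : hatOrder N = 2 * N := if_neg ho
  have h3 := (h1.mem_or l hl).resolve_left hK
  -- Modulo Λ̂ the period `l` is Nα, so it acts as N translations by α. The factor is ω^(-N) with ω
  -- a primitive 2N-th root of unity.
  refine ⟨rootOfUnity (hatOrder N) ^ (-(N : ℤ)), ?_, fun i z => ?_⟩
  · rw [← zpow_natCast, ← zpow_mul, show -(N : ℤ) * (2 : ℕ) = -((hatOrder N : ℕ) : ℤ) by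
      rw [h2]; push_cast; ring, zpow_neg, zpow_natCast, h.isPrimitiveRoot.pow_eq_one, inv_one]
  · have h4 := h.P_add_zsmul i N z
    rw [Int.cast_natCast, ← P_add_mem h3] at h4
    rw [← zpow_mul, show -(N : ℤ) * i = -(i * N) by ring, ← h4]
    congr 1
    ring

/-- Divisibility would give N ∣ j: 2 is invertible modulo odd N, and cancels against 2N for even N.
Coprimality then makes N a unit. -/
theorem not_hatOrder_dvd (hN : 2 ≤ N) {j : ℤ} (hj : IsCoprime j (N : ℤ)) :
    ¬ (hatOrder N : ℤ) ∣ 2 * j := by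
  intro h
  have h1 : (N : ℤ) ∣ j := by
    unfold hatOrder at h
    split_ifs at h with ho
    · refine IsCoprime.dvd_of_dvd_mul_left ?_ h
      obtain ⟨k, rfl⟩ := ho
      exact ⟨1, -k, by push_cast; ring⟩
    · push_cast at h
      exact Int.dvd_of_mul_dvd_mul_left two_ne_zero h
  have h2 := hj.isUnit_of_dvd' h1 dvd_rfl
  rw [Int.isUnit_iff] at h2
  omega

/-- A matrix valued function, holomorphic and of constant nonzero determinant off the lattice of
`L'`, with prescribed transformations under the translations by `L` and `α`, and under `z ↦ -z`. -/
structure IsFrame (L L' : PeriodPair) (α : ℂ) (D S : Matrix (Fin 2) (Fin 2) ℂ)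
    (Φ : ℂ → Matrix (Fin 2) (Fin 2) ℂ) : Prop where
  meromorphic : ∀ a b, Meromorphic fun z => Φ z a b
  analyticAt : ∀ z ∉ L'.lattice, ∀ a b, AnalyticAt ℂ (fun z => Φ z a b) z
  det_eq : ∃ d : ℂ, d ≠ 0 ∧ ∀ z ∉ L'.lattice, (Φ z).det = d
  add_mem : ∀ l ∈ L.lattice, ∃ ε : ℂ, ε ^ 2 = 1 ∧ ∀ z, Φ (z + l) = ε • Φ z
  add_self : ∀ z, Φ (z + α) = D * Φ z
  neg : ∀ z, Φ (-z) = S * Φ z * !![-1, 0; 0, 1]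

theorem isFrame_one : IsFrame L L' α 1 !![-1, 0; 0, 1] fun _ => 1 where
  meromorphic a b := fun z => MeromorphicAt.const _ z
  analyticAt _ _ _ _ := analyticAt_const
  det_eq := ⟨1, one_ne_zero, fun _ _ => by simp⟩
  add_mem _ _ := ⟨1, by simp, fun _ => by simp⟩
  add_self _ := by simp
  neg _ := by
    ext i j
    fin_cases i <;> fin_cases j <;> simp

/-- Absorbs the conjugation relating ρ to its standard model into the frame. -/
theorem IsFrame.conj {D S A : Matrix (Fin 2) (Fin 2) ℂ} {Φ : ℂ → Matrix (Fin 2) (Fin 2) ℂ}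
    (h : IsFrame L L' α D S Φ) (hA : IsUnit A.det) :
    IsFrame L L' α (A * D * A⁻¹) (A * S * A⁻¹) fun z => A * Φ z where
  meromorphic a b := fun z => by
    simp only [Matrix.mul_apply, Fin.sum_univ_two]
    exact ((MeromorphicAt.const _ z).mul (h.meromorphic 0 b z)).add
      ((MeromorphicAt.const _ z).mul (h.meromorphic 1 b z))
  analyticAt z hz a b := by
    simp only [Matrix.mul_apply, Fin.sum_univ_two]
    exact (analyticAt_const.mul (h.analyticAt z hz 0 b)).add
      (analyticAt_const.mul (h.analyticAt z hz 1 b))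
  det_eq := by
    obtain ⟨d, hd, h1⟩ := h.det_eq
    exact ⟨A.det * d, mul_ne_zero hA.ne_zero hd, fun z hz => by rw [Matrix.det_mul, h1 z hz]⟩
  add_mem l hl := by
    obtain ⟨ε, hε, h1⟩ := h.add_mem l hl
    exact ⟨ε, hε, fun z => by rw [h1, Matrix.mul_smul]⟩
  add_self z := by
    rw [h.add_self, Matrix.mul_assoc (A * D), Matrix.nonsing_inv_mul_cancel_left A _ hA,
      Matrix.mul_assoc]
  neg z := by
    rw [h.neg, Matrix.mul_assoc (A * S), Matrix.nonsing_inv_mul_cancel_left A _ hA]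
    simp only [Matrix.mul_assoc]

/-- The diagonal matrix with entries `ωʲ` and `ω⁻ʲ`. -/
def diagRoot (M : ℕ) (j : ℤ) : Matrix (Fin 2) (Fin 2) ℂ :=
  !![rootOfUnity M ^ j, 0; 0, rootOfUnity M ^ (-j)]

/-- The entries of each row share one multiplier: P_jP_{-2j} transforms like P_{-j}, and
P_{-j}P_{2j} like P_j. The reflection z ↦ -z exchanges the rows, with a sign on the linear first
column and none on the second, and that is why the λ-terms have opposite signs. -/
theorem isFrame_phiMatrix (hN : 2 ≤ N) (hα : ∀ k : ℤ, k * α ∈ L.lattice ↔ (N : ℤ) ∣ k)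
    (hL' : L'.lattice = L.lattice ⊔ Submodule.span ℤ {α}) {j : ℤ} {l m : ℂ}
    (hm : m ≠ 0) (hrel : ∀ z : ℂ, z ∉ L.lattice ⊔ Submodule.span ℤ {α} →
      (L.hat N α).P (hatOrder N) α (2 * j) z * (L.hat N α).P (hatOrder N) α (-j) z ^ 2
        - (L.hat N α).P (hatOrder N) α (-2 * j) z * (L.hat N α).P (hatOrder N) α j z ^ 2
      = l * ((L.hat N α).P (hatOrder N) α (-j) z * (L.hat N α).P (hatOrder N) α j z) + m) :
    IsFrame L L' α (diagRoot (hatOrder N) j) !![0, 1; 1, 0]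
      ((L.hat N α).phiMatrix (hatOrder N) α j l m) := by
  have h := isTorsionExtension_hat hN hα hL'
  have hω := rootOfUnity_ne_zero (hatOrder N)
  refine ⟨fun a b z => ?_, fun z hz a b => ?_, ⟨1, one_ne_zero, fun z hz => ?_⟩,
    fun x hx => ?_, fun z => ?_, fun z => ?_⟩
  · have hP := fun i => meromorphic_P (K := L.hat N α) (M := hatOrder N) (α := α) i z
    fin_cases a <;> fin_cases b
    · exact hP (-j)
    · exact ((MeromorphicAt.const (1 / m) z).mul ((hP j).mul (hP (-2 * j)))).add
        ((MeromorphicAt.const (l / (2 * m)) z).mul (hP (-j)))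
    · exact hP j
    · exact ((MeromorphicAt.const (1 / m) z).mul ((hP (-j)).mul (hP (2 * j)))).sub
        ((MeromorphicAt.const (l / (2 * m)) z).mul (hP j))
  · have hP := fun i => h.analyticAt_P i hz
    fin_cases a <;> fin_cases b
    · exact hP (-j)
    · exact (analyticAt_const.mul ((hP j).mul (hP (-2 * j)))).add
        (analyticAt_const.mul (hP (-j)))
    · exact hP j
    · exact (analyticAt_const.mul ((hP (-j)).mul (hP (2 * j)))).sub
        (analyticAt_const.mul (hP j))
  -- Expanded and multiplied by μ, det Φ = 1 is the defining relation of λ and μ.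
  · have h1 := hrel z (by rwa [← hL'])
    simp only [phiMatrix, Matrix.det_fin_two_of]
    field_simp
    linear_combination 2 * h1
  · obtain ⟨ε, hε, h1⟩ := exists_sign_P_hat hN hα hL' hx
    have hε0 : ε ≠ 0 := fun h0 => by simp [h0] at hε
    have hεinv : ∀ i : ℤ, ε ^ (-i) = ε ^ i := fun i => by
      rw [zpow_neg, ← inv_zpow]
      congr 1
      exact inv_eq_of_mul_eq_one_left (by rw [← sq, hε])
    have hεtwo : ∀ i : ℤ, ε ^ (2 * i) = 1 := fun i => by
      rw [zpow_mul, zpow_ofNat, hε, one_zpow]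
    refine ⟨ε ^ j, by rw [← zpow_natCast, ← zpow_mul, mul_comm, Nat.cast_ofNat, hεtwo], fun z => ?_⟩
    have e1 := h1 j z
    have e2 := h1 (-j) z
    have e3 := h1 (2 * j) z
    have e4 := h1 (-2 * j) z
    rw [hεinv] at e2
    rw [hεtwo, one_mul] at e3
    rw [neg_mul, hεinv, hεtwo, one_mul, ← neg_mul] at e4
    simp only [phiMatrix, e1, e2, e3, e4]
    ext a b
    fin_cases a <;> fin_cases b <;> simp <;> ring
  · have e1 := h.P_add_self j z
    have e2 := h.P_add_self (-j) z
    have e3 := h.P_add_self (2 * j) z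
    have e4 := h.P_add_self (-2 * j) z
    rw [show -(2 * j) = -j + -j by ring, zpow_add₀ hω, zpow_neg] at e3
    rw [show -(-2 * j) = j + j by ring, zpow_add₀ hω] at e4
    rw [zpow_neg] at e1
    rw [neg_neg] at e2
    have := zpow_ne_zero j hω
    simp only [phiMatrix, e1, e2, e3, e4, diagRoot, zpow_neg]
    ext a b
    fin_cases a <;> fin_cases b <;> simp <;> field_simp
  · have e1 := h.P_neg j z
    have e2 := h.P_neg (-j) z
    have e3 := h.P_neg (2 * j) z
    have e4 := h.P_neg (-2 * j) z
    rw [neg_neg] at e2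
    rw [← neg_mul] at e3
    rw [show -(-2 * j) = 2 * j by ring] at e4
    simp only [phiMatrix, e1, e2, e3, e4]
    ext a b
    fin_cases a <;> fin_cases b <;> simp
    ring

end PeriodPair

/-! ### Automorphisms of 𝔰𝔩₂ -/

namespace Sl2

theorem apply_one_one (x : Sl2) : x.1 1 1 = -x.1 0 0 := by
  have h : x.1.trace = 0 := LinearMap.mem_ker.1 x.2
  rw [Matrix.trace_fin_two] at h
  linear_combination h

theorem ext_entries {x y : Sl2} (h0 : x.1 0 0 = y.1 0 0) (h1 : x.1 0 1 = y.1 0 1)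
    (h2 : x.1 1 0 = y.1 1 0) : x = y := by
  refine Subtype.ext (Matrix.ext fun i j => ?_)
  fin_cases i <;> fin_cases j
  · exact h0
  · exact h1
  · exact h2
  · change x.1 1 1 = y.1 1 1
    rw [apply_one_one, apply_one_one, h0]

theorem coe_lie (x y : Sl2) : (⁅x, y⁆ : Sl2).1 = x.1 * y.1 - y.1 * x.1 := rfl

theorem lie_zero_zero (x y : Sl2) :
    (⁅x, y⁆ : Sl2).1 0 0 = x.1 0 1 * y.1 1 0 - y.1 0 1 * x.1 1 0 := by
  simp only [coe_lie, Matrix.sub_apply, Matrix.mul_apply, Fin.sum_univ_two]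
  ring

theorem lie_zero_one (x y : Sl2) :
    (⁅x, y⁆ : Sl2).1 0 1 = 2 * (x.1 0 0 * y.1 0 1 - x.1 0 1 * y.1 0 0) := by
  simp only [coe_lie, Matrix.sub_apply, Matrix.mul_apply, Fin.sum_univ_two, apply_one_one]
  ring

theorem lie_one_zero (x y : Sl2) :
    (⁅x, y⁆ : Sl2).1 1 0 = 2 * (x.1 1 0 * y.1 0 0 - x.1 0 0 * y.1 1 0) := by
  simp only [coe_lie, Matrix.sub_apply, Matrix.mul_apply, Fin.sum_univ_two, apply_one_one]
  ring

theorem coe_e : e.1 = !![0, 1; 0, 0] := rfl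
theorem coe_f : f.1 = !![0, 0; 1, 0] := rfl
theorem coe_h : h.1 = !![1, 0; 0, -1] := rfl

theorem coe_smul (c : ℂ) (x : Sl2) : (c • x).1 = c • x.1 := rfl
theorem coe_add (x y : Sl2) : (x + y).1 = x.1 + y.1 := rfl
theorem coe_neg (x : Sl2) : (-x).1 = -x.1 := rfl

theorem eq_combination (x : Sl2) : x = x.1 0 1 • e + x.1 1 0 • f + x.1 0 0 • h := by
  apply ext_entries <;> simp [coe_add, coe_e, coe_f, coe_h]

theorem lie_h_e : ⁅h, e⁆ = (2 : ℂ) • e := by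
  apply ext_entries <;> simp [lie_zero_zero, lie_zero_one, lie_one_zero, coe_e, coe_h]

theorem lie_h_f : ⁅h, f⁆ = (-2 : ℂ) • f := by
  apply ext_entries <;> simp [lie_zero_zero, lie_zero_one, lie_one_zero, coe_f, coe_h]

theorem lie_e_f : ⁅e, f⁆ = h := by
  apply ext_entries <;> simp [lie_zero_zero, lie_zero_one, lie_one_zero, coe_e, coe_f, coe_h]

theorem e_ne_zero : e ≠ 0 := fun h0 => by
  have := congrArg (fun x : Sl2 => x.1 0 1) h0
  simp [coe_e] at this

theorem Aut.map_lie (g : Aut) (x y : Sl2) : g.1 ⁅x, y⁆ = ⁅g.1 x, g.1 y⁆ := g.2 x y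

theorem Aut.mul_apply (g g' : Aut) (x : Sl2) : (g * g').1 x = g.1 (g'.1 x) := rfl

theorem Aut.ext_e_f {g g' : Aut} (he : g.1 e = g'.1 e) (hf : g.1 f = g'.1 f) : g = g' := by
  have hh : g.1 h = g'.1 h := by rw [← lie_e_f, Aut.map_lie g, Aut.map_lie g', he, hf]
  refine Subtype.ext (LinearEquiv.ext fun x => ?_)
  rw [eq_combination x]
  simp only [map_add, map_smul, he, hf, hh]

theorem coe_Ad (A : Matrix (Fin 2) (Fin 2) ℂ) (x : Sl2) : (Ad A x).1 = A * x.1 * A⁻¹ := rfl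

theorem Ad_mul (A B : Matrix (Fin 2) (Fin 2) ℂ) (x : Sl2) : Ad (A * B) x = Ad A (Ad B x) :=
  Subtype.ext (by simp only [coe_Ad, Matrix.mul_inv_rev, Matrix.mul_assoc])

theorem Ad_one (x : Sl2) : Ad 1 x = x := Subtype.ext (by simp [coe_Ad])

theorem Ad_add (A : Matrix (Fin 2) (Fin 2) ℂ) (x y : Sl2) : Ad A (x + y) = Ad A x + Ad A y :=
  Subtype.ext (by simp only [coe_Ad, coe_add, Matrix.mul_add, Matrix.add_mul])

theorem Ad_smul (A : Matrix (Fin 2) (Fin 2) ℂ) (c : ℂ) (x : Sl2) : Ad A (c • x) = c • Ad A x :=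
  Subtype.ext (by simp only [coe_Ad, coe_smul, Matrix.mul_smul, Matrix.smul_mul])

theorem Ad_lie {A : Matrix (Fin 2) (Fin 2) ℂ} (hA : IsUnit A.det) (x y : Sl2) :
    Ad A ⁅x, y⁆ = ⁅Ad A x, Ad A y⁆ :=
  Subtype.ext (by
    simp only [coe_Ad, coe_lie, Matrix.mul_sub, Matrix.sub_mul, Matrix.mul_assoc,
      Matrix.nonsing_inv_mul_cancel_left A _ hA])

/-- The adjoint action, as a homomorphism to the automorphism group. -/
def adHom : GL (Fin 2) ℂ →* Aut where
  toFun A := ⟨LinearEquiv.ofLinearMap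
    { toFun := Ad A.1, map_add' := Ad_add _, map_smul' := Ad_smul _ }
    { toFun := Ad A⁻¹.1, map_add' := Ad_add _, map_smul' := Ad_smul _ }
    (LinearMap.ext fun x => by
      change Ad A.1 (Ad A⁻¹.1 x) = x
      rw [← Ad_mul, ← Units.val_mul, mul_inv_cancel, Units.val_one, Ad_one])
    (LinearMap.ext fun x => by
      change Ad A⁻¹.1 (Ad A.1 x) = x
      rw [← Ad_mul, ← Units.val_mul, inv_mul_cancel, Units.val_one, Ad_one]),
    Ad_lie ((Matrix.isUnit_iff_isUnit_det _).1 A.isUnit)⟩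
  map_one' := Subtype.ext (LinearEquiv.ext Ad_one)
  map_mul' A B := Subtype.ext (LinearEquiv.ext fun x => Ad_mul A.1 B.1 x)

theorem adHom_apply (A : GL (Fin 2) ℂ) (x : Sl2) : (adHom A).1 x = Ad A.1 x := rfl

theorem Ad_eq_iff {A : Matrix (Fin 2) (Fin 2) ℂ} (hA : IsUnit A.det) {x y : Sl2} :
    Ad A x = y ↔ A * x.1 = y.1 * A := by
  rw [Subtype.ext_iff, coe_Ad]
  constructor
  · intro h
    rw [← h, Matrix.nonsing_inv_mul_cancel_right _ _ hA]
  · intro h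
    rw [h, Matrix.mul_nonsing_inv_cancel_right _ _ hA]

theorem isUnit_det (A : GL (Fin 2) ℂ) : IsUnit A.1.det :=
  (Matrix.isUnit_iff_isUnit_det _).1 A.isUnit

/-- The diagonal matrix with entries `u` and `1`. -/
def diag (u : ℂ) (hu : u ≠ 0) : GL (Fin 2) ℂ :=
  Matrix.GeneralLinearGroup.mkOfDetNeZero !![u, 0; 0, 1] (by simpa using hu)

/-- The permutation matrix. -/
def swap : GL (Fin 2) ℂ :=
  Matrix.GeneralLinearGroup.mkOfDetNeZero !![0, 1; 1, 0] (by simp)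

theorem coe_diag (u : ℂ) (hu : u ≠ 0) : (diag u hu).1 = !![u, 0; 0, 1] := rfl
theorem coe_swap : swap.1 = !![0, 1; 1, 0] := rfl

theorem adHom_diag_e {u : ℂ} (hu : u ≠ 0) : (adHom (diag u hu)).1 e = u • e := by
  rw [adHom_apply, Ad_eq_iff (isUnit_det _), coe_diag, coe_smul, coe_e]
  ext i j; fin_cases i <;> fin_cases j <;> simp

theorem adHom_diag_f {u : ℂ} (hu : u ≠ 0) : (adHom (diag u hu)).1 f = u⁻¹ • f := by
  rw [adHom_apply, Ad_eq_iff (isUnit_det _), coe_diag, coe_smul, coe_f]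
  ext i j; fin_cases i <;> fin_cases j <;> simp [hu]

theorem adHom_swap_e : (adHom swap).1 e = f := by
  rw [adHom_apply, Ad_eq_iff (isUnit_det _), coe_swap, coe_e, coe_f]
  ext i j; fin_cases i <;> fin_cases j <;> simp

theorem adHom_swap_f : (adHom swap).1 f = e := by
  rw [adHom_apply, Ad_eq_iff (isUnit_det _), coe_swap, coe_e, coe_f]
  ext i j; fin_cases i <;> fin_cases j <;> simp

theorem adHom_swap_h : (adHom swap).1 h = -h := by
  rw [adHom_apply, Ad_eq_iff (isUnit_det _), coe_swap, coe_neg, coe_h]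
  ext i j; fin_cases i <;> fin_cases j <;> simp

/-- For any x in 𝔰𝔩₂, (ad x)³ = 4(x₀₀² + x₀₁x₁₀) ad x. For x = g h the vector g e is an eigenvector
of ad x with eigenvalue 2, and comparing 8 on both sides gives the value 1. -/
theorem Aut.entries_map_h (g : Aut) :
    (g.1 h).1 0 0 ^ 2 + (g.1 h).1 0 1 * (g.1 h).1 1 0 = 1 := by
  have h1 : ⁅g.1 h, g.1 e⁆ = (2 : ℂ) • g.1 e := by rw [← Aut.map_lie g, lie_h_e, map_smul]
  have h2 : ⁅g.1 h, ⁅g.1 h, ⁅g.1 h, g.1 e⁆⁆⁆ = (8 : ℂ) • g.1 e := by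
    simp only [h1, lie_smul, smul_smul]
    norm_num
  have h3 : ∀ x y : Sl2, ⁅x, ⁅x, ⁅x, y⁆⁆⁆ = (4 * (x.1 0 0 ^ 2 + x.1 0 1 * x.1 1 0)) • ⁅x, y⁆ := by
    intro x y
    apply ext_entries <;>
      simp only [lie_zero_zero, lie_zero_one, lie_one_zero, coe_smul, Matrix.smul_apply,
        smul_eq_mul] <;> ring
  rw [h3, h1, smul_smul] at h2
  have h4 : g.1 e ≠ 0 := fun h0 => e_ne_zero (by simpa using h0)
  have h5 : (4 * ((g.1 h).1 0 0 ^ 2 + (g.1 h).1 0 1 * (g.1 h).1 1 0) * 2 : ℂ) = 8 :=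
    smul_left_injective ℂ h4 h2
  linear_combination h5 / 8

/-- The hypothesis means x² = 1, so (x + h)h = xh + 1 = x(x + h) and x + h conjugates h to x. Its
determinant is -2(x₀₀ + 1); when this vanishes, -x is used instead. -/
theorem exists_adHom_h_eq {x : Sl2} (hx : x.1 0 0 ^ 2 + x.1 0 1 * x.1 1 0 = 1) :
    ∃ A : GL (Fin 2) ℂ, (adHom A).1 h = x ∨ (adHom A).1 h = -x := by
  have key : ∀ x : Sl2, x.1 0 0 ^ 2 + x.1 0 1 * x.1 1 0 = 1 → x.1 0 0 ≠ -1 →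
      ∃ A : GL (Fin 2) ℂ, (adHom A).1 h = x := fun x hx hx0 => by
    have hxm : x.1 = !![x.1 0 0, x.1 0 1; x.1 1 0, -x.1 0 0] := by
      rw [← apply_one_one]; exact Matrix.eta_fin_two _
    have hdet : (x.1 + h.1).det ≠ 0 := by
      rw [coe_h, Matrix.det_fin_two]
      simp only [Matrix.add_apply, apply_one_one]
      simp
      intro h0
      apply hx0
      linear_combination (-1 / 2 : ℂ) * h0 - hx / 2
    refine ⟨Matrix.GeneralLinearGroup.mkOfDetNeZero _ hdet, ?_⟩
    rw [adHom_apply, Ad_eq_iff (isUnit_det _)]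
    change (x.1 + h.1) * h.1 = x.1 * (x.1 + h.1)
    rw [coe_h, hxm]
    ext i j
    fin_cases i <;> fin_cases j <;> simp [Matrix.mul_apply, Fin.sum_univ_two] <;>
      first | ring1 | linear_combination -hx
  by_cases hx0 : x.1 0 0 = -1
  · obtain ⟨A, hA⟩ := key (-x) (by simpa using hx) (by simp [hx0]; norm_num)
    exact ⟨A, Or.inr hA⟩
  · obtain ⟨A, hA⟩ := key x hx hx0
    exact ⟨A, Or.inl hA⟩

/-- An automorphism fixing `h` is diagonal. -/
theorem Aut.eq_adHom_diag {g : Aut} (hg : g.1 h = h) : ∃ u, ∃ hu : u ≠ 0, g = adHom (diag u hu) := by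
  have h1 : ⁅h, g.1 e⁆ = (2 : ℂ) • g.1 e := by
    nth_rw 1 [← hg]
    rw [← Aut.map_lie g, lie_h_e, map_smul]
  have h2 : ⁅h, g.1 f⁆ = (-2 : ℂ) • g.1 f := by
    nth_rw 1 [← hg]
    rw [← Aut.map_lie g, lie_h_f, map_smul]
  have he : g.1 e = (g.1 e).1 0 1 • e := by
    have h00 := congrArg (fun x : Sl2 => x.1 0 0) h1
    have h10 := congrArg (fun x : Sl2 => x.1 1 0) h1
    simp [lie_zero_zero, lie_one_zero, coe_h] at h00 h10
    apply ext_entries <;> simp [coe_e]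
    · exact h00
    · linear_combination (-1 / 4 : ℂ) * h10
  have hf : g.1 f = (g.1 f).1 1 0 • f := by
    have h00 := congrArg (fun x : Sl2 => x.1 0 0) h2
    have h01 := congrArg (fun x : Sl2 => x.1 0 1) h2
    simp [lie_zero_zero, lie_zero_one, coe_h] at h00 h01
    apply ext_entries <;> simp [coe_f]
    · exact h00
    · linear_combination (1 / 4 : ℂ) * h01
  have hu : (g.1 e).1 0 1 * (g.1 f).1 1 0 = 1 := by
    have h3 : ⁅g.1 e, g.1 f⁆ = h := by rw [← Aut.map_lie g, lie_e_f, hg]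
    rw [he, hf, smul_lie, lie_smul, lie_e_f] at h3
    have := congrArg (fun x : Sl2 => x.1 0 0) h3
    simpa [coe_smul, coe_h, coe_e, coe_f] using this
  have hu0 : (g.1 e).1 0 1 ≠ 0 := left_ne_zero_of_mul_eq_one hu
  refine ⟨_, hu0, Aut.ext_e_f ?_ ?_⟩
  · rw [adHom_diag_e]
    exact he
  · rw [adHom_diag_f, ← eq_inv_of_mul_eq_one_right hu]
    exact hf

theorem Aut.inv_apply_eq {g : Aut} {x y : Sl2} : g⁻¹.1 x = y ↔ g.1 y = x := by
  constructor
  · rintro rfl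
    rw [← mul_apply, mul_inv_cancel]
    rfl
  · rintro rfl
    rw [← mul_apply, inv_mul_cancel]
    rfl

/-- Every automorphism of `𝔰𝔩₂` is inner. -/
theorem adHom_surjective : Function.Surjective adHom := by
  intro g
  -- Once g h is moved back to h, with the swap correcting a sign, the remaining automorphism fixes
  -- h and is diagonal.
  obtain ⟨A, hA⟩ := exists_adHom_h_eq (Aut.entries_map_h g)
  rcases hA with hA | hA
  · obtain ⟨u, hu, h1⟩ := Aut.eq_adHom_diag (g := (adHom A)⁻¹ * g)
      (by rw [Aut.mul_apply, Aut.inv_apply_eq, hA])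
    exact ⟨A * diag u hu, by rw [map_mul, ← h1, mul_inv_cancel_left]⟩
  · obtain ⟨u, hu, h1⟩ := Aut.eq_adHom_diag (g := (adHom (A * swap))⁻¹ * g)
      (by rw [Aut.mul_apply, Aut.inv_apply_eq, map_mul, Aut.mul_apply, adHom_swap_h, map_neg, hA,
        neg_neg])
    exact ⟨A * swap * diag u hu, by rw [map_mul, ← h1, mul_inv_cancel_left]⟩

/-- An automorphism of finite order fixes a conjugate of `h`. -/
theorem Aut.exists_fixed_of_pow_eq_one {g : Aut} {n : ℕ} (hn : n ≠ 0) (hg : g ^ n = 1) :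
    ∃ A : GL (Fin 2) ℂ, ((adHom A)⁻¹ * g * adHom A).1 h = h := by
  suffices H : ∃ A : GL (Fin 2) ℂ, g.1 ((adHom A).1 h) = (adHom A).1 h by
    obtain ⟨A, hA⟩ := H
    exact ⟨A, by rw [Aut.mul_apply, Aut.mul_apply, Aut.inv_apply_eq, hA]⟩
  obtain ⟨B, rfl⟩ := adHom_surjective g
  set t : ℂ := B.1.trace / 2 with ht
  -- The traceless part of `B` commutes with `B`, so it is fixed by Ad B. It remains to see that it
  -- is zero or a multiple of a conjugate of h.
  let x : Sl2 := ofMatrix (B.1 - t • 1) (by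
    rw [Matrix.trace_sub, Matrix.trace_smul, Matrix.trace_one, ht]
    simp)
  have hB : B.1 = t • 1 + x.1 := by simp [x, ofMatrix]
  have hfix : (adHom B).1 x = x := by
    rw [adHom_apply, Ad_eq_iff (isUnit_det _), hB]
    simp [Matrix.mul_add, Matrix.add_mul]
  have hsq : x.1 * x.1 = (x.1 0 0 ^ 2 + x.1 0 1 * x.1 1 0) • (1 : Matrix (Fin 2) (Fin 2) ℂ) := by
    ext i j
    fin_cases i <;> fin_cases j <;>
      simp [Matrix.mul_apply, Fin.sum_univ_two, apply_one_one] <;> ring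
  by_cases hx : x = 0
  · refine ⟨1, ?_⟩
    rw [adHom_apply, Ad_eq_iff (isUnit_det _), hB, hx]
    simp
  by_cases hd : x.1 0 0 ^ 2 + x.1 0 1 * x.1 1 0 = 0
  · exfalso
    rw [hd, zero_smul] at hsq
    -- If x² = 0, then Bᵏ = tᵏ + k tᵏ⁻¹x. As Ad(Bⁿ) = 1, the matrix x commutes with all of 𝔰𝔩₂, so
    -- it is zero.
    have hpow : ∀ k : ℕ, B.1 ^ k = t ^ k • (1 : Matrix (Fin 2) (Fin 2) ℂ) +
        (k * t ^ (k - 1)) • x.1 := by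
      intro k
      induction k with
      | zero => simp
      | succ k ih =>
        rw [pow_succ, ih, hB]
        simp only [Matrix.add_mul, Matrix.mul_add, Matrix.smul_mul, Matrix.mul_smul, hsq,
          Matrix.one_mul, Matrix.mul_one, smul_zero, add_zero]
        rw [smul_add, add_assoc, smul_smul, smul_smul, ← add_smul]
        congr 2
        · ring
        · cases k with
          | zero => simp
          | succ k => simp; ring
    have ht0 : t ≠ 0 := by
      rintro ht0
      have h1 := (isUnit_det B).ne_zero
      rw [hB, ht0, zero_smul, zero_add, Matrix.det_fin_two, apply_one_one] at h1
      apply h1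
      linear_combination -hd
    rw [← map_pow] at hg
    have hcomm : ∀ y : Sl2, x.1 * y.1 = y.1 * x.1 := fun y => by
      have h1 : (adHom (B ^ n)).1 y = y := by rw [hg]; rfl
      rw [adHom_apply, Ad_eq_iff (isUnit_det _), Units.val_pow_eq_pow_val, hpow] at h1
      simp only [Matrix.add_mul, Matrix.mul_add, Matrix.smul_mul, Matrix.mul_smul, Matrix.one_mul,
        Matrix.mul_one, add_right_inj] at h1
      exact smul_right_injective _ (mul_ne_zero (Nat.cast_ne_zero.2 hn) (pow_ne_zero _ ht0)) h1
    have h1 := hcomm e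
    have h2 := hcomm f
    rw [coe_e] at h1
    rw [coe_f] at h2
    refine hx (ext_entries ?_ ?_ ?_)
    · have := congrFun (congrFun h1 0) 1
      simp [Matrix.mul_apply, Fin.sum_univ_two, apply_one_one] at this
      change x.1 0 0 = 0
      linear_combination this / 2
    · have := congrFun (congrFun h2 0) 0
      simpa [Matrix.mul_apply, Fin.sum_univ_two] using this
    · have := congrFun (congrFun h1 0) 0
      simpa [Matrix.mul_apply, Fin.sum_univ_two] using this.symm
  · obtain ⟨s, hs⟩ := IsAlgClosed.exists_pow_nat_eq (x.1 0 0 ^ 2 + x.1 0 1 * x.1 1 0) two_pos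
    have hs0 : s ≠ 0 := fun h0 => hd (by rw [← hs, h0]; simp)
    obtain ⟨A, hA⟩ := exists_adHom_h_eq (x := s⁻¹ • x) (by
      simp only [coe_smul, Matrix.smul_apply, smul_eq_mul]
      field_simp
      exact hs.symm)
    refine ⟨A, ?_⟩
    rcases hA with hA | hA <;> simp only [hA, map_neg, map_smul, hfix]

end Sl2

/-! ### Faithful dihedral actions on 𝔰𝔩₂ up to conjugation -/

namespace Sl2

open PeriodPair

/-- The matrix `diagRoot` as an element of the general linear group. -/
def diagRootUnit (M : ℕ) (j : ℤ) : GL (Fin 2) ℂ :=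
  Matrix.GeneralLinearGroup.mkOfDetNeZero (diagRoot M j) (by
    rw [diagRoot, Matrix.det_fin_two_of, ← zpow_add₀ (rootOfUnity_ne_zero M)]
    simp)

theorem coe_diagRootUnit (M : ℕ) (j : ℤ) : (diagRootUnit M j).1 = diagRoot M j := rfl

/-- The matrices diag(ω^j, ω^(-j)) and diag(ω^(2j), 1) differ by a scalar. -/
theorem adHom_diagRootUnit {M : ℕ} {j : ℤ} {u : ℂ} (hu : u ≠ 0)
    (h : (rootOfUnity M ^ 2) ^ j = u) : adHom (diagRootUnit M j) = adHom (diag u hu) := by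
  have hω := zpow_ne_zero j (rootOfUnity_ne_zero M)
  have h' : u = rootOfUnity M ^ j * rootOfUnity M ^ j := by
    rw [← h, sq, mul_zpow]
  apply Aut.ext_e_f
  · rw [adHom_diag_e, adHom_apply, Ad_eq_iff (isUnit_det _), coe_diagRootUnit, coe_smul, coe_e,
      diagRoot, h', zpow_neg]
    ext i j; fin_cases i <;> fin_cases j <;> simp
  · rw [adHom_diag_f, adHom_apply, Ad_eq_iff (isUnit_det _), coe_diagRootUnit, coe_smul, coe_f,
      diagRoot, h', zpow_neg]
    ext i j; fin_cases i <;> fin_cases j <;> simp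
    field_simp

/-- This is the reason for the two values of `hatOrder`: squaring preserves an odd order N and
halves the order 2N. -/
theorem isPrimitiveRoot_rootOfUnity_hatOrder_sq {N : ℕ} (hN : 1 ≤ N) :
    IsPrimitiveRoot (rootOfUnity (hatOrder N) ^ 2) N := by
  unfold hatOrder
  split_ifs with ho
  · exact (isPrimitiveRoot_rootOfUnity (by omega)).pow_of_coprime 2 ho.coprime_two_left
  · exact (isPrimitiveRoot_rootOfUnity (by omega)).pow (by omega) rfl

theorem adHom_diag_eq_iff {u v : ℂ} (hu : u ≠ 0) (hv : v ≠ 0) :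
    adHom (diag u hu) = adHom (diag v hv) ↔ u = v := by
  constructor
  · intro h
    have h1 := congrArg (fun g : Aut => g.1 e) h
    simp only [adHom_diag_e] at h1
    exact smul_left_injective ℂ e_ne_zero h1
  · rintro rfl
    rfl

theorem adHom_diag_mul {u v : ℂ} (hu : u ≠ 0) (hv : v ≠ 0) :
    adHom (diag u hu) * adHom (diag v hv) = adHom (diag (u * v) (mul_ne_zero hu hv)) := by
  apply Aut.ext_e_f
  · rw [Aut.mul_apply]
    simp only [adHom_diag_e, map_smul, smul_smul, mul_comm]
  · rw [Aut.mul_apply]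
    simp only [adHom_diag_f, map_smul, smul_smul, mul_inv, mul_comm]

theorem adHom_diag_one : adHom (diag 1 one_ne_zero) = 1 := by
  apply Aut.ext_e_f
  · rw [adHom_diag_e, one_smul]; rfl
  · rw [adHom_diag_f, inv_one, one_smul]; rfl

theorem adHom_diag_pow {u : ℂ} (hu : u ≠ 0) (k : ℕ) :
    adHom (diag u hu) ^ k = adHom (diag (u ^ k) (pow_ne_zero k hu)) := by
  induction k with
  | zero => rw [pow_zero, ← adHom_diag_one, adHom_diag_eq_iff, pow_zero]
  | succ k ih => rw [pow_succ, ih, adHom_diag_mul, adHom_diag_eq_iff, pow_succ]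

/-- The diagonal matrix with entries `-1` and `1`. -/
def reflection : GL (Fin 2) ℂ := diag (-1) (by norm_num)

theorem coe_reflection : reflection.1 = !![-1, 0; 0, 1] := rfl

theorem eq_one_or_neg_one_of_sq {g : Aut} (hg : g ^ 2 = 1) (hh : g.1 h = h) :
    g = 1 ∨ g = adHom reflection := by
  obtain ⟨u, hu, rfl⟩ := Aut.eq_adHom_diag hh
  rw [adHom_diag_pow, ← adHom_diag_one, adHom_diag_eq_iff, sq, mul_self_eq_one_iff] at hg
  rcases hg with rfl | rfl
  · exact Or.inl adHom_diag_one
  · exact Or.inr rfl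

theorem adHom_diag_mul_swap {u : ℂ} (hu : u ≠ 0) :
    adHom (diag u hu) * adHom swap = adHom swap * adHom (diag u⁻¹ (inv_ne_zero hu)) := by
  apply Aut.ext_e_f
  · simp only [Aut.mul_apply, adHom_swap_e, adHom_diag_f, adHom_diag_e, map_smul]
  · simp only [Aut.mul_apply, adHom_swap_f, adHom_diag_f, adHom_diag_e, map_smul, inv_inv]

theorem adHom_swap_mul_swap : adHom swap * adHom swap = 1 := by
  apply Aut.ext_e_f
  · rw [Aut.mul_apply, adHom_swap_e, adHom_swap_f]; rfl
  · rw [Aut.mul_apply, adHom_swap_f, adHom_swap_e]; rfl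

theorem adHom_diag_inv {u : ℂ} (hu : u ≠ 0) :
    (adHom (diag u hu))⁻¹ = adHom (diag u⁻¹ (inv_ne_zero hu)) := by
  refine inv_eq_of_mul_eq_one_right ?_
  rw [adHom_diag_mul, ← adHom_diag_one, adHom_diag_eq_iff, mul_inv_cancel₀ hu]

open DihedralGroup in
/-- A faithful action of the group of order two on `𝔰𝔩₂` is conjugate to the standard one. -/
theorem exists_conj_of_one {ρ : DihedralGroup 1 →* Aut} (hρ : Function.Injective ρ) :
    ∃ A : GL (Fin 2) ℂ, ρ (r 1) = adHom (A * 1 * A⁻¹) ∧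
      ρ (sr 0) = adHom (A * reflection * A⁻¹) := by
  have hsq : ρ (sr 0) ^ 2 = 1 := by rw [← map_pow, sq, sr_mul_self, map_one]
  obtain ⟨A, hA⟩ := Aut.exists_fixed_of_pow_eq_one two_ne_zero hsq
  refine ⟨A, ?_, ?_⟩
  · rw [mul_one, mul_inv_cancel, map_one, show (r 1 : DihedralGroup 1) = 1 from
      congrArg r (Subsingleton.elim _ _), map_one]
  · have h1 : ((adHom A)⁻¹ * ρ (sr 0) * adHom A) ^ 2 = 1 := by
      rw [sq, show ∀ a b : Aut, a⁻¹ * b * a * (a⁻¹ * b * a) = a⁻¹ * (b * b) * a by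
        intro a b; group, ← sq, hsq]
      group
    rcases eq_one_or_neg_one_of_sq h1 hA with h2 | h2
    · have h3 : ρ (sr 0) = 1 := by
        rw [mul_eq_one_iff_eq_inv, inv_mul_eq_iff_eq_mul, mul_inv_cancel] at h2
        exact h2
      rw [← map_one ρ] at h3
      exact absurd (hρ h3) (by rw [one_def]; exact fun h => by cases h)
    · rw [map_mul, map_mul, ← h2, map_inv]
      group

open DihedralGroup in
/-- A faithful action of a dihedral group on `𝔰𝔩₂` is conjugate to a standard one. -/
theorem exists_conj_of_two_le {N : ℕ} (hN : 2 ≤ N) {ρ : DihedralGroup N →* Aut}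
    (hρ : Function.Injective ρ) :
    ∃ A : GL (Fin 2) ℂ, ∃ j : ℤ, IsCoprime j (N : ℤ) ∧
      ρ (r 1) = adHom (A * diagRootUnit (hatOrder N) j * A⁻¹) ∧
      ρ (sr 0) = adHom (A * swap * A⁻¹) := by
  have hR : ρ (r 1) ^ N = 1 := by rw [← map_pow, r_one_pow_n, map_one]
  obtain ⟨A, hA⟩ := Aut.exists_fixed_of_pow_eq_one (by omega) hR
  let ρ' : DihedralGroup N →* Aut := (MulAut.conj (adHom A)⁻¹).toMonoidHom.comp ρ
  have hρ'inj : Function.Injective ρ' := (MulAut.conj (adHom A)⁻¹).injective.comp hρ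
  have hρ' : ∀ x, ρ' x = (adHom A)⁻¹ * ρ x * adHom A := fun x => by
    simp [ρ']
  have hρρ' : ∀ x, ρ x = adHom A * ρ' x * (adHom A)⁻¹ := fun x => by
    rw [hρ']
    group
  rw [← hρ'] at hA
  obtain ⟨ζ, hζ, hRζ⟩ := Aut.eq_adHom_diag hA
  have hprim : IsPrimitiveRoot ζ N := by
    refine ⟨?_, fun k hk => ?_⟩
    · have h1 : ρ' (r 1) ^ N = 1 := by rw [← map_pow, r_one_pow_n, map_one]
      rwa [hRζ, adHom_diag_pow, ← adHom_diag_one, adHom_diag_eq_iff] at h1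
    · have h1 : ρ' (r 1) ^ k = 1 := by
        rw [hRζ, adHom_diag_pow, ← adHom_diag_one, adHom_diag_eq_iff, hk]
      rw [← map_pow, ← map_one ρ'] at h1
      have h2 := orderOf_dvd_of_pow_eq_one (hρ'inj h1)
      rwa [orderOf_r_one] at h2
  have hζ1 : ζ ≠ 1 := hprim.ne_one (by omega)
  have hS2 : ρ' (sr 0) * ρ' (sr 0) = 1 := by rw [← map_mul, sr_mul_self, map_one]
  have hSR : ρ' (r 1) * (ρ' (sr 0) * ρ' (r 1)) = ρ' (sr 0) := by
    rw [← map_mul, ← map_mul]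
    congr 1
    simp
  -- Since r s r = s and r fixes h, r also fixes s h. As ζ ≠ 1 the fixed space of r is ℂh, so s h =
  -- ±h.
  set y : Sl2 := (ρ' (sr 0)).1 h with hy
  have hRy : (ρ' (r 1)).1 y = y := by
    rw [hy]
    nth_rw 1 [← hA]
    exact congrArg (fun g : Aut => g.1 h) hSR
  have hSy : (ρ' (sr 0)).1 y = h := congrArg (fun g : Aut => g.1 h) hS2
  have hyh : y = y.1 0 0 • h := by
    rw [hRζ] at hRy
    rw [eq_combination y, map_add, map_add, map_smul, map_smul, map_smul, adHom_diag_e,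
      adHom_diag_f, ← hRζ, hA] at hRy
    have h01 := congrArg (fun x : Sl2 => x.1 0 1) hRy
    have h10 := congrArg (fun x : Sl2 => x.1 1 0) hRy
    simp [coe_e, coe_f, coe_h] at h01 h10
    apply ext_entries
    · simp [coe_h]
    · have h2 : y.1 0 1 * (ζ - 1) = 0 := by linear_combination h01
      simpa [coe_h] using (mul_eq_zero.1 h2).resolve_right (sub_ne_zero.2 hζ1)
    · have h2 : y.1 1 0 * (ζ⁻¹ - 1) = 0 := by linear_combination h10
      simpa [coe_h] using (mul_eq_zero.1 h2).resolve_right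
        (sub_ne_zero.2 (inv_ne_one.2 hζ1))
  obtain ⟨a, ha⟩ : ∃ a : ℂ, y = a • h := ⟨_, hyh⟩
  have hsq : a = 1 ∨ a = -1 := by
    rw [ha, map_smul, ← hy, ha, smul_smul] at hSy
    have := congrArg (fun x : Sl2 => x.1 0 0) hSy
    simpa [coe_h, mul_self_eq_one_iff] using this
  rcases hsq with rfl | rfl
  -- If s fixes h, it is diagonal of order two. Then r s r = s gives ζ² = 1, so ζ = -1 and ρ
  -- identifies s with r, contrary to injectivity.
  · exfalso
    rw [one_smul] at ha
    rcases eq_one_or_neg_one_of_sq (by rw [sq, hS2]) (hy.symm.trans ha) with h2 | h2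
    · rw [← map_one ρ'] at h2
      exact absurd (hρ'inj h2) (by rw [one_def]; exact fun h => by cases h)
    · rw [hRζ, h2, reflection, adHom_diag_mul, adHom_diag_mul, adHom_diag_eq_iff] at hSR
      have h3 : ζ * ζ = 1 := by linear_combination -hSR
      have h4 := (mul_self_eq_one_iff.1 h3).resolve_left hζ1
      have h5 : ρ' (sr 0) = ρ' (r 1) := by
        rw [h2, hRζ, reflection, adHom_diag_eq_iff, h4]
      exact absurd (hρ'inj h5) (fun h => by cases h)
  · rw [neg_one_smul] at ha
    obtain ⟨κ, hκ, hSκ⟩ := Aut.eq_adHom_diag (g := adHom swap * ρ' (sr 0)) (by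
      rw [Aut.mul_apply, ← hy, ha, map_neg, adHom_swap_h, neg_neg])
    -- Here s is the swap times diag(κ, 1). Conjugation by diag(v, 1) with v² = κ removes the
    -- diagonal factor and leaves r unchanged.
    obtain ⟨v, rfl⟩ := IsAlgClosed.exists_pow_nat_eq κ two_pos
    have hv : v ≠ 0 := fun h0 => by simp [h0] at hκ
    have : NeZero N := ⟨by omega⟩
    obtain ⟨i, -, hi, hiζ⟩ := (isPrimitiveRoot_rootOfUnity_hatOrder_sq (N := N)
      (by omega)).isPrimitiveRoot_iff.1 hprim
    refine ⟨A * (diag v hv)⁻¹, i, Nat.isCoprime_iff_coprime.2 hi, ?_, ?_⟩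
    · rw [hρρ', hRζ, ← adHom_diagRootUnit (M := hatOrder N) (j := i) hζ (by rw [zpow_natCast, hiζ])]
      simp only [map_mul, map_inv]
      rw [adHom_diagRootUnit (M := hatOrder N) (j := i) hζ (by rw [zpow_natCast, hiζ])]
      have hcomm : (adHom (diag v hv))⁻¹ * adHom (diag ζ hζ) =
          adHom (diag ζ hζ) * (adHom (diag v hv))⁻¹ := by
        rw [adHom_diag_inv, adHom_diag_mul, adHom_diag_mul, adHom_diag_eq_iff, mul_comm]
      rw [mul_assoc (adHom A) (adHom (diag v hv))⁻¹, hcomm]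
      group
    · have h2 : ρ' (sr 0) = adHom swap * adHom (diag (v ^ 2) hκ) := by
        rw [← hSκ, ← mul_assoc, adHom_swap_mul_swap, one_mul]
      have h3 : (adHom (diag v hv))⁻¹ * adHom swap = adHom swap * adHom (diag v hv) := by
        rw [adHom_diag_inv, adHom_diag_mul_swap]
        simp only [inv_inv]
      rw [hρρ', h2]
      simp only [map_mul, map_inv]
      rw [mul_assoc (adHom A) (adHom (diag v hv))⁻¹, h3, ← adHom_diag_pow hv, sq]
      group

end Sl2

/-! ### The dihedral action on the torus and its punctures -/

namespace Torus

variable {L : PeriodPair}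

theorem mk_eq_mk_iff {z w : ℂ} : Torus.mk L z = Torus.mk L w ↔ z - w ∈ L.lattice :=
  Submodule.Quotient.eq L.lattice

theorem mk_add (z w : ℂ) : Torus.mk L (z + w) = Torus.mk L z + Torus.mk L w := rfl

theorem mk_neg (z : ℂ) : Torus.mk L (-z) = -Torus.mk L z := rfl

theorem mk_zero : Torus.mk L 0 = 0 := rfl

theorem mk_surjective : Function.Surjective (Torus.mk L) := Submodule.Quotient.mk_surjective _

theorem mk_intCast_mul (k : ℤ) (z : ℂ) : Torus.mk L (k * z) = k • Torus.mk L z := by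
  rw [← zsmul_eq_mul]; rfl

theorem Aut.mul_apply (u v : Torus.Aut L) (z : Torus L) : (u * v).1 z = u.1 (v.1 z) := rfl

theorem Aut.zpow_apply_of_translation {u : Torus.Aut L} {a : Torus L} (hu : ∀ z, u.1 z = z + a)
    (k : ℤ) (z : Torus L) : (u ^ k).1 z = z + k • a := by
  induction k using Int.induction_on generalizing z with
  | zero => rw [zpow_zero, zero_smul, add_zero]; rfl
  | succ i ih => rw [zpow_add_one, Aut.mul_apply, ih, hu, add_smul, one_smul]; abel
  | pred i ih =>
    rw [zpow_sub_one, Aut.mul_apply, ih]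
    have h1 : u⁻¹.1 z = z - a := by
      apply u.1.injective
      rw [← Aut.mul_apply, mul_inv_cancel, hu, sub_add_cancel]
      rfl
    rw [h1, sub_smul, one_smul]
    abel

end Torus

theorem DihedralGroup.induction_on_generators {N : ℕ} [NeZero N] {p : DihedralGroup N → Prop}
    (h1 : p 1) (hr : p (r 1)) (hs : p (sr 0)) (hmul : ∀ a b, p a → p b → p (a * b)) (g) : p g := by
  have hpow : ∀ k : ℕ, p (r 1 ^ k) := fun k => by
    induction k with
    | zero => simpa using h1
    | succ k ih => rw [pow_succ]; exact hmul _ _ ih hr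
  have hall : ∀ i : ZMod N, p (r i) := fun i => by
    have := hpow i.val
    rwa [r_one_pow, ZMod.natCast_zmod_val] at this
  rcases g with i | i
  · exact hall i
  · have := hmul _ _ hs (hall i)
    rwa [sr_mul_r, zero_add] at this

section Dihedral

open DihedralGroup

variable {L L' : PeriodPair} {N : ℕ} [NeZero N] {σ : DihedralGroup N →* Torus.Aut L} {α : ℂ}

omit [NeZero N] in
-- Faithfulness of σ makes the translation by α have the order of r, namely N.
theorem intCast_mul_mem_lattice_iff (hσ : Function.Injective σ)
    (hr : ∀ z : Torus L, (σ (r 1)).1 z = z + Torus.mk L α) (k : ℤ) :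
    k * α ∈ L.lattice ↔ (N : ℤ) ∣ k := by
  have h1 := Torus.Aut.zpow_apply_of_translation hr k
  rw [← orderOf_r_one (n := N), orderOf_dvd_iff_zpow_eq_one, ← hσ.eq_iff, map_zpow, map_one]
  have h2 : k * α ∈ L.lattice ↔ k • Torus.mk L α = 0 := by
    rw [← Torus.mk_intCast_mul, ← Torus.mk_zero, Torus.mk_eq_mk_iff, sub_zero]
  rw [h2]
  constructor
  · intro h3
    refine Subtype.ext (Equiv.ext fun z => ?_)
    rw [h1, h3, add_zero]
    rfl
  · intro h3
    have h4 := h1 0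
    rw [h3, zero_add] at h4
    exact h4.symm

/-- Every group element acts as z ↦ ±z + kα, so the orbit of 0 is the image of ℤα, whose preimage in
ℂ is Λ'. -/
theorem mk_mem_punctures_iff (hs : ∀ z : Torus L, (σ (sr 0)).1 z = -z)
    (hr : ∀ z : Torus L, (σ (r 1)).1 z = z + Torus.mk L α)
    (hL' : L'.lattice = L.lattice ⊔ Submodule.span ℤ {α}) (w : ℂ) :
    Torus.mk L w ∈ punctures σ ↔ w ∈ L'.lattice := by
  have h1 := Torus.Aut.zpow_apply_of_translation hr
  rw [hL', PeriodPair.mem_sup_span_singleton_iff]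
  constructor
  · rintro ⟨γ, hγ⟩
    have h2 : ∀ γ : DihedralGroup N, ∀ z : Torus L, ∃ k : ℤ,
        (σ γ).1 z = z + k • Torus.mk L α ∨ (σ γ).1 z = -z + k • Torus.mk L α := by
      intro γ
      induction γ using DihedralGroup.induction_on_generators with
      | h1 => exact fun z => ⟨0, Or.inl (by rw [map_one, zero_smul, add_zero]; rfl)⟩
      | hr => exact fun z => ⟨1, Or.inl (by rw [hr, one_smul])⟩
      | hs => exact fun z => ⟨0, Or.inr (by rw [hs, zero_smul, add_zero])⟩
      | hmul a b ha hb =>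
        intro z
        obtain ⟨k, hk⟩ := hb z
        obtain ⟨m, hm⟩ := ha ((σ b).1 z)
        rw [map_mul, Torus.Aut.mul_apply]
        rcases hm with hm | hm <;> rcases hk with hk | hk <;> rw [hm, hk]
        · exact ⟨k + m, Or.inl (by rw [add_smul]; abel)⟩
        · exact ⟨k + m, Or.inr (by rw [add_smul]; abel)⟩
        · exact ⟨m - k, Or.inr (by rw [sub_smul]; abel)⟩
        · exact ⟨m - k, Or.inl (by rw [sub_smul]; abel)⟩
    obtain ⟨k, hk⟩ := h2 γ 0
    refine ⟨k, ?_⟩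
    rw [← Torus.mk_eq_mk_iff, Torus.mk_intCast_mul, ← hγ]
    rcases hk with hk | hk
    · exact hk.trans (zero_add _)
    · exact hk.trans (by rw [neg_zero, zero_add])
  · rintro ⟨k, hk⟩
    refine ⟨r 1 ^ k, ?_⟩
    rw [← Torus.mk_eq_mk_iff] at hk
    change (σ (r 1 ^ k)).1 0 = _
    rw [map_zpow, h1, zero_add, hk, Torus.mk_intCast_mul]

end Dihedral

/-! ### Pulling back functions and current algebra elements to ℂ -/

section Functions

variable {L L' : PeriodPair} {Γ : Type} [Group Γ] {σ : Γ →* Torus.Aut L}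

open Classical in
/-- The pull-back to `ℂ` of a function on the punctured torus, extended by zero. -/
def RegFun.lift (f : RegFun σ) (w : ℂ) : ℂ :=
  if h : Torus.mk L w ∉ punctures σ then f.1 ⟨Torus.mk L w, h⟩ else 0

theorem RegFun.lift_of_notMem (f : RegFun σ) {w : ℂ} (h : Torus.mk L w ∉ punctures σ) :
    f.lift w = f.1 ⟨Torus.mk L w, h⟩ := dif_pos h

theorem RegFun.lift_of_mem (f : RegFun σ) {w : ℂ} (h : Torus.mk L w ∈ punctures σ) :
    f.lift w = 0 := dif_neg (not_not.2 h)

theorem RegFun.lift_eq_of_mk_eq (f : RegFun σ) {w w' : ℂ} (h : Torus.mk L w = Torus.mk L w') :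
    f.lift w = f.lift w' := by
  by_cases hw : Torus.mk L w ∈ punctures σ
  · rw [f.lift_of_mem hw, f.lift_of_mem (h ▸ hw)]
  · rw [f.lift_of_notMem hw, f.lift_of_notMem (h ▸ hw)]
    exact congrArg f.1 (Subtype.ext h)

theorem RegFun.ext_lift {f g : RegFun σ}
    (h : ∀ w, Torus.mk L w ∉ punctures σ → f.lift w = g.lift w) : f = g := by
  refine Subtype.ext (funext fun ⟨z, hz⟩ => ?_)
  obtain ⟨w, rfl⟩ := Torus.mk_surjective z
  rw [← f.lift_of_notMem hz, ← g.lift_of_notMem hz, h w hz]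

theorem RegFun.meromorphic_lift (hp : ∀ w, Torus.mk L w ∈ punctures σ ↔ w ∈ L'.lattice)
    (f : RegFun σ) : Meromorphic f.lift := by
  intro x
  obtain ⟨F, hF, -, h⟩ := f.2 x
  refine hF.congr ?_
  filter_upwards [h.filter_mono nhdsWithin_le_nhds, L'.notMem_lattice_eventually x] with w hw hwL
  rw [← hp] at hwL
  rw [f.lift_of_notMem hwL, hw hwL]

theorem RegFun.analyticAt_lift (hp : ∀ w, Torus.mk L w ∈ punctures σ ↔ w ∈ L'.lattice)
    (f : RegFun σ) {x : ℂ} (hx : x ∉ L'.lattice) : AnalyticAt ℂ f.lift x := by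
  obtain ⟨F, -, hF, h⟩ := f.2 x
  refine (hF (by rwa [hp])).congr ?_
  filter_upwards [h, L'.compl_lattice_mem_nhds hx] with w hw hwL
  have hwL' : Torus.mk L w ∉ punctures σ := by rwa [hp]
  rw [f.lift_of_notMem hwL', hw hwL']

/-- A periodic function with poles in the lattice of `L'` descends to the punctured torus. -/
theorem RegFun.exists_of_periodic (hp : ∀ w, Torus.mk L w ∈ punctures σ ↔ w ∈ L'.lattice)
    {g : ℂ → ℂ} (hg : Meromorphic g) (hga : ∀ z ∉ L'.lattice, AnalyticAt ℂ g z)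
    (hper : ∀ l ∈ L.lattice, ∀ z, g (z + l) = g z) :
    ∃ f : RegFun σ, ∀ z ∉ L'.lattice, f.lift z = g z := by
  have hout : ∀ w, g (Function.surjInv Torus.mk_surjective (Torus.mk L w)) = g w := fun w => by
    have h1 := Function.surjInv_eq Torus.mk_surjective (Torus.mk L w)
    have h2 := hper _ (Torus.mk_eq_mk_iff.1 h1) w
    rwa [add_sub_cancel] at h2
  refine ⟨⟨fun z => g (Function.surjInv Torus.mk_surjective z.1), fun x =>
    ⟨g, hg x, fun hx => hga x (by rwa [← hp]), Filter.Eventually.of_forall fun w hw => hout w⟩⟩,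
    fun z hz => ?_⟩
  rw [← hp] at hz
  rw [RegFun.lift_of_notMem _ hz]
  exact hout z

theorem apply_notMem_punctures (σ : Γ →* Torus.Aut L) (γ : Γ) {z : Torus L}
    (hz : z ∉ punctures σ) : (σ γ).1 z ∉ punctures σ := by
  have := apply_inv_notMem_punctures σ γ⁻¹ hz
  rwa [inv_inv] at this

theorem apply_inv_apply (σ : Γ →* Torus.Aut L) (γ : Γ) (z : Torus L) :
    (σ γ).1 ((σ γ⁻¹).1 z) = z := by
  rw [← Torus.Aut.mul_apply, ← map_mul, mul_inv_cancel, map_one]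
  rfl

theorem apply_apply_inv (σ : Γ →* Torus.Aut L) (γ : Γ) (z : Torus L) :
    (σ γ⁻¹).1 ((σ γ).1 z) = z := by
  rw [← Torus.Aut.mul_apply, ← map_mul, inv_mul_cancel, map_one]
  rfl

theorem RegFun.mem_invariants_iff {f : RegFun σ} : f ∈ RegFun.invariants σ ↔
    ∀ (γ : Γ) (z) (hz : z ∉ punctures σ),
      f.1 ⟨(σ γ).1 z, apply_notMem_punctures σ γ hz⟩ = f.1 ⟨z, hz⟩ := by
  constructor
  · intro h γ z hz
    have h1 := congrArg (fun g : RegFun σ => g.1 ⟨(σ γ).1 z, apply_notMem_punctures σ γ hz⟩) (h γ)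
    rw [← h1]
    exact congrArg f.1 (Subtype.ext (apply_apply_inv σ γ z))
  · intro h γ
    refine Subtype.ext (funext fun ⟨z, hz⟩ => ?_)
    change f.1 ⟨(σ γ⁻¹).1 z, _⟩ = f.1 ⟨z, hz⟩
    exact h γ⁻¹ z hz

namespace CurrentAlgebra

theorem eval_tmul (z : PuncturedTorus σ) (f : RegFun σ) (x : Sl2) :
    eval σ z (f ⊗ₜ[ℂ] x) = f.1 z • x := rfl

set_option synthInstance.maxHeartbeats 400000 in
theorem eval_lie (z : PuncturedTorus σ) (X Y : CurrentAlgebra σ) :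
    eval σ z ⁅X, Y⁆ = ⁅eval σ z X, eval σ z Y⁆ := by
  induction X using TensorProduct.induction_on with
  | zero =>
    rw [map_zero, zero_lie]
    exact (congrArg (eval σ z) (zero_lie (L := CurrentAlgebra σ) Y)).trans (map_zero _)
  | add X X' hX hX' =>
    rw [map_add, add_lie, ← hX, ← hX', ← map_add]
    exact congrArg (eval σ z) (add_lie X X' Y)
  | tmul f x =>
    induction Y using TensorProduct.induction_on with
    | zero =>
      rw [map_zero, lie_zero]
      exact (congrArg (eval σ z) (lie_zero (f ⊗ₜ[ℂ] x))).trans (map_zero _)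
    | add Y Y' hY hY' =>
      rw [map_add, lie_add, ← hY, ← hY', ← map_add]
      exact congrArg (eval σ z) (lie_add (f ⊗ₜ[ℂ] x) Y Y')
    | tmul g y =>
      rw [LieAlgebra.ExtendScalars.bracket_tmul, eval_tmul, eval_tmul, eval_tmul, smul_lie, lie_smul,
        smul_smul]
      rfl

theorem eval_smul (z : PuncturedTorus σ) (f : RegFun σ) (X : CurrentAlgebra σ) :
    eval σ z (f • X) = f.1 z • eval σ z X := by
  induction X using TensorProduct.induction_on with
  | zero => simp
  | add X X' hX hX' => rw [smul_add, map_add, hX, hX', map_add, smul_add]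
  | tmul g x =>
    rw [TensorProduct.smul_tmul', eval_tmul, eval_tmul, smul_smul]
    rfl

theorem eval_act (ρ : Γ →* Sl2.Aut) (γ : Γ) (z : PuncturedTorus σ) (X : CurrentAlgebra σ) :
    eval σ z (act ρ σ γ X) =
      (ρ γ).1 (eval σ ⟨(σ γ⁻¹).1 z.1, apply_inv_notMem_punctures σ γ z.2⟩ X) := by
  induction X using TensorProduct.induction_on with
  | zero => simp
  | add X X' hX hX' => rw [map_add, map_add, hX, hX', map_add, map_add]
  | tmul g x =>
    rw [eval_tmul, map_smul]
    rfl

theorem exists_eq_sum (X : CurrentAlgebra σ) : ∃ a b c : RegFun σ,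
    X = a ⊗ₜ Sl2.e + b ⊗ₜ Sl2.f + c ⊗ₜ Sl2.h := by
  induction X using TensorProduct.induction_on with
  | zero => exact ⟨0, 0, 0, by simp⟩
  | add X X' hX hX' =>
    obtain ⟨a, b, c, rfl⟩ := hX
    obtain ⟨a', b', c', rfl⟩ := hX'
    refine ⟨a + a', b + b', c + c', ?_⟩
    simp only [TensorProduct.add_tmul]
    abel
  | tmul g x =>
    refine ⟨x.1 0 1 • g, x.1 1 0 • g, x.1 0 0 • g, ?_⟩
    conv_lhs => rw [Sl2.eq_combination x]
    simp only [TensorProduct.tmul_add, TensorProduct.tmul_smul, TensorProduct.smul_tmul']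

/-- Since e, f, h is a basis, the values determine the coefficient functions. Identities in the
tensor product can thus be checked pointwise in 𝔰𝔩₂. -/
theorem ext_eval {X Y : CurrentAlgebra σ} (h : ∀ z, eval σ z X = eval σ z Y) : X = Y := by
  obtain ⟨a, b, c, rfl⟩ := exists_eq_sum X
  obtain ⟨a', b', c', rfl⟩ := exists_eq_sum Y
  simp only [map_add, eval_tmul] at h
  have h1 : ∀ z, a.1 z = a'.1 z ∧ b.1 z = b'.1 z ∧ c.1 z = c'.1 z := fun z => by
    have h01 := congrArg (fun x : Sl2 => x.1 0 1) (h z)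
    have h10 := congrArg (fun x : Sl2 => x.1 1 0) (h z)
    have h00 := congrArg (fun x : Sl2 => x.1 0 0) (h z)
    simp [Sl2.coe_e, Sl2.coe_f, Sl2.coe_h] at h01 h10 h00
    exact ⟨h01, h10, h00⟩
  rw [Subtype.ext (funext fun z => (h1 z).1), Subtype.ext (funext fun z => (h1 z).2.1),
    Subtype.ext (funext fun z => (h1 z).2.2)]

theorem mem_automorphicLieAlgebra_iff {ρ : Γ →* Sl2.Aut} {X : CurrentAlgebra σ} :
    X ∈ automorphicLieAlgebra ρ σ ↔ ∀ (γ : Γ) (z) (hz : z ∉ punctures σ),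
      eval σ ⟨(σ γ).1 z, apply_notMem_punctures σ γ hz⟩ X = (ρ γ).1 (eval σ ⟨z, hz⟩ X) := by
  constructor
  · intro h γ z hz
    have h1 := congrArg (eval σ ⟨(σ γ).1 z, apply_notMem_punctures σ γ hz⟩) (h γ)
    rw [← h1, eval_act]
    congr 2
    exact congrArg (eval σ) (Subtype.ext (apply_apply_inv σ γ z))
  · intro h γ
    refine ext_eval fun ⟨z, hz⟩ => ?_
    rw [eval_act, ← h γ _ (apply_inv_notMem_punctures σ γ hz)]
    congr 2
    exact Subtype.ext (apply_inv_apply σ γ z)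

open Classical in
/-- The pull-back to `ℂ` of an element of the current algebra, extended by zero. -/
def lift (X : CurrentAlgebra σ) (w : ℂ) : Sl2 :=
  if h : Torus.mk L w ∉ punctures σ then eval σ ⟨Torus.mk L w, h⟩ X else 0

theorem lift_of_notMem (X : CurrentAlgebra σ) {w : ℂ} (h : Torus.mk L w ∉ punctures σ) :
    lift X w = eval σ ⟨Torus.mk L w, h⟩ X := dif_pos h

theorem lift_of_mem (X : CurrentAlgebra σ) {w : ℂ} (h : Torus.mk L w ∈ punctures σ) :
    lift X w = 0 := dif_neg (not_not.2 h)

theorem lift_sum (a b c : RegFun σ) (w : ℂ) :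
    lift (a ⊗ₜ[ℂ] Sl2.e + b ⊗ₜ[ℂ] Sl2.f + c ⊗ₜ[ℂ] Sl2.h) w =
      a.lift w • Sl2.e + b.lift w • Sl2.f + c.lift w • Sl2.h := by
  by_cases h : Torus.mk L w ∈ punctures σ
  · simp [lift_of_mem _ h, RegFun.lift_of_mem _ h]
  · simp only [lift_of_notMem _ h, RegFun.lift_of_notMem _ h, map_add, eval_tmul]

theorem lift_lie (X Y : CurrentAlgebra σ) (w : ℂ) : lift ⁅X, Y⁆ w = ⁅lift X w, lift Y w⁆ := by
  by_cases h : Torus.mk L w ∈ punctures σ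
  · simp [lift_of_mem _ h]
  · simp only [lift_of_notMem _ h, eval_lie]

theorem lift_smul (f : RegFun σ) (X : CurrentAlgebra σ) (w : ℂ) :
    lift (f • X) w = f.lift w • lift X w := by
  by_cases h : Torus.mk L w ∈ punctures σ
  · simp [lift_of_mem _ h]
  · simp only [lift_of_notMem _ h, RegFun.lift_of_notMem _ h, eval_smul]

theorem lift_add (X Y : CurrentAlgebra σ) (w : ℂ) : lift (X + Y) w = lift X w + lift Y w := by
  by_cases h : Torus.mk L w ∈ punctures σ
  · simp [lift_of_mem _ h]
  · simp only [lift_of_notMem _ h, map_add]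

theorem lift_const_smul (c : ℂ) (X : CurrentAlgebra σ) (w : ℂ) :
    lift (c • X) w = c • lift X w := by
  by_cases h : Torus.mk L w ∈ punctures σ
  · simp [lift_of_mem _ h]
  · simp only [lift_of_notMem _ h, map_smul]

theorem lift_eq_of_mk_eq (X : CurrentAlgebra σ) {w w' : ℂ} (h : Torus.mk L w = Torus.mk L w') :
    lift X w = lift X w' := by
  by_cases hw : Torus.mk L w ∈ punctures σ
  · rw [lift_of_mem X hw, lift_of_mem X (h ▸ hw)]
  · rw [lift_of_notMem X hw, lift_of_notMem X (h ▸ hw)]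
    exact congrArg (fun z => eval σ z X) (Subtype.ext h)

theorem ext_lift {X Y : CurrentAlgebra σ}
    (h : ∀ w, Torus.mk L w ∉ punctures σ → lift X w = lift Y w) : X = Y := by
  refine ext_eval fun ⟨z, hz⟩ => ?_
  obtain ⟨w, rfl⟩ := Torus.mk_surjective z
  rw [← lift_of_notMem X hz, ← lift_of_notMem Y hz, h w hz]

end CurrentAlgebra

end Functions

/-! ### Functions and matrices regular off the lattice -/

section Regular

variable {L' : PeriodPair}

/-- A function on `ℂ` is regular off the lattice if it is meromorphic, with all poles in the
lattice. -/
def PeriodPair.IsRegular (L' : PeriodPair) (f : ℂ → ℂ) : Prop :=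
  Meromorphic f ∧ ∀ z ∉ L'.lattice, AnalyticAt ℂ f z

namespace PeriodPair.IsRegular

variable {f g : ℂ → ℂ}

theorem const (c : ℂ) : L'.IsRegular fun _ => c :=
  ⟨fun z => MeromorphicAt.const c z, fun _ _ => analyticAt_const⟩

theorem add (hf : L'.IsRegular f) (hg : L'.IsRegular g) : L'.IsRegular fun z => f z + g z :=
  ⟨fun z => (hf.1 z).add (hg.1 z), fun z hz => (hf.2 z hz).add (hg.2 z hz)⟩

theorem mul (hf : L'.IsRegular f) (hg : L'.IsRegular g) : L'.IsRegular fun z => f z * g z :=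
  ⟨fun z => (hf.1 z).mul (hg.1 z), fun z hz => (hf.2 z hz).mul (hg.2 z hz)⟩

theorem congr (hf : L'.IsRegular f) (h : ∀ z ∉ L'.lattice, f z = g z) : L'.IsRegular g :=
  ⟨fun z => (hf.1 z).congr ((L'.notMem_lattice_eventually z).mono h), fun z hz =>
    (hf.2 z hz).congr (Filter.mem_of_superset (L'.compl_lattice_mem_nhds hz) h)⟩

end PeriodPair.IsRegular

variable {A B : ℂ → Matrix (Fin 2) (Fin 2) ℂ}

theorem isRegular_matrix_mul (hA : ∀ a b, L'.IsRegular fun z => A z a b)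
    (hB : ∀ a b, L'.IsRegular fun z => B z a b) (a b : Fin 2) :
    L'.IsRegular fun z => (A z * B z) a b := by
  simp only [Matrix.mul_apply, Fin.sum_univ_two]
  exact ((hA a 0).mul (hB 0 b)).add ((hA a 1).mul (hB 1 b))

/-- With constant determinant the inverse is a constant multiple of the adjugate, so inversion
creates no poles. -/
theorem isRegular_matrix_inv (hA : ∀ a b, L'.IsRegular fun z => A z a b) {d : ℂ}
    (hd : ∀ z ∉ L'.lattice, (A z).det = d) (a b : Fin 2) :
    L'.IsRegular fun z => (A z)⁻¹ a b := by
  have h1 : L'.IsRegular fun z => d⁻¹ * (A z).adjugate a b := by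
    refine (PeriodPair.IsRegular.const _).mul ?_
    simp only [Matrix.adjugate_fin_two]
    fin_cases a <;> fin_cases b
    · exact hA 1 1
    · exact ((PeriodPair.IsRegular.const (-1)).mul (hA 0 1)).congr fun z _ => neg_one_mul _
    · exact ((PeriodPair.IsRegular.const (-1)).mul (hA 1 0)).congr fun z _ => neg_one_mul _
    · exact hA 0 0
  refine h1.congr fun z hz => ?_
  rw [Matrix.inv_def, hd z hz, Ring.inverse_eq_inv', Matrix.smul_apply, smul_eq_mul]

theorem isRegular_Ad (hA : ∀ a b, L'.IsRegular fun z => A z a b) {d : ℂ}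
    (hd : ∀ z ∉ L'.lattice, (A z).det = d) {X : ℂ → Sl2}
    (hX : ∀ a b, L'.IsRegular fun z => (X z).1 a b) (a b : Fin 2) :
    L'.IsRegular fun z => (Sl2.Ad (A z) (X z)).1 a b :=
  isRegular_matrix_mul (isRegular_matrix_mul hA hX) (isRegular_matrix_inv hA hd) a b

end Regular

namespace Sl2

theorem Ad_inv_apply_Ad {A : Matrix (Fin 2) (Fin 2) ℂ} (hA : IsUnit A.det) (x : Sl2) :
    Ad A⁻¹ (Ad A x) = x := by
  rw [← Ad_mul, Matrix.nonsing_inv_mul _ hA, Ad_one]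

theorem Ad_apply_Ad_inv {A : Matrix (Fin 2) (Fin 2) ℂ} (hA : IsUnit A.det) (x : Sl2) :
    Ad A (Ad A⁻¹ x) = x := by
  rw [← Ad_mul, Matrix.mul_nonsing_inv _ hA, Ad_one]

theorem Ad_sign_smul {ε : ℂ} (hε : ε ^ 2 = 1) (A : Matrix (Fin 2) (Fin 2) ℂ) (x : Sl2) :
    Ad (ε • A) x = Ad A x := by
  have h0 : ε ≠ 0 := fun h => by simp [h] at hε
  have h1 : (ε • (1 : Matrix (Fin 2) (Fin 2) ℂ)).det ≠ 0 := by simp [h0]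
  have h2 : Ad (ε • (1 : Matrix (Fin 2) (Fin 2) ℂ)) x = x := by
    rw [Ad_eq_iff (isUnit_iff_ne_zero.2 h1)]
    simp
  rw [← mul_one A, ← Matrix.mul_smul, Ad_mul, h2, mul_one]

theorem Ad_reflection (x : Sl2) : Ad reflection.1 x =
    (-x.1 0 1) • e + (-x.1 1 0) • f + x.1 0 0 • h := by
  rw [Ad_eq_iff (isUnit_det _), coe_reflection]
  ext i j
  fin_cases i <;> fin_cases j <;>
    simp [coe_add, coe_e, coe_f, coe_h, Matrix.mul_apply, Fin.sum_univ_two, apply_one_one]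

theorem Ad_combination (A : Matrix (Fin 2) (Fin 2) ℂ) (a b c : ℂ) :
    Ad A (a • e + b • f + c • h) = a • Ad A e + b • Ad A f + c • Ad A h := by
  simp only [Ad_add, Ad_smul]

theorem combination_injective {a b c a' b' c' : ℂ}
    (H : a • e + b • f + c • h = a' • e + b' • f + c' • h) : a = a' ∧ b = b' ∧ c = c' := by
  have h01 := congrArg (fun x : Sl2 => x.1 0 1) H
  have h10 := congrArg (fun x : Sl2 => x.1 1 0) H
  have h00 := congrArg (fun x : Sl2 => x.1 0 0) H
  simp [coe_add, coe_e, coe_f, coe_h] at h01 h10 h00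
  exact ⟨h01, h10, h00⟩

end Sl2

namespace RegFun

variable {L L' : PeriodPair} {Γ : Type} [Group Γ] {σ : Γ →* Torus.Aut L}

theorem aeval_apply (x : RegFun σ) (q : ℂ[X]) (z : PuncturedTorus σ) :
    (aeval x q).1 z = q.eval (x.1 z) := by
  let φ : RegFun σ →ₐ[ℂ] ℂ := (Pi.evalAlgHom ℂ _ z).comp (regularFunctions L (punctures σ)).val
  have h1 : φ (aeval x q) = aeval (φ x) q := (aeval_algHom_apply φ x q).symm
  rwa [coe_aeval_eq_eval] at h1

theorem lift_aeval (x : RegFun σ) (q : ℂ[X]) {w : ℂ} (hw : Torus.mk L w ∉ punctures σ) :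
    (aeval x q).lift w = q.eval (x.lift w) := by
  rw [lift_of_notMem _ hw, lift_of_notMem _ hw, aeval_apply]

theorem isRegular_lift (hp : ∀ w, Torus.mk L w ∈ punctures σ ↔ w ∈ L'.lattice) (f : RegFun σ) :
    L'.IsRegular f.lift :=
  ⟨meromorphic_lift hp f, fun _ hz => analyticAt_lift hp f hz⟩

end RegFun

namespace CurrentAlgebra

variable {L L' : PeriodPair} {Γ : Type} [Group Γ] {σ : Γ →* Torus.Aut L}

theorem isRegular_lift (hp : ∀ w, Torus.mk L w ∈ punctures σ ↔ w ∈ L'.lattice)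
    (X : CurrentAlgebra σ) (a b : Fin 2) : L'.IsRegular fun w => (lift X w).1 a b := by
  obtain ⟨u, v, t, rfl⟩ := exists_eq_sum X
  simp only [lift_sum, Sl2.coe_add, Sl2.coe_smul, Matrix.add_apply, Matrix.smul_apply, smul_eq_mul]
  exact (((RegFun.isRegular_lift hp u).mul (.const _)).add
    ((RegFun.isRegular_lift hp v).mul (.const _))).add ((RegFun.isRegular_lift hp t).mul (.const _))

theorem exists_of_periodic (hp : ∀ w, Torus.mk L w ∈ punctures σ ↔ w ∈ L'.lattice)
    {G : ℂ → Sl2} (hG : ∀ a b, L'.IsRegular fun z => (G z).1 a b)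
    (hper : ∀ l ∈ L.lattice, ∀ z, G (z + l) = G z) :
    ∃ X : CurrentAlgebra σ, ∀ z ∉ L'.lattice, lift X z = G z := by
  have h1 : ∀ a b, ∃ f : RegFun σ, ∀ z ∉ L'.lattice, f.lift z = (G z).1 a b := fun a b =>
    RegFun.exists_of_periodic hp (hG a b).1 (hG a b).2 fun l hl z => by rw [hper l hl]
  choose u hu using h1
  refine ⟨u 0 1 ⊗ₜ[ℂ] Sl2.e + u 1 0 ⊗ₜ[ℂ] Sl2.f + u 0 0 ⊗ₜ[ℂ] Sl2.h, fun z hz => ?_⟩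
  rw [lift_sum, hu _ _ z hz, hu _ _ z hz, hu _ _ z hz, ← Sl2.eq_combination]

end CurrentAlgebra

/-! ### Invariance expressed through translation by α and negation -/

section Dihedral

open DihedralGroup

variable {L L' : PeriodPair} {N : ℕ} {σ : DihedralGroup N →* Torus.Aut L} {α : ℂ}

theorem RegFun.lift_add_self {f : RegFun σ} (hf : f ∈ RegFun.invariants σ)
    (hp : ∀ w, Torus.mk L w ∈ punctures σ ↔ w ∈ L'.lattice) (hα : α ∈ L'.lattice)
    (hr : ∀ z : Torus L, (σ (r 1)).1 z = z + Torus.mk L α) (w : ℂ) :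
    f.lift (w + α) = f.lift w := by
  by_cases hw : Torus.mk L w ∈ punctures σ
  · rw [f.lift_of_mem hw, f.lift_of_mem]
    rw [hp] at hw ⊢
    exact add_mem hw hα
  · have h1 := RegFun.mem_invariants_iff.1 hf (r 1) _ hw
    have h2 : (σ (r 1)).1 (Torus.mk L w) = Torus.mk L (w + α) := by rw [hr, Torus.mk_add]
    have h3 := apply_notMem_punctures σ (r 1) hw
    rw [h2] at h3
    rw [f.lift_of_notMem hw, f.lift_of_notMem h3, ← h1]
    exact congrArg f.1 (Subtype.ext h2.symm)

theorem RegFun.lift_neg {f : RegFun σ} (hf : f ∈ RegFun.invariants σ)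
    (hp : ∀ w, Torus.mk L w ∈ punctures σ ↔ w ∈ L'.lattice)
    (hs : ∀ z : Torus L, (σ (sr 0)).1 z = -z) (w : ℂ) :
    f.lift (-w) = f.lift w := by
  by_cases hw : Torus.mk L w ∈ punctures σ
  · rw [f.lift_of_mem hw, f.lift_of_mem]
    rw [hp] at hw ⊢
    exact neg_mem hw
  · have h1 := RegFun.mem_invariants_iff.1 hf (sr 0) _ hw
    have h2 : (σ (sr 0)).1 (Torus.mk L w) = Torus.mk L (-w) := by rw [hs, Torus.mk_neg]
    have h3 := apply_notMem_punctures σ (sr 0) hw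
    rw [h2] at h3
    rw [f.lift_of_notMem hw, f.lift_of_notMem h3, ← h1]
    exact congrArg f.1 (Subtype.ext h2.symm)

theorem RegFun.mem_invariants_of_lift [NeZero N]
    (hr : ∀ z : Torus L, (σ (r 1)).1 z = z + Torus.mk L α)
    (hs : ∀ z : Torus L, (σ (sr 0)).1 z = -z) {f : RegFun σ}
    (h1 : ∀ w, Torus.mk L w ∉ punctures σ → f.lift (w + α) = f.lift w)
    (h2 : ∀ w, Torus.mk L w ∉ punctures σ → f.lift (-w) = f.lift w) :
    f ∈ RegFun.invariants σ := by
  rw [RegFun.mem_invariants_iff]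
  intro γ
  induction γ using DihedralGroup.induction_on_generators with
  | h1 =>
    intro z hz
    refine congrArg f.1 (Subtype.ext ?_)
    change (σ 1).1 z = z
    rw [map_one]
    rfl
  | hr =>
    intro z hz
    obtain ⟨w, rfl⟩ := Torus.mk_surjective z
    have e1 : (σ (r 1)).1 (Torus.mk L w) = Torus.mk L (w + α) := by rw [hr, Torus.mk_add]
    have h3 := apply_notMem_punctures σ (r 1) hz
    have h4 := h1 w hz
    rw [e1] at h3
    rw [f.lift_of_notMem hz, f.lift_of_notMem h3] at h4
    rw [← h4]
    exact congrArg f.1 (Subtype.ext e1)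
  | hs =>
    intro z hz
    obtain ⟨w, rfl⟩ := Torus.mk_surjective z
    have e1 : (σ (sr 0)).1 (Torus.mk L w) = Torus.mk L (-w) := by rw [hs, Torus.mk_neg]
    have h3 := apply_notMem_punctures σ (sr 0) hz
    have h4 := h2 w hz
    rw [e1] at h3
    rw [f.lift_of_notMem hz, f.lift_of_notMem h3] at h4
    rw [← h4]
    exact congrArg f.1 (Subtype.ext e1)
  | hmul a b ha hb =>
    intro z hz
    rw [← hb z hz, ← ha _ (apply_notMem_punctures σ b hz)]
    refine congrArg f.1 (Subtype.ext ?_)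
    change (σ (a * b)).1 z = _
    rw [map_mul]
    rfl

variable {ρ : DihedralGroup N →* Sl2.Aut}

namespace CurrentAlgebra

theorem lift_add_self {X : CurrentAlgebra σ} (hX : X ∈ automorphicLieAlgebra ρ σ)
    (hp : ∀ w, Torus.mk L w ∈ punctures σ ↔ w ∈ L'.lattice) (hα : α ∈ L'.lattice)
    (hr : ∀ z : Torus L, (σ (r 1)).1 z = z + Torus.mk L α) (w : ℂ) :
    lift X (w + α) = (ρ (r 1)).1 (lift X w) := by
  by_cases hw : Torus.mk L w ∈ punctures σ
  · rw [lift_of_mem X hw, lift_of_mem, map_zero]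
    rw [hp] at hw ⊢
    exact add_mem hw hα
  · have h1 := mem_automorphicLieAlgebra_iff.1 hX (r 1) _ hw
    have h2 : (σ (r 1)).1 (Torus.mk L w) = Torus.mk L (w + α) := by rw [hr, Torus.mk_add]
    have h3 := apply_notMem_punctures σ (r 1) hw
    rw [h2] at h3
    rw [lift_of_notMem X hw, lift_of_notMem X h3, ← h1]
    exact congrArg (fun z => eval σ z X) (Subtype.ext h2.symm)

theorem lift_neg {X : CurrentAlgebra σ} (hX : X ∈ automorphicLieAlgebra ρ σ)
    (hp : ∀ w, Torus.mk L w ∈ punctures σ ↔ w ∈ L'.lattice)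
    (hs : ∀ z : Torus L, (σ (sr 0)).1 z = -z) (w : ℂ) :
    lift X (-w) = (ρ (sr 0)).1 (lift X w) := by
  by_cases hw : Torus.mk L w ∈ punctures σ
  · rw [lift_of_mem X hw, lift_of_mem, map_zero]
    rw [hp] at hw ⊢
    exact neg_mem hw
  · have h1 := mem_automorphicLieAlgebra_iff.1 hX (sr 0) _ hw
    have h2 : (σ (sr 0)).1 (Torus.mk L w) = Torus.mk L (-w) := by rw [hs, Torus.mk_neg]
    have h3 := apply_notMem_punctures σ (sr 0) hw
    rw [h2] at h3
    rw [lift_of_notMem X hw, lift_of_notMem X h3, ← h1]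
    exact congrArg (fun z => eval σ z X) (Subtype.ext h2.symm)

theorem mem_automorphicLieAlgebra_of_lift [NeZero N]
    (hr : ∀ z : Torus L, (σ (r 1)).1 z = z + Torus.mk L α)
    (hs : ∀ z : Torus L, (σ (sr 0)).1 z = -z) {X : CurrentAlgebra σ}
    (h1 : ∀ w, Torus.mk L w ∉ punctures σ → lift X (w + α) = (ρ (r 1)).1 (lift X w))
    (h2 : ∀ w, Torus.mk L w ∉ punctures σ → lift X (-w) = (ρ (sr 0)).1 (lift X w)) :
    X ∈ automorphicLieAlgebra ρ σ := by
  rw [mem_automorphicLieAlgebra_iff]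
  intro γ
  induction γ using DihedralGroup.induction_on_generators with
  | h1 =>
    intro z hz
    rw [ρ.map_one]
    refine congrArg (fun z => eval σ z X) (Subtype.ext ?_)
    change (σ 1).1 z = z
    rw [map_one]
    rfl
  | hr =>
    intro z hz
    obtain ⟨w, rfl⟩ := Torus.mk_surjective z
    have e1 : (σ (r 1)).1 (Torus.mk L w) = Torus.mk L (w + α) := by rw [hr, Torus.mk_add]
    have h3 := apply_notMem_punctures σ (r 1) hz
    have h4 := h1 w hz
    rw [e1] at h3
    rw [lift_of_notMem X hz, lift_of_notMem X h3] at h4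
    rw [← h4]
    exact congrArg (fun z => eval σ z X) (Subtype.ext e1)
  | hs =>
    intro z hz
    obtain ⟨w, rfl⟩ := Torus.mk_surjective z
    have e1 : (σ (sr 0)).1 (Torus.mk L w) = Torus.mk L (-w) := by rw [hs, Torus.mk_neg]
    have h3 := apply_notMem_punctures σ (sr 0) hz
    have h4 := h2 w hz
    rw [e1] at h3
    rw [lift_of_notMem X hz, lift_of_notMem X h3] at h4
    rw [← h4]
    exact congrArg (fun z => eval σ z X) (Subtype.ext e1)
  | hmul a b ha hb =>
    intro z hz
    rw [ρ.map_mul, Sl2.Aut.mul_apply, ← hb z hz, ← ha _ (apply_notMem_punctures σ b hz)]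
    refine congrArg (fun z => eval σ z X) (Subtype.ext ?_)
    change (σ (a * b)).1 z = _
    rw [map_mul]
    rfl

end CurrentAlgebra

end Dihedral

/-! ### Coordinates in a frame and the normal form -/

theorem PeriodPair.periodic_of_periodic_sup {K L' : PeriodPair} {α : ℂ} {β : Type*} {f : ℂ → β}
    (hL' : L'.lattice = K.lattice ⊔ Submodule.span ℤ {α})
    (hK : ∀ l ∈ K.lattice, ∀ z, f (z + l) = f z) (hα : ∀ z, f (z + α) = f z) :
    ∀ l ∈ L'.lattice, ∀ z, f (z + l) = f z := by
  intro l hl z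
  rw [hL', mem_sup_span_singleton_iff] at hl
  obtain ⟨k, hk⟩ := hl
  have h1 : Function.Periodic f (k * α) := Function.Periodic.int_mul hα k
  have h2 : z + l = z + (l - k * α) + k * α := by ring
  rw [h2, h1, hK _ hk]

theorem PeriodPair.derivWeierstrassP_isRegular (L' : PeriodPair) :
    L'.IsRegular L'.derivWeierstrassP :=
  ⟨L'.meromorphic_derivWeierstrassP, fun _ hz => L'.analyticAt_derivWeierstrassP hz⟩

theorem PeriodPair.weierstrassP_isRegular (L' : PeriodPair) : L'.IsRegular L'.weierstrassP :=
  ⟨fun z => L'.meromorphic_weierstrassP z, fun _ hz => L'.analyticAt_weierstrassP hz⟩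

namespace PeriodPair.IsFrame

variable {L L' : PeriodPair} {α : ℂ} {R S : GL (Fin 2) ℂ} {Ψ : ℂ → Matrix (Fin 2) (Fin 2) ℂ}

section

variable {D T : Matrix (Fin 2) (Fin 2) ℂ} (hΨ : IsFrame L L' α D T Ψ)

include hΨ

theorem isUnit_det {z : ℂ} (hz : z ∉ L'.lattice) : IsUnit (Ψ z).det := by
  obtain ⟨d, hd, h⟩ := hΨ.det_eq
  rw [h z hz]
  exact isUnit_iff_ne_zero.2 hd

theorem isRegular (a b : Fin 2) : L'.IsRegular fun z => Ψ z a b :=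
  ⟨hΨ.meromorphic a b, fun z hz => hΨ.analyticAt z hz a b⟩

theorem Ad_add_mem {l : ℂ} (hl : l ∈ L.lattice) (z : ℂ) (v : Sl2) :
    Sl2.Ad (Ψ (z + l)) v = Sl2.Ad (Ψ z) v := by
  obtain ⟨ε, hε, h⟩ := hΨ.add_mem l hl
  rw [h, Sl2.Ad_sign_smul hε]

theorem Ad_inv_add_mem {l : ℂ} (hl : l ∈ L.lattice) (z : ℂ) (v : Sl2) :
    Sl2.Ad (Ψ (z + l))⁻¹ v = Sl2.Ad (Ψ z)⁻¹ v := by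
  obtain ⟨ε, hε, h⟩ := hΨ.add_mem l hl
  rcases sq_eq_sq_iff_eq_or_eq_neg.1 (hε.trans (one_pow 2).symm) with rfl | rfl
  · rw [h, one_smul]
  · have h1 : ((-1 : ℂ) • Ψ z)⁻¹ = (-1 : ℂ) • (Ψ z)⁻¹ := by
      have h2 : (-1 : Matrix (Fin 2) (Fin 2) ℂ)⁻¹ = -1 := Matrix.inv_eq_left_inv (by simp)
      rw [neg_one_smul, neg_one_smul, ← neg_one_mul, Matrix.mul_inv_rev, h2, mul_neg_one]
    rw [h, h1, Sl2.Ad_sign_smul hε]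

theorem Ad_add_self (z : ℂ) (v : Sl2) :
    Sl2.Ad (Ψ (z + α)) v = Sl2.Ad D (Sl2.Ad (Ψ z) v) := by
  rw [hΨ.add_self, Sl2.Ad_mul]

theorem Ad_neg (z : ℂ) (v : Sl2) :
    Sl2.Ad (Ψ (-z)) v = Sl2.Ad T (Sl2.Ad (Ψ z) (Sl2.Ad Sl2.reflection.1 v)) := by
  rw [hΨ.neg, Sl2.Ad_mul, Sl2.Ad_mul]
  rfl

theorem exists_isRegular_lift {Γ : Type} [Group Γ] {σ : Γ →* Torus.Aut L}
    (hp : ∀ w, Torus.mk L w ∈ punctures σ ↔ w ∈ L'.lattice) (v : Sl2) :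
    ∃ X : CurrentAlgebra σ, ∀ z ∉ L'.lattice, CurrentAlgebra.lift X z = Sl2.Ad (Ψ z) v := by
  obtain ⟨d, -, hd⟩ := hΨ.det_eq
  exact CurrentAlgebra.exists_of_periodic hp
    (isRegular_Ad hΨ.isRegular hd fun _ _ => .const _) fun l hl z => hΨ.Ad_add_mem hl z v

theorem isRegular_Ad_inv {X : ℂ → Sl2} (hX : ∀ a b, L'.IsRegular fun z => (X z).1 a b)
    (a b : Fin 2) : L'.IsRegular fun z => (Sl2.Ad (Ψ z)⁻¹ (X z)).1 a b := by
  obtain ⟨d, -, hd⟩ := hΨ.det_eq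
  exact isRegular_Ad (isRegular_matrix_inv hΨ.isRegular hd) (d := d⁻¹) (fun z hz => by
    rw [Matrix.det_nonsing_inv, hd z hz, Ring.inverse_eq_inv']) hX a b

end

/-- In a frame, an equivariant function with values in `𝔰𝔩₂` has off-diagonal coordinates that are
polynomials in `℘` times `℘'`, and diagonal coordinates that are polynomials in `℘`. -/
theorem exists_coordinates (hΨ : IsFrame L L' α R.1 S.1 Ψ)
    (hL' : L'.lattice = L.lattice ⊔ Submodule.span ℤ {α})
    {X : ℂ → Sl2} (hX : ∀ a b, L'.IsRegular fun z => (X z).1 a b)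
    (hper : ∀ l ∈ L.lattice, ∀ z, X (z + l) = X z)
    (hα : ∀ z, X (z + α) = Sl2.Ad R.1 (X z)) (hneg : ∀ z, X (-z) = Sl2.Ad S.1 (X z)) :
    ∃ a b c : ℂ[X], ∀ z ∉ L'.lattice, X z =
      (a.eval (L'.weierstrassP z) * L'.derivWeierstrassP z) • Sl2.Ad (Ψ z) Sl2.e +
      (b.eval (L'.weierstrassP z) * L'.derivWeierstrassP z) • Sl2.Ad (Ψ z) Sl2.f +
      c.eval (L'.weierstrassP z) • Sl2.Ad (Ψ z) Sl2.h := by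
  -- In the untwisted coordinates the factors R and S cancel: `Y` is Λ'-periodic and only the
  -- reflection diag(-1, 1) survives, which negates the e- and f-coordinates.
  set Y : ℂ → Sl2 := fun z => Sl2.Ad (Ψ z)⁻¹ (X z) with hY
  have hYper : ∀ l ∈ L'.lattice, ∀ z, Y (z + l) = Y z := by
    refine periodic_of_periodic_sup hL' (fun l hl z => ?_) fun z => ?_
    · simp only [hY]
      rw [hper l hl, hΨ.Ad_inv_add_mem hl]
    · simp only [hY]
      rw [hα, hΨ.add_self, Matrix.mul_inv_rev, Sl2.Ad_mul, Sl2.Ad_inv_apply_Ad (Sl2.isUnit_det R)]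
  have hYneg : ∀ z, Y (-z) =
      (-(Y z).1 0 1) • Sl2.e + (-(Y z).1 1 0) • Sl2.f + (Y z).1 0 0 • Sl2.h := fun z => by
    have h1 : Sl2.Ad Sl2.reflection.1 (Y (-z)) = Y z := by
      simp only [hY]
      rw [hneg, hΨ.neg, Matrix.mul_inv_rev, Matrix.mul_inv_rev, Sl2.Ad_mul, Sl2.Ad_mul,
        Sl2.Ad_inv_apply_Ad (Sl2.isUnit_det S)]
      exact Sl2.Ad_apply_Ad_inv (Sl2.isUnit_det Sl2.reflection) _
    have h2 := Sl2.Ad_reflection (Y (-z))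
    rw [h1] at h2
    rw [h2]
    conv_lhs => rw [Sl2.eq_combination (Y (-z))]
    simp [Sl2.coe_add, Sl2.coe_e, Sl2.coe_f, Sl2.coe_h]
  have hreg := hΨ.isRegular_Ad_inv hX
  obtain ⟨a, ha⟩ := L'.exists_polynomial_of_odd (f := fun z => (Y z).1 0 1) (hreg 0 1).1
    (hreg 0 1).2 (fun l hl z => by rw [hYper l hl]) (fun z => by
      rw [hYneg]; simp [Sl2.coe_add, Sl2.coe_e, Sl2.coe_f, Sl2.coe_h])
  obtain ⟨b, hb⟩ := L'.exists_polynomial_of_odd (f := fun z => (Y z).1 1 0) (hreg 1 0).1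
    (hreg 1 0).2 (fun l hl z => by rw [hYper l hl]) (fun z => by
      rw [hYneg]; simp [Sl2.coe_add, Sl2.coe_e, Sl2.coe_f, Sl2.coe_h])
  obtain ⟨c, hc⟩ := L'.exists_polynomial_of_even (f := fun z => (Y z).1 0 0) (hreg 0 0).1
    (hreg 0 0).2 (fun l hl z => by rw [hYper l hl]) (fun z => by
      rw [hYneg]; simp [Sl2.coe_add, Sl2.coe_e, Sl2.coe_f, Sl2.coe_h])
  refine ⟨a, b, c, fun z hz => ?_⟩
  rw [← ha z hz, ← hb z hz, ← hc z hz, ← Sl2.Ad_combination, ← Sl2.eq_combination]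
  exact (Sl2.Ad_apply_Ad_inv (hΨ.isUnit_det hz) _).symm

end PeriodPair.IsFrame

section Dihedral

open DihedralGroup

variable {L L' : PeriodPair} {N : ℕ} [NeZero N] {σ : DihedralGroup N →* Torus.Aut L} {α : ℂ}
  {ρ : DihedralGroup N →* Sl2.Aut} {R S : GL (Fin 2) ℂ} {Ψ : ℂ → Matrix (Fin 2) (Fin 2) ℂ}

/-- Pulled back to ℂ, an invariant function is even, elliptic for Λ' and without poles off Λ', hence
a polynomial in ℘. -/
theorem RegFun.invariants_eq_adjoin (hL' : L'.lattice = L.lattice ⊔ Submodule.span ℤ {α})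
    (hr : ∀ z : Torus L, (σ (r 1)).1 z = z + Torus.mk L α)
    (hs : ∀ z : Torus L, (σ (sr 0)).1 z = -z)
    {x : RegFun σ} (hx : ∀ z ∉ L'.lattice, x.lift z = L'.weierstrassP z) :
    RegFun.invariants σ = Algebra.adjoin ℂ {x} := by
  have hp := mk_mem_punctures_iff hs hr hL'
  have hα : α ∈ L'.lattice := by
    rw [hL']
    exact Submodule.mem_sup_right (Submodule.mem_span_singleton_self α)
  apply le_antisymm
  · intro f hf
    obtain ⟨q, hq⟩ := L'.exists_polynomial_of_even (f.meromorphic_lift hp)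
      (fun z hz => f.analyticAt_lift hp hz)
      (PeriodPair.periodic_of_periodic_sup hL' (fun l hl z => f.lift_eq_of_mk_eq (by
        rw [Torus.mk_eq_mk_iff, add_sub_cancel_left]; exact hl)) (RegFun.lift_add_self hf hp hα hr))
      (RegFun.lift_neg hf hp hs)
    rw [Algebra.adjoin_singleton_eq_range_aeval]
    refine ⟨q, RegFun.ext_lift fun w hw => ?_⟩
    have hw' : w ∉ L'.lattice := by rwa [← hp]
    change (aeval x q).lift w = _
    rw [RegFun.lift_aeval x q hw, hx w hw', hq w hw']
  · rw [Algebra.adjoin_le_iff, Set.singleton_subset_iff]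
    refine RegFun.mem_invariants_of_lift hr hs (fun w hw => ?_) fun w hw => ?_
    · rw [hp] at hw
      rw [hx _ hw, hx _ fun h => hw ((add_mem_cancel_right hα).1 h), L'.weierstrassP_add hα]
    · rw [hp] at hw
      rw [hx _ hw, hx _ fun h => hw (neg_mem_iff.1 h), L'.weierstrassP_neg]

omit [NeZero N] in
theorem RegFun.eq_of_mul_eq_mul {x y f g : RegFun σ} {L' : PeriodPair}
    (hp : ∀ w, Torus.mk L w ∈ punctures σ ↔ w ∈ L'.lattice)
    (hx : ∀ z ∉ L'.lattice, x.lift z = L'.weierstrassP z)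
    (hy : ∀ z ∉ L'.lattice, y.lift z = L'.derivWeierstrassP z)
    (hf : f ∈ Algebra.adjoin ℂ {x}) (hg : g ∈ Algebra.adjoin ℂ {x})
    (h : ∀ z ∉ L'.lattice, f.lift z * y.lift z = g.lift z * y.lift z) : f = g := by
  rw [Algebra.adjoin_singleton_eq_range_aeval] at hf hg
  obtain ⟨q, rfl⟩ := hf
  obtain ⟨t, rfl⟩ := hg
  have h1 : q - t = 0 := L'.eq_zero_of_forall_eval_mul_derivWeierstrassP_eq_zero fun z hz => by
    have h2 := h z hz
    change (aeval x q).lift z * _ = (aeval x t).lift z * _ at h2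
    have hz' : Torus.mk L z ∉ punctures σ := by rwa [hp]
    rw [lift_aeval x q hz', lift_aeval x t hz', hx z hz, hy z hz] at h2
    rw [eval_sub, sub_mul, h2, sub_self]
  rw [sub_eq_zero.1 h1]

/-- Under z ↦ -z the fields Ad(Ψ)e and Ad(Ψ)f acquire a sign, which the odd factor ℘' compensates.
They generate because odd coordinates are divisible by ℘', and the bracket of the two generators
brings in ℘'². -/
theorem isNormalForm_of_isFrame (hL' : L'.lattice = L.lattice ⊔ Submodule.span ℤ {α})
    (hr : ∀ z : Torus L, (σ (r 1)).1 z = z + Torus.mk L α)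
    (hs : ∀ z : Torus L, (σ (sr 0)).1 z = -z) (hΨ : L.IsFrame L' α R.1 S.1 Ψ)
    (hR : ρ (r 1) = Sl2.adHom R) (hS : ρ (sr 0) = Sl2.adHom S) {E F H : CurrentAlgebra σ}
    (hE : ∀ z ∉ L'.lattice, CurrentAlgebra.lift E z = Sl2.Ad (Ψ z) Sl2.e)
    (hF : ∀ z ∉ L'.lattice, CurrentAlgebra.lift F z = Sl2.Ad (Ψ z) Sl2.f)
    (hH : ∀ z ∉ L'.lattice, CurrentAlgebra.lift H z = Sl2.Ad (Ψ z) Sl2.h)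
    {x y : RegFun σ} (hx : ∀ z ∉ L'.lattice, x.lift z = L'.weierstrassP z)
    (hy : ∀ z ∉ L'.lattice, y.lift z = L'.derivWeierstrassP z) :
    IsNormalForm ρ σ (y • E) (y • F) H (aeval x L'.cubic) := by
  have hp := mk_mem_punctures_iff hs hr hL'
  have hα : α ∈ L'.lattice := by
    rw [hL']
    exact Submodule.mem_sup_right (Submodule.mem_span_singleton_self α)
  have hinv := RegFun.invariants_eq_adjoin hL' hr hs hx
  have haddα : ∀ {w}, w ∉ L'.lattice → w + α ∉ L'.lattice :=
    fun hw h => hw ((add_mem_cancel_right hα).1 h)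
  have hneg : ∀ {w}, w ∉ L'.lattice → -w ∉ L'.lattice := fun hw h => hw (neg_mem_iff.1 h)
  have hRa : ∀ v, (ρ (r 1)).1 v = Sl2.Ad R.1 v := fun v => by rw [hR, Sl2.adHom_apply]
  have hSa : ∀ v, (ρ (sr 0)).1 v = Sl2.Ad S.1 v := fun v => by rw [hS, Sl2.adHom_apply]
  have hre : Sl2.Ad Sl2.reflection.1 Sl2.e = (-1 : ℂ) • Sl2.e := by
    rw [Sl2.Ad_reflection]; simp [Sl2.coe_e]
  have hrf : Sl2.Ad Sl2.reflection.1 Sl2.f = (-1 : ℂ) • Sl2.f := by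
    rw [Sl2.Ad_reflection]; simp [Sl2.coe_f]
  have hrh : Sl2.Ad Sl2.reflection.1 Sl2.h = Sl2.h := by
    rw [Sl2.Ad_reflection]; simp [Sl2.coe_h]
  have hmem : ∀ {v : Sl2} {X : CurrentAlgebra σ}, Sl2.Ad Sl2.reflection.1 v = (-1 : ℂ) • v →
      (∀ z ∉ L'.lattice, CurrentAlgebra.lift X z = Sl2.Ad (Ψ z) v) →
      y • X ∈ automorphicLieAlgebra ρ σ := by
    intro v X hv hX
    refine CurrentAlgebra.mem_automorphicLieAlgebra_of_lift hr hs (fun w hw => ?_) fun w hw => ?_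
    · rw [hp] at hw
      rw [CurrentAlgebra.lift_smul, CurrentAlgebra.lift_smul, hX _ hw, hX _ (haddα hw), hy _ hw,
        hy _ (haddα hw), L'.derivWeierstrassP_add hα, hΨ.Ad_add_self, hRa, Sl2.Ad_smul]
    · rw [hp] at hw
      rw [CurrentAlgebra.lift_smul, CurrentAlgebra.lift_smul, hX _ hw, hX _ (hneg hw), hy _ hw,
        hy _ (hneg hw), L'.derivWeierstrassP_neg, hΨ.Ad_neg, hSa, hv, Sl2.Ad_smul, Sl2.Ad_smul,
        Sl2.Ad_smul, smul_smul, neg_mul_neg, mul_one]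
  have hlift : ∀ (c : Fin 3 → RegFun σ) {z}, z ∉ L'.lattice →
      CurrentAlgebra.lift (c 0 • (y • E) + c 1 • (y • F) + c 2 • H) z = Sl2.Ad (Ψ z)
        (((c 0).lift z * y.lift z) • Sl2.e + ((c 1).lift z * y.lift z) • Sl2.f +
          (c 2).lift z • Sl2.h) := by
    intro c z hz
    rw [CurrentAlgebra.lift_add, CurrentAlgebra.lift_add, CurrentAlgebra.lift_smul,
      CurrentAlgebra.lift_smul, CurrentAlgebra.lift_smul, CurrentAlgebra.lift_smul,
      CurrentAlgebra.lift_smul, hE z hz, hF z hz, hH z hz, Sl2.Ad_combination, smul_smul, smul_smul]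
  have hxmem : ∀ q : ℂ[X], aeval x q ∈ RegFun.invariants σ := fun q => by
    rw [hinv]
    exact aeval_mem_adjoin_singleton ℂ x
  refine ⟨hmem hre hE, hmem hrf hF, ?_, hxmem _, fun X hX => ?_, ?_, ?_, ?_⟩
  · refine CurrentAlgebra.mem_automorphicLieAlgebra_of_lift hr hs (fun w hw => ?_) fun w hw => ?_
    · rw [hp] at hw
      rw [hH _ hw, hH _ (haddα hw), hΨ.Ad_add_self, hRa]
    · rw [hp] at hw
      rw [hH _ hw, hH _ (hneg hw), hΨ.Ad_neg, hSa, hrh]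
  · obtain ⟨a, b, c, habc⟩ := hΨ.exists_coordinates hL' (CurrentAlgebra.isRegular_lift hp X)
      (fun l hl z => CurrentAlgebra.lift_eq_of_mk_eq X (by
        rw [Torus.mk_eq_mk_iff, add_sub_cancel_left]; exact hl))
      (fun z => by rw [CurrentAlgebra.lift_add_self hX hp hα hr, hRa])
      (fun z => by rw [CurrentAlgebra.lift_neg hX hp hs, hSa])
    have hXeq : X = (![aeval x a, aeval x b, aeval x c] : Fin 3 → RegFun σ) 0 • (y • E) +
        (![aeval x a, aeval x b, aeval x c] : Fin 3 → RegFun σ) 1 • (y • F) +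
        (![aeval x a, aeval x b, aeval x c] : Fin 3 → RegFun σ) 2 • H := by
      refine CurrentAlgebra.ext_lift fun w hw => ?_
      have hw' : w ∉ L'.lattice := by rwa [← hp]
      rw [hlift _ hw', habc w hw', Sl2.Ad_combination]
      simp only [Matrix.cons_val_zero, Matrix.cons_val_one, Matrix.cons_val]
      rw [RegFun.lift_aeval x a hw, RegFun.lift_aeval x b hw, RegFun.lift_aeval x c hw,
        hx w hw', hy w hw']
    refine ⟨![⟨_, hxmem a⟩, ⟨_, hxmem b⟩, ⟨_, hxmem c⟩], hXeq, fun c' hc' => ?_⟩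
    -- Applying Ad(Ψ)⁻¹ reduces uniqueness to comparing coefficients of e, f and h.
    have hc : ∀ z ∉ L'.lattice, (c' 0).1.lift z * y.lift z = (aeval x a).lift z * y.lift z ∧
        (c' 1).1.lift z * y.lift z = (aeval x b).lift z * y.lift z ∧
        (c' 2).1.lift z = (aeval x c).lift z := fun z hz => by
      have h1 := (congrArg (fun X => CurrentAlgebra.lift X z) hc').trans
        (hlift (fun i => (c' i).1) hz)
      have h2 := (congrArg (fun X => CurrentAlgebra.lift X z) hXeq).trans (hlift _ hz)
      exact Sl2.combination_injective
        (((Sl2.Ad_inv_apply_Ad (hΨ.isUnit_det hz) _).symm.trans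
          (congrArg _ (h1.symm.trans h2))).trans (Sl2.Ad_inv_apply_Ad (hΨ.isUnit_det hz) _))
    have heq := fun i q => RegFun.eq_of_mul_eq_mul (f := (c' i).1) (g := aeval x q) hp hx hy
      (hinv ▸ (c' i).2) (hinv ▸ hxmem q)
    funext i
    fin_cases i
    · exact Subtype.ext (heq 0 a fun z hz => (hc z hz).1)
    · exact Subtype.ext (heq 1 b fun z hz => (hc z hz).2.1)
    · exact Subtype.ext (heq 2 c fun z hz => by
        rw [(hc z hz).2.2])
  · refine CurrentAlgebra.ext_lift fun w hw => ?_
    rw [hp] at hw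
    rw [CurrentAlgebra.lift_lie, CurrentAlgebra.lift_const_smul, CurrentAlgebra.lift_smul, hE w hw,
      hH w hw, lie_smul, ← Sl2.Ad_lie (hΨ.isUnit_det hw), Sl2.lie_h_e, Sl2.Ad_smul, smul_comm]
  · refine CurrentAlgebra.ext_lift fun w hw => ?_
    rw [hp] at hw
    rw [CurrentAlgebra.lift_lie, CurrentAlgebra.lift_const_smul, CurrentAlgebra.lift_smul, hF w hw,
      hH w hw, lie_smul, ← Sl2.Ad_lie (hΨ.isUnit_det hw), Sl2.lie_h_f, Sl2.Ad_smul, smul_comm]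
  · refine CurrentAlgebra.ext_lift fun w hw => ?_
    have hw' : w ∉ L'.lattice := by rwa [← hp]
    rw [CurrentAlgebra.lift_lie, CurrentAlgebra.lift_smul, CurrentAlgebra.lift_smul,
      CurrentAlgebra.lift_smul, RegFun.lift_aeval x _ hw, hE w hw', hF w hw', hH w hw', hx w hw',
      hy w hw', lie_smul, smul_lie, ← Sl2.Ad_lie (hΨ.isUnit_det hw'), Sl2.lie_e_f, smul_smul,
      L'.eval_cubic_weierstrassP hw', sq]

end Dihedral

/-! ### The lattice Λ' and homothety to ℤ ⊕ ℤτ -/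

namespace PeriodPair

theorem exists_lattice_eq (M : Submodule ℤ ℂ) [DiscreteTopology M] [IsZLattice ℝ M] :
    ∃ L' : PeriodPair, L'.lattice = M := by
  have := ZLattice.module_finite ℝ M
  have := ZLattice.module_free ℝ M
  have h2 : Module.finrank ℤ M = 2 := by rw [ZLattice.rank ℝ M, Complex.finrank_real_complex]
  let b := Module.finBasisOfFinrankEq ℤ M h2
  have hb : ![(b 0 : ℂ), b 1] = b.ofZLatticeBasis ℝ M := by
    funext i
    rw [Module.Basis.ofZLatticeBasis_apply]
    fin_cases i <;> rfl
  refine ⟨⟨b 0, b 1, hb ▸ (b.ofZLatticeBasis ℝ M).linearIndependent⟩, ?_⟩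
  conv_rhs => rw [← b.ofZLatticeBasis_span ℝ, ← hb]
  rw [Matrix.range_cons_cons_empty]
  rfl

/-- Multiplication by n embeds Λ + ℤα continuously into the discrete group Λ, so the sum is
discrete; it spans ℂ over ℝ because Λ does. -/
theorem exists_lattice_eq_sup (L : PeriodPair) {α : ℂ} {n : ℤ} (hn : n ≠ 0)
    (hα : n * α ∈ L.lattice) :
    ∃ L' : PeriodPair, L'.lattice = L.lattice ⊔ Submodule.span ℤ {α} := by
  have hmem : ∀ w : (L.lattice ⊔ Submodule.span ℤ {α} : Submodule ℤ ℂ), n * w.1 ∈ L.lattice := by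
    rintro ⟨w, hw⟩
    rw [mem_sup_span_singleton_iff] at hw
    obtain ⟨k, hk⟩ := hw
    have h1 := add_mem (L.lattice.smul_mem n hk) (L.lattice.smul_mem k hα)
    convert h1 using 1
    simp only [zsmul_eq_mul]
    ring
  have : DiscreteTopology (L.lattice ⊔ Submodule.span ℤ {α} : Submodule ℤ ℂ) := by
    refine DiscreteTopology.of_continuous_injective
      (f := fun w => (⟨n * w.1, hmem w⟩ : L.lattice)) (by fun_prop) fun w w' h => ?_
    exact Subtype.ext (mul_left_cancel₀ (Int.cast_ne_zero.2 hn) (congrArg Subtype.val h))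
  have : IsZLattice ℝ (L.lattice ⊔ Submodule.span ℤ {α} : Submodule ℤ ℂ) := by
    refine ⟨top_le_iff.1 ?_⟩
    rw [← IsZLattice.span_top (K := ℝ) (L := L.lattice)]
    exact Submodule.span_mono fun x hx => Submodule.mem_sup_left hx
  exact exists_lattice_eq _

theorem im_div_ne_zero (L : PeriodPair) : (L.ω₂ / L.ω₁).im ≠ 0 := by
  intro h
  have h0 : L.ω₁ ≠ 0 := L.indep.ne_zero 0
  have h1 := LinearIndependent.pair_iff.1 L.indep (-(L.ω₂ / L.ω₁).re) 1 (by
    have h2 : (((L.ω₂ / L.ω₁).re : ℝ) : ℂ) = L.ω₂ / L.ω₁ := Complex.ext rfl (by simp [h])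
    rw [Complex.real_smul, Complex.ofReal_neg, h2, one_smul, neg_mul, div_mul_cancel₀ _ h0,
      neg_add_cancel])
  exact one_ne_zero h1.2

/-- Scale by ω₁⁻¹; if ω₂/ω₁ lies in the lower half plane, its negative spans the same lattice with
1. -/
theorem exists_tauPair (L : PeriodPair) : ∃ τ : UpperHalfPlane, ∃ c : ℂ, c ≠ 0 ∧
    ∀ w : ℂ, w ∈ L.lattice ↔ c * w ∈ (tauPair τ).lattice := by
  have h0 : L.ω₁ ≠ 0 := L.indep.ne_zero 0
  have key : ∀ m n w : ℂ, m * L.ω₁ + n * L.ω₂ = w ↔ m + n * (L.ω₂ / L.ω₁) = L.ω₁⁻¹ * w := by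
    intro m n w
    rw [← mul_right_inj' (inv_ne_zero h0)]
    field_simp
  rcases L.im_div_ne_zero.lt_or_gt with h | h
  · refine ⟨⟨-(L.ω₂ / L.ω₁), by simpa using h⟩, L.ω₁⁻¹, inv_ne_zero h0, fun w => ?_⟩
    rw [mem_lattice, mem_lattice]
    constructor
    · rintro ⟨m, n, hmn⟩
      refine ⟨m, -n, ?_⟩
      rw [← (key _ _ _).1 hmn]
      simp [tauPair]
    · rintro ⟨m, n, hmn⟩
      refine ⟨m, -n, (key _ _ _).2 ?_⟩
      rw [← hmn]
      simp [tauPair]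
  · refine ⟨⟨L.ω₂ / L.ω₁, h⟩, L.ω₁⁻¹, inv_ne_zero h0, fun w => ?_⟩
    rw [mem_lattice, mem_lattice]
    simp [key, tauPair]

section Homothety

variable {K L : PeriodPair} {c : ℂ} (hc : c ≠ 0) (h : ∀ w : ℂ, w ∈ L.lattice ↔ c * w ∈ K.lattice)

include hc h

theorem G_of_homothety (n : ℕ) : K.G n = c⁻¹ ^ n * L.G n := by
  let e : L.lattice ≃ K.lattice :=
    { toFun := fun l => ⟨c * l, (h l).1 l.2⟩
      invFun := fun l => ⟨c⁻¹ * l, (h _).2 (by rw [mul_inv_cancel_left₀ hc]; exact l.2)⟩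
      left_inv := fun l => Subtype.ext (inv_mul_cancel_left₀ hc _)
      right_inv := fun l => Subtype.ext (mul_inv_cancel_left₀ hc _) }
  rw [G, G, ← e.tsum_eq, ← tsum_mul_left]
  refine tsum_congr fun l => ?_
  change ((c * (l : ℂ)) ^ n)⁻¹ = _
  rw [mul_pow, mul_inv, inv_pow]

/-- Homogeneity: g₂ and g₃ have weights 4 and 6, so with x of weight 2 every term of the cubic has
weight 6. -/
theorem cubic_of_homothety (x : ℂ) :
    K.cubic.eval (c⁻¹ ^ 2 * x) = c⁻¹ ^ 6 * L.cubic.eval x := by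
  rw [eval_cubic, eval_cubic, g₂, g₃, g₂, g₃, G_of_homothety hc h, G_of_homothety hc h]
  ring

end Homothety

end PeriodPair

/-! ### From the normal form to an isomorphism with 𝔖_τ -/

theorem lie_combination {R A : Type*} [CommRing R] [LieRing A] [LieAlgebra R A] {E F H : A}
    (hE : ⁅H, E⁆ = (2 : R) • E) (hF : ⁅H, F⁆ = (-2 : R) • F) (a b c a' b' c' : R) :
    ⁅a • E + b • F + c • H, a' • E + b' • F + c' • H⁆ =
      (2 * (c * a' - a * c')) • E + (-2 * (c * b' - b * c')) • F + (a * b' - b * a') • ⁅E, F⁆ := by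
  have hE' : ⁅E, H⁆ = (-2 : R) • E := by rw [← lie_skew, hE, neg_smul]
  have hF' : ⁅F, H⁆ = (2 : R) • F := by rw [← lie_skew, hF, neg_smul, neg_neg]
  have hEF : ⁅F, E⁆ = -⁅E, F⁆ := (lie_skew F E).symm
  simp only [add_lie, lie_add, smul_lie, lie_smul, lie_self, hE, hF, hE', hF', hEF]
  module

section NormalForm

variable {L : PeriodPair} {Γ : Type} [Group Γ] {σ : Γ →* Torus.Aut L} {ρ : Γ →* Sl2.Aut}
  {E F H : CurrentAlgebra σ}

theorem IsNormalForm.smul {p : RegFun σ} (h : IsNormalForm ρ σ E F H p) {k : ℂ} (hk : k ≠ 0) :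
    IsNormalForm ρ σ (k • E) (k • F) H (k ^ 2 • p) where
  mem_E := (automorphicLieAlgebra ρ σ).smul_mem k h.mem_E
  mem_F := (automorphicLieAlgebra ρ σ).smul_mem k h.mem_F
  mem_H := h.mem_H
  mem_p := (RegFun.invariants σ).smul_mem h.mem_p _
  existsUnique_coeff X hX := by
    have key : ∀ (u : RegFun σ) (Y : CurrentAlgebra σ), u • k • Y = (k • u) • Y := fun u Y =>
      CurrentAlgebra.ext_eval fun z => by
        rw [CurrentAlgebra.eval_smul, CurrentAlgebra.eval_smul, LinearMap.map_smul, smul_smul,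
          mul_comm]
        rfl
    obtain ⟨c, hc, huniq⟩ := h.existsUnique_coeff X hX
    refine ⟨![k⁻¹ • c 0, k⁻¹ • c 1, c 2], ?_, fun c' hc' => ?_⟩
    · simp only [key, Matrix.cons_val_zero, Matrix.cons_val_one, Matrix.cons_val, SetLike.val_smul,
        smul_inv_smul₀ hk]
      exact hc
    · have h1 := huniq ![k • c' 0, k • c' 1, c' 2] (by
        simp only [key] at hc'
        exact hc')
      rw [← h1]
      funext i
      fin_cases i
      · exact (inv_smul_smul₀ hk _).symm
      · exact (inv_smul_smul₀ hk _).symm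
      · rfl
  lie_H_E := CurrentAlgebra.ext_eval fun z => by
    rw [CurrentAlgebra.eval_lie, map_smul, lie_smul, ← CurrentAlgebra.eval_lie, h.lie_H_E]
    simp only [map_smul]
    rw [smul_comm]
  lie_H_F := CurrentAlgebra.ext_eval fun z => by
    rw [CurrentAlgebra.eval_lie, map_smul, lie_smul, ← CurrentAlgebra.eval_lie, h.lie_H_F]
    simp only [map_smul]
    rw [smul_comm]
  lie_E_F := CurrentAlgebra.ext_eval fun z => by
    rw [CurrentAlgebra.eval_lie, map_smul, map_smul, lie_smul, smul_lie, ← CurrentAlgebra.eval_lie,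
      h.lie_E_F, CurrentAlgebra.eval_smul, CurrentAlgebra.eval_smul, smul_smul, smul_smul]
    congr 1
    rw [← sq]
    rfl

theorem CurrentAlgebra.eval_aeval_combination (x : RegFun σ) (z : PuncturedTorus σ)
    {p : ℂ[X]} (u : TwistedCurrent p) :
    eval σ z (aeval x (u 0) • E + aeval x (u 1) • F + aeval x (u 2) • H) =
      (u 0).eval (x.1 z) • eval σ z E + (u 1).eval (x.1 z) • eval σ z F +
        (u 2).eval (x.1 z) • eval σ z H := by
  rw [map_add, map_add, eval_smul, eval_smul, eval_smul, RegFun.aeval_apply, RegFun.aeval_apply,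
    RegFun.aeval_apply]

/-- Transcendence of `x` identifies the invariants with ℂ[X], so the unique coefficients of the
normal form are polynomials. Compatibility with brackets is checked pointwise in 𝔰𝔩₂. -/
theorem IsNormalForm.nonempty_lieEquiv {x : RegFun σ} {p : ℂ[X]}
    (h : IsNormalForm ρ σ E F H (aeval x p)) (hinv : RegFun.invariants σ = Algebra.adjoin ℂ {x})
    (hx : Function.Injective (aeval x : ℂ[X] →ₐ[ℂ] RegFun σ)) :
    Nonempty (automorphicLieAlgebra ρ σ ≃ₗ⁅ℂ⁆ TwistedCurrent p) := by
  have hmem : ∀ (q : ℂ[X]) {Y : CurrentAlgebra σ}, Y ∈ automorphicLieAlgebra ρ σ →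
      aeval x q • Y ∈ automorphicLieAlgebra ρ σ := by
    intro q Y hY
    have hq : aeval x q ∈ RegFun.invariants σ := hinv ▸ aeval_mem_adjoin_singleton ℂ x
    rw [RegFun.mem_invariants_iff] at hq
    rw [CurrentAlgebra.mem_automorphicLieAlgebra_iff] at hY ⊢
    intro γ z hz
    rw [CurrentAlgebra.eval_smul, CurrentAlgebra.eval_smul, map_smul, hY, hq]
  let φ : TwistedCurrent p →ₗ⁅ℂ⁆ automorphicLieAlgebra ρ σ :=
    { toFun := fun u => ⟨aeval x (u 0) • E + aeval x (u 1) • F + aeval x (u 2) • H,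
        add_mem (add_mem (hmem _ h.mem_E) (hmem _ h.mem_F)) (hmem _ h.mem_H)⟩
      map_add' := fun u v => Subtype.ext (CurrentAlgebra.ext_eval fun z => by
        refine (CurrentAlgebra.eval_aeval_combination x z (u + v)).trans ?_
        refine Eq.trans ?_ (map_add (CurrentAlgebra.eval σ z) _ _).symm
        rw [CurrentAlgebra.eval_aeval_combination x z u, CurrentAlgebra.eval_aeval_combination x z v]
        simp only [TwistedCurrent.add_apply, eval_add]
        module)
      map_smul' := fun c u => Subtype.ext (CurrentAlgebra.ext_eval fun z => by
        refine (CurrentAlgebra.eval_aeval_combination x z (c • u)).trans ?_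
        refine Eq.trans ?_ (map_smul (CurrentAlgebra.eval σ z) c _).symm
        rw [CurrentAlgebra.eval_aeval_combination x z u]
        simp only [TwistedCurrent.smul_apply, eval_smul, smul_add, smul_assoc])
      map_lie' := fun {u v} => Subtype.ext (CurrentAlgebra.ext_eval fun z => by
        have hE := (CurrentAlgebra.eval_lie z H E).symm.trans (congrArg _ h.lie_H_E)
        have hF := (CurrentAlgebra.eval_lie z H F).symm.trans (congrArg _ h.lie_H_F)
        have hEF := (CurrentAlgebra.eval_lie z E F).symm.trans (congrArg _ h.lie_E_F)
        rw [LinearMap.map_smul] at hE hF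
        rw [CurrentAlgebra.eval_smul] at hEF
        refine (CurrentAlgebra.eval_aeval_combination x z ⁅u, v⁆).trans ?_
        refine Eq.trans ?_ (CurrentAlgebra.eval_lie z _ _).symm
        rw [CurrentAlgebra.eval_aeval_combination x z u, CurrentAlgebra.eval_aeval_combination x z v,
          lie_combination hE hF, hEF, RegFun.aeval_apply, smul_smul]
        simp only [TwistedCurrent.lie_apply_zero, TwistedCurrent.lie_apply_one,
          TwistedCurrent.lie_apply_two, eval_mul, eval_sub, eval_neg, eval_ofNat,
          mul_comm (p.eval _)]) }
  have hinj : Function.Injective φ := by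
    intro u v huv
    obtain ⟨c, -, hc⟩ := h.existsUnique_coeff _ (φ u).2
    have hq : ∀ q : ℂ[X], aeval x q ∈ RegFun.invariants σ := fun q =>
      hinv ▸ aeval_mem_adjoin_singleton ℂ x
    have hu := hc (fun i => ⟨aeval x (u i), hq _⟩) rfl
    have hv := hc (fun i => ⟨aeval x (v i), hq _⟩) (congrArg Subtype.val huv)
    funext i
    exact hx (congrArg Subtype.val (congrFun (hu.trans hv.symm) i))
  have hsurj : Function.Surjective φ := by
    rintro ⟨X, hX⟩
    obtain ⟨c, hc, -⟩ := h.existsUnique_coeff X hX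
    have hq : ∀ i, ∃ q : ℂ[X], aeval x q = (c i).1 := fun i => by
      have h1 : (c i).1 ∈ Algebra.adjoin ℂ {x} := hinv ▸ (c i).2
      rw [Algebra.adjoin_singleton_eq_range_aeval] at h1
      exact h1
    choose q hq using hq
    refine ⟨q, Subtype.ext ?_⟩
    change aeval x (q 0) • E + aeval x (q 1) • F + aeval x (q 2) • H = X
    rw [hq, hq, hq]
    exact hc.symm
  exact ⟨(LieEquiv.ofBijective φ ⟨hinj, hsurj⟩).symm⟩

theorem RegFun.aeval_injective {L' : PeriodPair}
    (hp : ∀ w, Torus.mk L w ∈ punctures σ ↔ w ∈ L'.lattice) {x : RegFun σ}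
    (hx : ∀ z ∉ L'.lattice, x.lift z = L'.weierstrassP z) :
    Function.Injective (aeval x : ℂ[X] →ₐ[ℂ] RegFun σ) := by
  rw [injective_iff_map_eq_zero]
  intro q hq
  refine L'.eq_zero_of_forall_eval_weierstrassP_eq_zero fun z hz => ?_
  have hz' : Torus.mk L z ∉ punctures σ := by rwa [hp]
  rw [← hx z hz, ← lift_aeval x q hz', hq, lift_of_notMem _ hz']
  rfl

theorem aeval_smul_eq {A : Type*} [CommRing A] [Algebra ℂ A] (x : A) (k : ℂ) (q : ℂ[X]) :
    aeval (k • x) q = aeval x (q.comp (C k * X)) := by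
  rw [aeval_comp]
  simp [Algebra.smul_def]

/-- A normal form over `ℂ[℘]` identifies the automorphic Lie algebra with the twisted current
algebra of any homothetic lattice. -/
theorem IsNormalForm.nonempty_lieEquiv_of_homothety {K L' : PeriodPair}
    (hp : ∀ w, Torus.mk L w ∈ punctures σ ↔ w ∈ L'.lattice) {x : RegFun σ}
    (hx : ∀ z ∉ L'.lattice, x.lift z = L'.weierstrassP z)
    (h : IsNormalForm ρ σ E F H (aeval x L'.cubic))
    (hinv : RegFun.invariants σ = Algebra.adjoin ℂ {x}) {c : ℂ} (hc : c ≠ 0)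
    (hK : ∀ w : ℂ, w ∈ L'.lattice ↔ c * w ∈ K.lattice) :
    Nonempty (automorphicLieAlgebra ρ σ ≃ₗ⁅ℂ⁆ TwistedCurrent K.cubic) := by
  have hk : c⁻¹ ≠ 0 := inv_ne_zero hc
  -- The generator ℘ is replaced by c⁻²℘. The resulting factor c⁻⁶ = (c⁻³)² is a square and is
  -- absorbed by scaling E and F by c⁻³.
  have hcubic : K.cubic.comp (C (c⁻¹ ^ 2) * X) = (c⁻¹ ^ 3) ^ 2 • L'.cubic := by
    refine Polynomial.funext fun t => ?_
    rw [eval_comp, eval_smul, eval_mul, eval_C, eval_X, PeriodPair.cubic_of_homothety hc hK,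
      smul_eq_mul, ← pow_mul]
  have h1 : IsNormalForm ρ σ (c⁻¹ ^ 3 • E) (c⁻¹ ^ 3 • F) H (aeval (c⁻¹ ^ 2 • x) K.cubic) := by
    rw [aeval_smul_eq, hcubic, map_smul]
    exact h.smul (pow_ne_zero 3 hk)
  refine h1.nonempty_lieEquiv ?_ ?_
  · rw [hinv]
    apply le_antisymm
    · rw [Algebra.adjoin_le_iff, Set.singleton_subset_iff]
      have h2 := (Algebra.adjoin ℂ {c⁻¹ ^ 2 • x}).smul_mem
        (Algebra.self_mem_adjoin_singleton ℂ (c⁻¹ ^ 2 • x)) (c⁻¹ ^ 2)⁻¹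
      rwa [inv_smul_smul₀ (pow_ne_zero 2 hk)] at h2
    · rw [Algebra.adjoin_le_iff, Set.singleton_subset_iff]
      exact (Algebra.adjoin ℂ {x}).smul_mem (Algebra.self_mem_adjoin_singleton ℂ x) _
  · rw [injective_iff_map_eq_zero]
    intro q hq
    rw [aeval_smul_eq] at hq
    exact (comp_C_mul_X_eq_zero_iff (mem_nonZeroDivisors_of_ne_zero (pow_ne_zero 2 hk))).1
      ((injective_iff_map_eq_zero _).1 (RegFun.aeval_injective hp hx) _ hq)

end NormalForm

/-! ### The intertwiner for a given action, and the theorem -/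

section Intertwiner

open DihedralGroup

variable {L L' : PeriodPair} {N : ℕ} {α : ℂ} {ρ : DihedralGroup N →* Sl2.Aut}

theorem exists_intertwiner (hN : 1 ≤ N) (hρ : Function.Injective ρ)
    (hα : ∀ k : ℤ, k * α ∈ L.lattice ↔ (N : ℤ) ∣ k)
    (hL' : L'.lattice = L.lattice ⊔ Submodule.span ℤ {α}) :
    ∃ (A : GL (Fin 2) ℂ) (Φ : ℂ → Matrix (Fin 2) (Fin 2) ℂ), IsIntertwiner L N α Φ ∧
      ∃ D S : GL (Fin 2) ℂ, L.IsFrame L' α D.1 S.1 Φ ∧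
        ρ (r 1) = Sl2.adHom (A * D * A⁻¹) ∧ ρ (sr 0) = Sl2.adHom (A * S * A⁻¹) := by
  rcases hN.eq_or_lt with rfl | hN
  · obtain ⟨A, hD, hS⟩ := Sl2.exists_conj_of_one hρ
    exact ⟨A, _, Or.inl ⟨rfl, rfl⟩, 1, Sl2.reflection, PeriodPair.isFrame_one, hD, hS⟩
  · obtain ⟨A, j, hj, hD, hS⟩ := Sl2.exists_conj_of_two_le hN hρ
    obtain ⟨l, m, hm, hrel⟩ := (PeriodPair.isTorsionExtension_hat hN hα hL').exists_relation
      (PeriodPair.not_hatOrder_dvd hN hj)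
    rw [hL'] at hrel
    exact ⟨A, _, Or.inr ⟨hN, j, hj, l, m, hm, hrel, rfl⟩, Sl2.diagRootUnit (hatOrder N) j,
      Sl2.swap, PeriodPair.isFrame_phiMatrix hN hα hL' hm hrel, hD, hS⟩

end Intertwiner

end

theorem mainTheorem4 (L : PeriodPair) (N : ℕ) (hN : 1 ≤ N)
    (ρ : DihedralGroup N →* Sl2.Aut) (hρ : Function.Injective ρ)
    (σ : DihedralGroup N →* Torus.Aut L) (hσ : Function.Injective σ)
    (hs : ∀ z : Torus L, (σ (DihedralGroup.sr 0)).1 z = -z)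
    (α : ℂ) (hr : ∀ z : Torus L, (σ (DihedralGroup.r 1)).1 z = z + Torus.mk L α) :
    -- the lattice `Λ_(α) = Λ + ℤα`
    ∃ L' : PeriodPair, L'.lattice = L.lattice ⊔ Submodule.span ℤ {α} ∧
      -- the isomorphism type; `ℂ / Λ_(α)` is isomorphic to `ℂ / (ℤ ⊕ ℤτ)`
      (∃ τ : UpperHalfPlane,
        (∃ c : ℂ, c ≠ 0 ∧ ∀ w : ℂ, w ∈ L'.lattice ↔ c * w ∈ (tauPair τ).lattice) ∧
        Nonempty (automorphicLieAlgebra ρ σ ≃ₗ⁅ℂ⁆ STau τ)) ∧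
      -- the normal form
      ∃ (B : Sl2.Aut) (Φ : ℂ → Matrix (Fin 2) (Fin 2) ℂ), IsIntertwiner L N α Φ ∧
      ∃ E F H : CurrentAlgebra σ,
        (∀ (z : ℂ) (hz : Torus.mk L z ∉ punctures σ),
          CurrentAlgebra.eval σ ⟨Torus.mk L z, hz⟩ E = B.1 (Sl2.Ad (Φ z) Sl2.e) ∧
          CurrentAlgebra.eval σ ⟨Torus.mk L z, hz⟩ F = B.1 (Sl2.Ad (Φ z) Sl2.f) ∧
          CurrentAlgebra.eval σ ⟨Torus.mk L z, hz⟩ H = B.1 (Sl2.Ad (Φ z) Sl2.h)) ∧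
      -- the functions `℘` and `℘'` of the lattice `Λ_(α)`, as elements of `𝒪_𝕋`
      ∃ x y : RegFun σ,
        (∀ (z : ℂ) (hz : Torus.mk L z ∉ punctures σ),
          x.1 ⟨Torus.mk L z, hz⟩ = L'.weierstrassP z ∧
          y.1 ⟨Torus.mk L z, hz⟩ = L'.derivWeierstrassP z) ∧
        RegFun.invariants σ = Algebra.adjoin ℂ {x} ∧
        IsNormalForm ρ σ (y • E) (y • F) H (Polynomial.aeval x L'.cubic) := by
  have : NeZero N := ⟨by omega⟩
  have hα := intCast_mul_mem_lattice_iff hσ hr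
  obtain ⟨L', hL'⟩ := L.exists_lattice_eq_sup (n := N) (by exact_mod_cast (by omega : N ≠ 0))
    ((hα N).2 dvd_rfl)
  have hp := mk_mem_punctures_iff hs hr hL'
  obtain ⟨τ, c, hc, hτ⟩ := L'.exists_tauPair
  obtain ⟨A, Φ, hΦ, D, S, hframe, hD, hS⟩ := exists_intertwiner hN hρ hα hL'
  have hΨ := hframe.conj (Sl2.isUnit_det A)
  -- The conjugating matrix `A` supplies B = Ad A, and AΦ is a frame for ρ itself.
  have hA : ∀ z v, (Sl2.adHom A).1 (Sl2.Ad (Φ z) v) = Sl2.Ad (A.1 * Φ z) v := fun z v => by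
    rw [Sl2.adHom_apply, Sl2.Ad_mul]
  have hΨ' : L.IsFrame L' α (A * D * A⁻¹).1 (A * S * A⁻¹).1 fun z => A.1 * Φ z := by
    simpa only [Units.val_mul, Matrix.coe_units_inv] using hΨ
  obtain ⟨E, hE⟩ := hΨ.exists_isRegular_lift hp Sl2.e
  obtain ⟨F, hF⟩ := hΨ.exists_isRegular_lift hp Sl2.f
  obtain ⟨H, hH⟩ := hΨ.exists_isRegular_lift hp Sl2.h
  obtain ⟨x, hx⟩ := RegFun.exists_of_periodic hp L'.weierstrassP_isRegular.1
    L'.weierstrassP_isRegular.2 fun l hl => L'.weierstrassP_add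
      (by rw [hL']; exact Submodule.mem_sup_left hl)
  obtain ⟨y, hy⟩ := RegFun.exists_of_periodic hp L'.derivWeierstrassP_isRegular.1
    L'.derivWeierstrassP_isRegular.2 fun l hl => L'.derivWeierstrassP_add
      (by rw [hL']; exact Submodule.mem_sup_left hl)
  have hinv := RegFun.invariants_eq_adjoin hL' hr hs hx
  have hnf := isNormalForm_of_isFrame hL' hr hs hΨ' hD hS hE hF hH hx hy
  refine ⟨L', hL', ⟨τ, ⟨c, hc, hτ⟩, hnf.nonempty_lieEquiv_of_homothety hp hx hinv hc hτ⟩,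
    Sl2.adHom A, Φ, hΦ, E, F, H, fun z hz => ?_, x, y, fun z hz => ?_, hinv, hnf⟩
  · have hz' : z ∉ L'.lattice := by rwa [← hp]
    simp only [hA]
    rw [← CurrentAlgebra.lift_of_notMem E hz, ← CurrentAlgebra.lift_of_notMem F hz,
      ← CurrentAlgebra.lift_of_notMem H hz]
    exact ⟨hE z hz', hF z hz', hH z hz'⟩
  · have hz' : z ∉ L'.lattice := by rwa [← hp]
    rw [← x.lift_of_notMem hz, ← y.lift_of_notMem hz]
    exact ⟨hx z hz', hy z hz'⟩
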